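/- **Setting.** Let $\mathcal X,\mathcal Y$ be countable sets of prompts and responses, $\rho$ a distribution on $\mathcal X$; a policy is a map $\pi:\mathcal X\to\Delta(\mathcal Y)$. Fix policies $\pi_{\rm ref},\pi_{\rm base}$, and $B\ge 1$, $\beta>0$, $\eta>0$, $C\in\mathbb R$. There are $m$ objectives with known features $\phi_i:\mathcal X\times\mathcal Y\to\mathbb R^d$, $\|\phi_i\|_2\le 1$, and rewards $r_i^{\theta}=\langle\theta,\phi_i\rangle$ with $\theta\in\Theta_i=\{\theta:\|\theta\|_2\le B,\ 0\le r_i^\theta\le B,\ \mathbb E_{\pi_{\rm base}}r_i^\theta=C\}$. The true rewards are $r_i^*=r_i^{\theta_i^*}$ with $\theta_i^*\in\Theta_i$. There are $N$ groups; group $n$ has weights $\alpha^{*,(n)}\in\Delta_{m-1}$, parameters $p^{(n)}\le1$, $p^{(n)}\neq0$, $c^{(n)}\in\mathbb R$, and target set $W^{(n)}=W^{\alpha^{*,(n)}}_{p^{(n)},c^{(n)}}$, where $W_{p,c}^\alpha=\{z\in\mathbb R^m_{\ge0}:(\sum_i\alpha_iz_i^p)^{1/p}\ge c\}$. Let $\mathrm{KL}(\pi)=\mathbb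 E_{x\sim\rho}\mathrm{KL}(\pi(\cdot|x)\|\pi_{\rm ref}(\cdot|x))$ and, for $\mathrm{KL}(\pi)<\infty$, $S^\theta(\pi)_i=\mathbb E_\pi[r_i^{\theta_i}]-\beta\,\mathrm{KL}(\pi)$, $J(r^\theta,e,\pi)=\sum_ie_iS^\theta(\pi)_i$. The goal is either consensus, $D(\pi)=d(S^{\theta^*}(\pi),\bigcap_nW^{(n)})$, or malfare, $D(\pi)=(\sum_n\zeta_n d(S^{\theta^*}(\pi),W^{(n)})^{2q})^{1/(2q)}$ with $\zeta_n>0$, $\sum_n\zeta_n=1$, $q\ge1$. An optimal policy $\pi^*$ is a minimiser of $D$ over the policies with finite $\mathrm{KL}$ such that no other such policy strictly increases every coordinate of $S^{\theta^*}$ (the latter is automatic when $\min D>0$). **Gap assumption.** $\gamma>0$ and $\min_i\mathbb E_{x\sim\rho,\,y_1\sim\pi^*,\,y_2\sim\pi_{\rm ref}}|r_i^*(x,y_1)-r_i^*(x,y_2)|\ge\gamma$ for an optimal policy $\pi^*$. **Algorithm.** In round $t=1,\dots,T$, using the data of rounds $s<t$: 1. $\tilde\theta_i^t\in\arg\min_{\theta\in\Theta_i}L_i^t(\theta)$,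 where $L_i^t(\theta)=-\sum\log\sigma(r_i^\theta(x,y_w)-r_i^\theta(x,y_l))$ runs over all preferences on objective $i$ reported so far (by all groups) and $\sigma(z)=1/(1+e^{-z})$. 2. $\hat\alpha^{t,(n)}\in\arg\max_{\alpha\in\Delta_{m-1}}\sum_{s<t}\log\mathbb P(I^{s,(n)}\mid\alpha,r^{\tilde\theta^t},x^s,y_1^s,y_2^s)$, where $\mathbb P(I=i\mid\alpha,r,x,y_1,y_2)\propto\exp(\alpha_i|r_i(x,y_1)-r_i(x,y_2)|)$; and $\alpha^{t,(n)}=\frac{t-1}t\alpha^{t-1,(n)}+\frac1t\hat\alpha^{t,(n)}$. 3. With the current direction $\overline{d^t}$ ($\overline{d^1}\in\Delta_{m-1}$ arbitrary): $\theta^t$ maximises $\max_\pi J(r^\theta,\overline{d^t},\pi)-\eta\sum_iL_i^t(\theta_i)$ over $\prod_i\Theta_i$ and $\pi^t$ maximises $J(r^{\theta^t},\overline{d^t},\cdot)$; or $\theta^t,\pi^t$ are given by the reward-free form, in which $\theta^t$ minimises $\beta\,\mathbb E_{\pi_{\rm base}}\log\frac{\pi^\theta(y|x)}{\pi_{\rm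 ref}(y|x)}-\eta\sum_i\ell_i^t(\theta_i)$ and $\pi^t=\pi^{\theta^t}$, where $\pi^\theta\propto\pi_{\rm ref}\exp(\frac1\beta\sum_i\overline{d^t_i}r_i^{\theta_i})$ and $\ell_i^t(\theta_i)=\sum\log\sigma\big(\beta\log\frac{\pi_{\theta_i}(y_w|x)}{\pi_{\rm ref}(y_w|x)}-\beta\log\frac{\pi_{\theta_i}(y_l|x)}{\pi_{\rm ref}(y_l|x)}\big)$ over the same data as $L_i^t$, with $\pi_{\theta_i}\propto\pi_{\rm ref}\exp(r_i^{\theta_i}/\beta)$. 4. Draw $x^t\sim\rho$, $y_1^t,y_2^t\sim\pi^t(\cdot|x^t)$. Given these, independently for each $n$, group $n$ reports $I^{t,(n)}\sim\mathbb P(\cdot\mid\alpha^{*,(n)},r^*,x^t,y_1^t,y_2^t)$ and prefers $y_1^t$ to $y_2^t$ with probability $\sigma(r^*_I(x^t,y_1^t)-r^*_I(x^t,y_2^t))$, $I=I^{t,(n)}$. 5. Let $\overline V^t=\frac1t\sum_{s\le t}S^{\theta^s}(\pi^s)$ and $W^{t,(n)}=W^{\alpha^{t,(n)}}_{p^{(n)},c^{(n)}}$.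 With $\mathrm{Proj}(W,V)=\frac{\Pi_W(V)-V}{\|\Pi_W(V)-V\|}$ ($0$ if $V\in W$), put $d^{t+1}=\mathrm{Proj}(\bigcap_nW^{t,(n)},\overline V^t)$ for consensus, $d^{t+1}=\sum_n\mathrm{Proj}(W^{t,(n)},\overline V^t)\frac{\zeta_n d(\overline V^t,W^{t,(n)})^{2q-1}}{(\sum_{n'}\zeta_{n'}d(\overline V^t,W^{t,(n')})^{2q})^{(2q-1)/(2q)}}$ for malfare, and $\overline{d^{t+1}}=d^{t+1}/\|d^{t+1}\|_1$; if $\overline V^t$ lies in all $W^{t,(n)}$, $\overline{d^{t+1}}\in\Delta_{m-1}$ is arbitrary. Ties in the optimisation steps may be broken arbitrarily, as a function of the past. **Theorem (Estimation of $\alpha$).** There are a polynomial $P$ in five variables and an integer $k$, both universal, such that for every instance and execution as above, every group $n$, every $t\in\{1,\dots,T\}$ and every $\delta\in(0,1)$, with probability at least $1-\delta$, $$\|\alpha^{*,(n)}-\alpha^{t,(n)}\|_\infty\le\frac1t\sum_{s=1}^t\|\alpha^{*,(n)}-\hat\alpha^{s,(n)}\|_\infty\le\gamma^{-1}\,P\big(m,e^B,e^{B/\beta},d,\log(1/\delta)\big)\,(1+\log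 t)^k\cdot\frac1{\sqrt t}.$$ -/

import Mathlib

open MeasureTheory ProbabilityTheory

noncomputable section

namespace MORLHF

/-- What is optimised across the `N` groups: consensus, or malfare with group weights `ζ` and
exponent `q`. -/
inductive Goal (N : ℕ) where
  | consensus : Goal N
  | malfare (ζ : Fin N → ℝ) (q : ℝ) : Goal N

/-- The standing requirements on the goal: positive group weights of total one, and `1 ≤ q`. -/
def Goal.Valid {N : ℕ} : Goal N → Prop
  | .consensus => True
  | .malfare ζ q => (∀ n, 0 < ζ n) ∧ ∑ n, ζ n = 1 ∧ 1 ≤ q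

/-- The target set `{z ≥ 0 : (∑ i, α i * z i ^ p) ^ (1 / p) ≥ c}`.  The power mean is computed in
`[0, ∞]`, so that `0 ^ p = ∞` and `∞ ^ (1 / p) = 0` when `p < 0`, and `0 * ∞ = 0`. -/
def targetSet {m : ℕ} (p c : ℝ) (α : Fin m → ℝ) : Set (EuclideanSpace ℝ (Fin m)) :=
  {z | (∀ i, 0 ≤ z i) ∧
    ENNReal.ofReal c ≤
      (∑ i, ENNReal.ofReal (α i) * ENNReal.ofReal (z i) ^ p) ^ (1 / p)}

/-- The distance of the point `z` to the target sets `W n` in the sense of the goal: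
`d(z, ⋂ n, W n)` for consensus, `(∑ n, ζ n * d(z, W n) ^ (2q)) ^ (1 / (2q))` for malfare. -/
def Goal.loss {N m : ℕ} (G : Goal N) (W : Fin N → Set (EuclideanSpace ℝ (Fin m)))
    (z : EuclideanSpace ℝ (Fin m)) : ℝ :=
  match G with
  | .consensus => Metric.infDist z (⋂ n, W n)
  | .malfare ζ q => (∑ n, ζ n * Metric.infDist z (W n) ^ (2 * q)) ^ (1 / (2 * q))

/-- `P` is a Euclidean projection of `V` onto `W`. -/
def IsProj {m : ℕ} (W : Set (EuclideanSpace ℝ (Fin m))) (V P : EuclideanSpace ℝ (Fin m)) : Prop :=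
  P ∈ W ∧ dist V P = Metric.infDist V W

/-- The vector `v` divided by its `ℓ¹` norm. -/
def normalizeOne {m : ℕ} (v : EuclideanSpace ℝ (Fin m)) : Fin m → ℝ :=
  fun i => v i / ∑ j, |v j|

/-- `e` is the (`ℓ¹`-normalised) direction which the algorithm may take from the current average
`V` towards the target sets `W n`.  When every target set that matters already contains `V`, the
quotient that defines the direction is `0 / 0`, and `e` may be any point of the simplex. -/
def Goal.IsDirection {N m : ℕ} (G : Goal N) (W : Fin N → Set (EuclideanSpace ℝ (Fin m)))
    (V : EuclideanSpace ℝ (Fin m)) (e : Fin m → ℝ) : Prop :=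
  match G with
  | .consensus =>
      (V ∈ ⋂ n, W n → e ∈ stdSimplex ℝ (Fin m)) ∧
      (V ∉ ⋂ n, W n → ∃ P, IsProj (⋂ n, W n) V P ∧
        e = normalizeOne ((1 / ‖P - V‖) • (P - V)))
  | .malfare ζ q =>
      ((∀ n, V ∈ W n) → e ∈ stdSimplex ℝ (Fin m)) ∧
      ((¬ ∀ n, V ∈ W n) → ∃ P : Fin N → EuclideanSpace ℝ (Fin m),
        (∀ n, IsProj (W n) V (P n)) ∧
        e = normalizeOne (∑ n,
          (ζ n * Metric.infDist V (W n) ^ (2 * q - 1) /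
            (∑ n', ζ n' * Metric.infDist V (W n') ^ (2 * q)) ^ ((2 * q - 1) / (2 * q))) •
          ((1 / ‖P n - V‖) • (P n - V))))

/-- The softmax probability `∝ exp (α i * |r i (x, y₁) - r i (x, y₂)|)` that the objective `i` is
reported, where `u i`, `v i` are the rewards of the two responses for the objective `i`. -/
def objectiveProb {m : ℕ} (α u v : Fin m → ℝ) (i : Fin m) : ℝ :=
  Real.exp (α i * |u i - v i|) / ∑ j, Real.exp (α j * |u j - v j|)

/-- The data of one round: the prompt, the two responses, and for each group `n` the objective
which it reports and its preference on that objective (`true` when `y₁` is preferred). -/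
structure Round (𝒳 𝒴 : Type*) (N m : ℕ) where
  x : 𝒳
  y₁ : 𝒴
  y₂ : 𝒴
  obj : Fin N → Fin m
  pref : Fin N → Bool

/-- The preferred response of group `n`. -/
def Round.win {𝒳 𝒴 : Type*} {N m : ℕ} (o : Round 𝒳 𝒴 N m) (n : Fin N) : 𝒴 :=
  if o.pref n then o.y₁ else o.y₂

/-- The rejected response of group `n`. -/
def Round.lose {𝒳 𝒴 : Type*} {N m : ℕ} (o : Round 𝒳 𝒴 N m) (n : Fin N) : 𝒴 :=
  if o.pref n then o.y₂ else o.y₁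

/-- The problem instance together with the inputs of the algorithm.  A policy is a map
`𝒳 → PMF 𝒴`. -/
structure Model (𝒳 𝒴 : Type*) (N m d : ℕ) where
  /-- distribution of the prompts -/
  ρ : PMF 𝒳
  /-- reference policy -/
  πref : 𝒳 → PMF 𝒴
  /-- baseline policy, which fixes the additive constant of the rewards -/
  πbase : 𝒳 → PMF 𝒴
  /-- feature maps of the objectives -/
  φ : Fin m → 𝒳 → 𝒴 → EuclideanSpace ℝ (Fin d)
  /-- bound of the rewards -/
  B : ℝ
  /-- weight of the KL regularisation -/
  β : ℝ
  /-- common mean of the rewards under the baseline policy -/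
  C : ℝ
  /-- weight of the log-likelihood in the optimistic step -/
  η : ℝ
  /-- true reward parameters -/
  θstar : Fin m → EuclideanSpace ℝ (Fin d)
  /-- true importance weights of the groups -/
  αstar : Fin N → Fin m → ℝ
  /-- exponents of the groups -/
  p : Fin N → ℝ
  /-- requirements of the groups -/
  c : Fin N → ℝ
  /-- consensus or malfare -/
  goal : Goal N

namespace Model

variable {𝒳 𝒴 : Type*} {N m d : ℕ} (M : Model 𝒳 𝒴 N m d)

/-- The linear reward `⟨θ, φ i (x, y)⟩` of the objective `i`. -/
def reward (i : Fin m) (θ : EuclideanSpace ℝ (Fin d)) (x : 𝒳) (y : 𝒴) : ℝ :=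
  inner ℝ θ (M.φ i x y)

/-- `𝔼 [g(x, y)]` for `x ∼ ρ`, `y ∼ π(· ∣ x)`; used for bounded `g` only. -/
def expect (π : 𝒳 → PMF 𝒴) (g : 𝒳 → 𝒴 → ℝ) : ℝ :=
  ∑' x, (M.ρ x).toReal * ∑' y, (π x y).toReal * g x y

/-- The parameter space `Θ i` of the objective `i`. -/
def paramSet (i : Fin m) : Set (EuclideanSpace ℝ (Fin d)) :=
  {θ | ‖θ‖ ≤ M.B ∧ (∀ x y, M.reward i θ x y ∈ Set.Icc 0 M.B) ∧
    M.expect M.πbase (M.reward i θ) = M.C}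

/-- The standing assumptions on the instance. -/
structure Valid : Prop where
  one_le_B : 1 ≤ M.B
  β_pos : 0 < M.β
  η_pos : 0 < M.η
  norm_φ_le : ∀ i x y, ‖M.φ i x y‖ ≤ 1
  θstar_mem : ∀ i, M.θstar i ∈ M.paramSet i
  αstar_mem : ∀ n, M.αstar n ∈ stdSimplex ℝ (Fin m)
  p_le_one : ∀ n, M.p n ≤ 1
  p_ne_zero : ∀ n, M.p n ≠ 0
  goal_valid : M.goal.Valid

section Policies

variable [MeasurableSpace 𝒴]

/-- The expected divergence `𝔼_{x ∼ ρ} KL(π(· ∣ x) ‖ πref(· ∣ x))`, in `[0, ∞]`. -/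
def kl (π : 𝒳 → PMF 𝒴) : ENNReal :=
  ∑' x, M.ρ x * InformationTheory.klDiv (π x).toMeasure (M.πref x).toMeasure

/-- The vector with the coordinates `𝔼_π [r i - β KL(π ‖ πref)]`, for the rewards with parameters
`θ`; used for policies of finite divergence only. -/
def rewardVector (θ : Fin m → EuclideanSpace ℝ (Fin d)) (π : 𝒳 → PMF 𝒴) :
    EuclideanSpace ℝ (Fin m) :=
  WithLp.toLp 2 fun i => M.expect π (M.reward i (θ i)) - M.β * (M.kl π).toReal

/-- The linearly aggregated objective `J(r^θ, e, π) = 𝔼_π [∑ i, e i * (r i - β KL(π ‖ πref))]`. -/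
def J (θ : Fin m → EuclideanSpace ℝ (Fin d)) (e : Fin m → ℝ) (π : 𝒳 → PMF 𝒴) : ℝ :=
  ∑ i, e i * M.rewardVector θ π i

/-- `max_π J(r^θ, e, π)`. -/
def maxJ (θ : Fin m → EuclideanSpace ℝ (Fin d)) (e : Fin m → ℝ) : ℝ :=
  sSup {v | ∃ π : 𝒳 → PMF 𝒴, M.kl π ≠ ⊤ ∧ v = M.J θ e π}

/-- `π` maximises `J(r^θ, e, ·)`; policies of infinite divergence have the value `-∞`. -/
def IsGreedy (θ : Fin m → EuclideanSpace ℝ (Fin d)) (e : Fin m → ℝ) (π : 𝒳 → PMF 𝒴) : Prop :=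
  M.kl π ≠ ⊤ ∧ ∀ π' : 𝒳 → PMF 𝒴, M.kl π' ≠ ⊤ → M.J θ e π' ≤ M.J θ e π

/-- The distance `D(π)` of the true expected reward vector of `π` to the true target sets. -/
def D (π : 𝒳 → PMF 𝒴) : ℝ :=
  M.goal.loss (fun n => targetSet (M.p n) (M.c n) (M.αstar n)) (M.rewardVector M.θstar π)

/-- `π` is an optimal policy: it minimises `D` and is (weakly) Pareto optimal.  The second clause
is automatic when the minimum is positive; when the minimum is `0`, it selects among the
minimisers. -/
structure IsOptimal (π : 𝒳 → PMF 𝒴) : Prop where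
  kl_ne_top : M.kl π ≠ ⊤
  minimal : ∀ π' : 𝒳 → PMF 𝒴, M.kl π' ≠ ⊤ → M.D π ≤ M.D π'
  pareto : ¬ ∃ π' : 𝒳 → PMF 𝒴, M.kl π' ≠ ⊤ ∧
    ∀ i, M.rewardVector M.θstar π i < M.rewardVector M.θstar π' i

end Policies

/-- `𝔼 |r* i (x, y₁) - r* i (x, y₂)|` for `x ∼ ρ`, `y₁ ∼ π(· ∣ x)`, `y₂ ∼ πref(· ∣ x)`. -/
def gap (π : 𝒳 → PMF 𝒴) (i : Fin m) : ℝ :=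
  M.expect π fun x y₁ => ∑' y₂, (M.πref x y₂).toReal *
    |M.reward i (M.θstar i) x y₁ - M.reward i (M.θstar i) x y₂|

/-- The probability that a round with policy `π` produces the data `o`: `x ∼ ρ`,
`y₁, y₂ ∼ π(· ∣ x)`, and each group independently reports an objective by the softmax model and
a preference on it by the Bradley–Terry model. -/
def roundProb (π : 𝒳 → PMF 𝒴) (o : Round 𝒳 𝒴 N m) : ℝ :=
  (M.ρ o.x).toReal * (π o.x o.y₁).toReal * (π o.x o.y₂).toReal *
    ∏ n, (objectiveProb (M.αstar n) (fun i => M.reward i (M.θstar i) o.x o.y₁)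
        (fun i => M.reward i (M.θstar i) o.x o.y₂) (o.obj n) *
      Real.sigmoid (M.reward (o.obj n) (M.θstar (o.obj n)) o.x (o.win n) -
        M.reward (o.obj n) (M.θstar (o.obj n)) o.x (o.lose n)))

/-- The negative log-likelihood `L i` of the preferences reported on the objective `i`, by all
groups, in the rounds `1, …, t - 1` of the data `o`. -/
def prefLoss (o : ℕ → Round 𝒳 𝒴 N m) (t : ℕ) (i : Fin m) (θ : EuclideanSpace ℝ (Fin d)) : ℝ :=
  -∑ s ∈ Finset.Ico 1 t, ∑ n, if (o s).obj n = i then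
    Real.log (Real.sigmoid (M.reward i θ (o s).x ((o s).win n) -
      M.reward i θ (o s).x ((o s).lose n))) else 0

/-- The log-likelihood of the weights `α` for the objectives reported by group `n` in the rounds
`1, …, t - 1`, under the rewards with parameters `θ`. -/
def weightLogLik (o : ℕ → Round 𝒳 𝒴 N m) (t : ℕ) (n : Fin N)
    (θ : Fin m → EuclideanSpace ℝ (Fin d)) (α : Fin m → ℝ) : ℝ :=
  ∑ s ∈ Finset.Ico 1 t, Real.log (objectiveProb α
    (fun i => M.reward i (θ i) (o s).x (o s).y₁)
    (fun i => M.reward i (θ i) (o s).x (o s).y₂) ((o s).obj n))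

/-- The probability of `y` given `x` under the policy `∝ πref(y ∣ x) exp (f(x, y) / β)`. -/
def gibbsProb (f : 𝒳 → 𝒴 → ℝ) (x : 𝒳) (y : 𝒴) : ℝ :=
  (M.πref x y).toReal * Real.exp (f x y / M.β) /
    ∑' y', (M.πref x y').toReal * Real.exp (f x y' / M.β)

/-- `π^θ(y ∣ x)`: the optimal policy of the linear aggregation of `r^θ` in the direction `e`. -/
def aggProb (θ : Fin m → EuclideanSpace ℝ (Fin d)) (e : Fin m → ℝ) (x : 𝒳) (y : 𝒴) : ℝ :=
  M.gibbsProb (fun x y => ∑ i, e i * M.reward i (θ i) x y) x y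

/-- The reward-free log-likelihood `ℓ(𝒟 i, θ)`, written through the policy
`π_θ ∝ πref exp (r_i^θ / β)` of the single objective `i`. -/
def policyLogLik (o : ℕ → Round 𝒳 𝒴 N m) (t : ℕ) (i : Fin m)
    (θ : EuclideanSpace ℝ (Fin d)) : ℝ :=
  ∑ s ∈ Finset.Ico 1 t, ∑ n, if (o s).obj n = i then
    Real.log (Real.sigmoid
      (M.β * Real.log (M.gibbsProb (M.reward i θ) (o s).x ((o s).win n) /
          (M.πref (o s).x ((o s).win n)).toReal) -
        M.β * Real.log (M.gibbsProb (M.reward i θ) (o s).x ((o s).lose n) /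
          (M.πref (o s).x ((o s).lose n)).toReal))) else 0

/-- Reward-based optimistic step in the direction `e`:
`θ` maximises `max_π J(r^θ, e, π) - η ∑ i, L i (θ i)`, and `π` maximises `J(r^θ, e, ·)`. -/
def IsMOPRB [MeasurableSpace 𝒴] (o : ℕ → Round 𝒳 𝒴 N m) (t : ℕ) (e : Fin m → ℝ)
    (θ : Fin m → EuclideanSpace ℝ (Fin d)) (π : 𝒳 → PMF 𝒴) : Prop :=
  (∀ i, θ i ∈ M.paramSet i) ∧
  (∀ θ' : Fin m → EuclideanSpace ℝ (Fin d), (∀ i, θ' i ∈ M.paramSet i) →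
    M.maxJ θ' e - ∑ i, M.η * M.prefLoss o t i (θ' i) ≤
      M.maxJ θ e - ∑ i, M.η * M.prefLoss o t i (θ i)) ∧
  M.IsGreedy θ e π

/-- Reward-free optimistic step in the direction `e`: `θ` minimises
`β 𝔼_{πbase} [log (π^θ / πref)] - η ∑ i, ℓ(𝒟 i, θ i)`, and `π = π^θ`. -/
def IsMOPRF (o : ℕ → Round 𝒳 𝒴 N m) (t : ℕ) (e : Fin m → ℝ)
    (θ : Fin m → EuclideanSpace ℝ (Fin d)) (π : 𝒳 → PMF 𝒴) : Prop :=
  (∀ i, θ i ∈ M.paramSet i) ∧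
  (∀ θ' : Fin m → EuclideanSpace ℝ (Fin d), (∀ i, θ' i ∈ M.paramSet i) →
    M.β * M.expect M.πbase
        (fun x y => Real.log (M.aggProb θ e x y / (M.πref x y).toReal)) -
        M.η * ∑ i, M.policyLogLik o t i (θ i) ≤
      M.β * M.expect M.πbase
        (fun x y => Real.log (M.aggProb θ' e x y / (M.πref x y).toReal)) -
        M.η * ∑ i, M.policyLogLik o t i (θ' i)) ∧
  ∀ x y, (π x y).toReal = M.aggProb θ e x y

end Model

/-- The quantities which the algorithm computes, or observes, in the rounds `t = 1, 2, …`, as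
functions of the outcome `ω`. -/
structure Trajectory (Ω 𝒳 𝒴 : Type*) (N m d : ℕ) where
  /-- data collected in round `t` -/
  obs : ℕ → Ω → Round 𝒳 𝒴 N m
  /-- maximum likelihood reward parameters -/
  θMLE : ℕ → Ω → Fin m → EuclideanSpace ℝ (Fin d)
  /-- maximum likelihood weights of each group -/
  αhat : ℕ → Ω → Fin N → Fin m → ℝ
  /-- running averages of the weights -/
  α : ℕ → Ω → Fin N → Fin m → ℝ
  /-- optimistic reward parameters -/
  θ : ℕ → Ω → Fin m → EuclideanSpace ℝ (Fin d)
  /-- policy that generates the responses -/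
  π : ℕ → Ω → 𝒳 → PMF 𝒴
  /-- normalised direction -/
  dir : ℕ → Ω → Fin m → ℝ

/-- The average `(1 / t) ∑_{s ≤ t} V^s` of the estimated reward vectors. -/
def Trajectory.avgVector {Ω 𝒳 𝒴 : Type*} {N m d : ℕ} [MeasurableSpace 𝒴]
    (R : Trajectory Ω 𝒳 𝒴 N m d) (M : Model 𝒳 𝒴 N m d) (t : ℕ) (ω : Ω) :
    EuclideanSpace ℝ (Fin m) :=
  (1 / (t : ℝ)) • ∑ s ∈ Finset.Icc 1 t, M.rewardVector (R.θ s ω) (R.π s ω)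

/-- `R` is an execution of the online algorithm for `T` rounds, on a probability space with a
filtration `ℱ`, where `ℱ t` is the information after round `t`.  Ties in the optimisation steps
may be broken in any way. -/
structure IsExecution {Ω 𝒳 𝒴 : Type*} {N m d : ℕ} [MeasurableSpace 𝒴] [mΩ : MeasurableSpace Ω]
    (M : Model 𝒳 𝒴 N m d) (T : ℕ) (μ : Measure Ω) (ℱ : Filtration ℕ mΩ)
    (R : Trajectory Ω 𝒳 𝒴 N m d) : Prop where
  θMLE_mem : ∀ t ∈ Finset.Icc 1 T, ∀ ω i, R.θMLE t ω i ∈ M.paramSet i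
  θMLE_min : ∀ t ∈ Finset.Icc 1 T, ∀ ω i, ∀ θ ∈ M.paramSet i,
    M.prefLoss (fun s => R.obs s ω) t i (R.θMLE t ω i) ≤ M.prefLoss (fun s => R.obs s ω) t i θ
  αhat_mem : ∀ t ∈ Finset.Icc 1 T, ∀ ω n, R.αhat t ω n ∈ stdSimplex ℝ (Fin m)
  αhat_max : ∀ t ∈ Finset.Icc 1 T, ∀ ω n, ∀ α ∈ stdSimplex ℝ (Fin m),
    M.weightLogLik (fun s => R.obs s ω) t n (R.θMLE t ω) α ≤
      M.weightLogLik (fun s => R.obs s ω) t n (R.θMLE t ω) (R.αhat t ω n)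
  α_eq : ∀ t ∈ Finset.Icc 1 T, ∀ ω n,
    R.α t ω n = (((t : ℝ) - 1) / t) • R.α (t - 1) ω n + (1 / (t : ℝ)) • R.αhat t ω n
  step : ∀ t ∈ Finset.Icc 1 T, ∀ ω,
    M.IsMOPRB (fun s => R.obs s ω) t (R.dir t ω) (R.θ t ω) (R.π t ω) ∨
    M.IsMOPRF (fun s => R.obs s ω) t (R.dir t ω) (R.θ t ω) (R.π t ω)
  dir_one : ∀ ω, R.dir 1 ω ∈ stdSimplex ℝ (Fin m)
  dir_succ : ∀ t ∈ Finset.Icc 1 T, ∀ ω,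
    M.goal.IsDirection (fun n => targetSet (M.p n) (M.c n) (R.α t ω n))
      (R.avgVector M t ω) (R.dir (t + 1) ω)
  αhat_measurable : ∀ t ∈ Finset.Icc 1 T, ∀ n i, Measurable[ℱ (t - 1)] fun ω => R.αhat t ω n i
  π_measurable : ∀ t ∈ Finset.Icc 1 T, ∀ x y, Measurable[ℱ (t - 1)] fun ω => R.π t ω x y
  obs_measurable : ∀ t ∈ Finset.Icc 1 T, ∀ o, MeasurableSet[ℱ t] (R.obs t ⁻¹' {o})
  /-- given the past, the data of round `t` has the law `roundProb` of the policy of round `t` -/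
  obs_law : ∀ t ∈ Finset.Icc 1 T, ∀ o,
    μ[(R.obs t ⁻¹' {o}).indicator fun _ => (1 : ℝ) | ℱ (t - 1)] =ᵐ[μ]
      fun ω => M.roundProb (R.π t ω) o

end MORLHF

end

/-! The error of each estimate `αhat k` is bounded by a multiple of `1 / √(k - 1)`, up to
logarithms, and these bounds are summed. Four ingredients carry this.

Comparable policies. The optimal policy and all executed policies have densities with respect to
`πref` that vary at most by the factor `F = exp (B / β)`. If an optimal or reward-based policy
violated this, moving a little mass between two responses would cost at most `B` per unit of mass in
each reward and save more in `β` KL, so all coordinates would increase (`ratioBound_of_pareto`). For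
executed policies the direction must lie in the simplex, which holds because target sets are upward
closed. The gap assumption, stated for the optimal policy against `πref`, thus gives mean absolute
margin at least `γ / F ^ 3` in every query (`ofReal_gap_le`).

Concentration. If `exp f` of a round has conditional mean at most one, the products over the rounds
have mean at most one, and Markov's inequality bounds the sums of `f` (`exists_bad_event`). Three
kinds of tests are used: half the log-likelihood ratio of the preferences plus a squared error; half
that of the reported objectives plus a Hellinger distance minus a misspecification cost; and the
lower tail of the squared margins. The estimates depend on the data, so the tests run over a net
whose mesh is of order `1 / t`.

Maximum likelihood. Optimality makes the likelihood ratios nonnegative up to rounding, so the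
cumulative squared margin errors and Hellinger distances are `O(Λ)`, with `Λ` the confidence level.
Hellinger distance controls differences of logits, that is, of weight errors times absolute margins.
Weight errors sum to zero, so the largest has a partner of opposite or zero sign and cannot be
cancelled. Hence `‖α' - αstar‖ ^ 2` times the cumulative squared margin of one objective is `O(Λ)`,
and that cumulative margin grows linearly in the number of rounds (`mul_sq_norm_sub_le`).

Summation. The bounds on the single errors telescope through `√k - √(k - 1)` to `√t`, and averaging
gives the rate `1 / √t`. -/

noncomputable section

namespace MORLHF

/-! ### Kullback–Leibler divergence of discrete distributions. -/

section Divergence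

open InformationTheory

/-- The tangent inequality of a convex function: `log u` is the derivative at `u`. The defect equals
`u * klFun (v / u)`, which is nonnegative, also for `v = 0`. -/
lemma klFun_sub_le {u v : ℝ} (hu : 0 < u) (hv : 0 ≤ v) :
    klFun u - klFun v ≤ (u - v) * Real.log u := by
  have h := klFun_nonneg (x := v / u) (by positivity)
  have h2 : u * klFun (v / u) = klFun v - klFun u + (u - v) * Real.log u := by
    rcases hv.eq_or_lt with rfl | hv
    · simp [klFun_apply]; ring
    · simp only [klFun_apply, Real.log_div hv.ne' hu.ne']
      field_simp
      ring
  nlinarith [mul_nonneg hu.le h]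

/-- Mass `ε` moved from a point of density ratio `a' / b'` to one of ratio `a / b`. -/
lemma klFun_shift_lt {a b a' b' ε c : ℝ} (ha : 0 ≤ a) (hb : 0 < b) (ha' : 0 ≤ a') (hb' : 0 < b')
    (hε : 0 < ε) (hεa : ε < a') (h : Real.exp c * ((a + ε) * b') < (a' - ε) * b) :
    b * klFun ((a + ε) / b) - b * klFun (a / b) +
      (b' * klFun ((a' - ε) / b') - b' * klFun (a' / b')) < -(ε * c) := by
  -- The tangents are taken at the ratios after the move; these are positive, so the logarithms are
  -- meaningful even when `a = 0`.
  have h1 := klFun_sub_le (u := (a + ε) / b) (v := a / b) (by positivity) (by positivity)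
  have h2 := klFun_sub_le (u := (a' - ε) / b') (v := a' / b')
    (div_pos (by linarith) hb') (by positivity)
  have h3 : c + Real.log ((a + ε) / b) < Real.log ((a' - ε) / b') := by
    rw [← Real.log_exp c, ← Real.log_mul (Real.exp_pos c).ne' (by positivity)]
    apply Real.log_lt_log (by positivity)
    rw [← mul_div_assoc, div_lt_div_iff₀ hb hb']
    linarith
  have e1 : b * ((a + ε) / b - a / b) = ε := by field_simp; ring
  have e2 : b' * ((a' - ε) / b' - a' / b') = -ε := by field_simp; ring
  have h1' := mul_le_mul_of_nonneg_left h1 hb.le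
  have h2' := mul_le_mul_of_nonneg_left h2 hb'.le
  rw [← mul_assoc, e1] at h1'
  rw [← mul_assoc, e2] at h2'
  nlinarith

lemma mul_klFun_div_nonneg {𝒴 : Type*} (p q : PMF 𝒴) (y : 𝒴) :
    0 ≤ (q y).toReal * klFun ((p y).toReal / (q y).toReal) :=
  mul_nonneg ENNReal.toReal_nonneg (klFun_nonneg (by positivity))

variable {𝒴 : Type*} [Countable 𝒴] [MeasurableSpace 𝒴] [DiscreteMeasurableSpace 𝒴]

lemma absolutelyContinuous_toMeasure_iff {p q : PMF 𝒴} :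
    p.toMeasure ≪ q.toMeasure ↔ ∀ y, q y = 0 → p y = 0 := by
  constructor
  · intro h y hy
    have := @h {y}
    rw [PMF.toMeasure_apply_singleton _ _ (.singleton y),
      PMF.toMeasure_apply_singleton _ _ (.singleton y)] at this
    exact this hy
  · intro h s hs
    rw [PMF.toMeasure_apply_eq_zero_iff _ (.of_discrete)] at hs ⊢
    refine hs.mono_left fun y hy => ?_
    rw [PMF.mem_support_iff] at hy ⊢
    exact fun h' => hy (h y h')

/-- With `klFun` in place of `p * log (p / q)` every term is nonnegative. Finiteness then amounts to
summability, and altering two terms changes the divergence by exactly their increments. -/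
lemma klDiv_toMeasure {p q : PMF 𝒴} (h : ∀ y, q y = 0 → p y = 0) :
    klDiv p.toMeasure q.toMeasure =
      ∑' y, ENNReal.ofReal ((q y).toReal * klFun ((p y).toReal / (q y).toReal)) := by
  rw [klDiv_eq_lintegral_klFun_of_ac (absolutelyContinuous_toMeasure_iff.2 h)]
  have e : p.toMeasure = q.toMeasure.withDensity (fun y => p y / q y) := by
    ext s hs
    rw [withDensity_apply _ hs, ← lintegral_indicator hs, lintegral_countable',
      PMF.toMeasure_apply_eq_tsum]
    congr 1 with y
    rw [PMF.toMeasure_apply_singleton _ _ (.singleton y)]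
    by_cases hy : y ∈ s
    · simp only [Set.indicator_of_mem hy]
      by_cases hq : q y = 0
      · simp [hq, h y hq]
      · exact (ENNReal.div_mul_cancel hq (q.apply_ne_top y)).symm
    · simp [Set.indicator_of_notMem hy]
  have e2 : p.toMeasure.rnDeriv q.toMeasure =ᵐ[q.toMeasure] fun y => p y / q y := by
    conv_lhs => rw [e]
    exact Measure.rnDeriv_withDensity _ (.of_discrete)
  rw [lintegral_congr_ae (g := fun y => ENNReal.ofReal (klFun (p y / q y).toReal))
    (by filter_upwards [e2] with y hy; rw [hy]), lintegral_countable']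
  congr 1 with y
  rw [PMF.toMeasure_apply_singleton _ _ (.singleton y), ENNReal.toReal_div, mul_comm,
    ENNReal.ofReal_mul ENNReal.toReal_nonneg, ENNReal.ofReal_toReal (q.apply_ne_top y)]

lemma hasSum_klDiv {p q : PMF 𝒴} (h : klDiv p.toMeasure q.toMeasure ≠ ⊤) :
    HasSum (fun y => (q y).toReal * klFun ((p y).toReal / (q y).toReal))
      (klDiv p.toMeasure q.toMeasure).toReal := by
  have hac := absolutelyContinuous_toMeasure_iff.1 (klDiv_ne_top_iff.1 h).1
  rw [klDiv_toMeasure hac] at h ⊢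
  have := ENNReal.hasSum_toReal h
  simpa only [ENNReal.toReal_ofReal (mul_klFun_div_nonneg p q _),
    ENNReal.tsum_toReal_eq (fun a => ENNReal.ofReal_ne_top)] using this

lemma klDiv_eq_of_hasSum {p q : PMF 𝒴} {s : ℝ} (h : ∀ y, q y = 0 → p y = 0)
    (hs : HasSum (fun y => (q y).toReal * klFun ((p y).toReal / (q y).toReal)) s) :
    klDiv p.toMeasure q.toMeasure = ENNReal.ofReal s := by
  rw [klDiv_toMeasure h, ← ENNReal.ofReal_tsum_of_nonneg (mul_klFun_div_nonneg p q) hs.summable,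
    hs.tsum_eq]

end Divergence

/-! ### Moving mass between two points of a distribution. -/

section Shift

variable {𝒴 : Type*}

lemma hasSum_pmf_toReal (p : PMF 𝒴) : HasSum (fun y => (p y).toReal) 1 := by
  have := ENNReal.hasSum_toReal p.tsum_coe_ne_top
  rwa [← ENNReal.tsum_toReal_eq (fun a => p.apply_ne_top a), p.tsum_coe, ENNReal.toReal_one] at this

lemma summable_pmf_mul (p : PMF 𝒴) {g : 𝒴 → ℝ} {K : ℝ} (hg : ∀ y, |g y| ≤ K) :
    Summable fun y => (p y).toReal * g y := by
  refine Summable.of_norm_bounded (g := fun y => (p y).toReal * K)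
    ((hasSum_pmf_toReal p).summable.mul_right K) fun y => ?_
  rw [norm_mul, Real.norm_of_nonneg ENNReal.toReal_nonneg]
  exact mul_le_mul_of_nonneg_left (hg y) ENNReal.toReal_nonneg

lemma abs_tsum_pmf_mul_le (p : PMF 𝒴) {g : 𝒴 → ℝ} {K : ℝ} (hg : ∀ y, |g y| ≤ K) :
    |∑' y, (p y).toReal * g y| ≤ K := by
  have h := tsum_of_norm_bounded (f := fun y => (p y).toReal * g y)
    (g := fun y => (p y).toReal * K) ((hasSum_pmf_toReal p).mul_right K) fun y => by
      rw [norm_mul, Real.norm_of_nonneg ENNReal.toReal_nonneg]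
      exact mul_le_mul_of_nonneg_left (hg y) ENNReal.toReal_nonneg
  simpa using h

lemma exists_pmf_of_hasSum {f : 𝒴 → ℝ} (h0 : ∀ y, 0 ≤ f y) (h : HasSum f 1) :
    ∃ p : PMF 𝒴, ∀ y, (p y).toReal = f y := by
  refine ⟨⟨fun y => ENNReal.ofReal (f y), ?_⟩, fun y => ENNReal.toReal_ofReal (h0 y)⟩
  have := ENNReal.ofReal_tsum_of_nonneg h0 h.summable
  rw [h.tsum_eq, ENNReal.ofReal_one] at this
  rw [this]
  exact ENNReal.summable.hasSum

open Classical in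
/-- The change of a sum when two terms are changed. -/
lemma hasSum_of_eq_off_pair {f g : 𝒴 → ℝ} {s : ℝ} {y y' : 𝒴} (hy : y ≠ y') (hf : HasSum f s)
    (hg : ∀ z, z ≠ y → z ≠ y' → g z = f z) :
    HasSum g (s + ((g y - f y) + (g y' - f y'))) := by
  have h := (hf.update y (g y)).update y' (g y')
  have e : Function.update (Function.update f y (g y)) y' (g y') = g := by
    ext z
    by_cases h1 : z = y'
    · subst h1; simp
    · by_cases h2 : z = y
      · subst h2; simp [h1]
      · simp [h1, h2, hg z h2 h1]
  rw [e, Function.update_of_ne hy.symm] at h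
  rwa [show s + ((g y - f y) + (g y' - f y')) = g y' - f y' + (g y - f y + s) by ring]

open Classical in
/-- The distribution `p` with mass `ε` moved from `y'` to `y`. -/
lemma exists_pmf_shift (p : PMF 𝒴) {y y' : 𝒴} (hy : y ≠ y') {ε : ℝ} (hε : 0 ≤ ε)
    (hεy : ε ≤ (p y').toReal) :
    ∃ p' : PMF 𝒴, (p' y).toReal = (p y).toReal + ε ∧ (p' y').toReal = (p y').toReal - ε ∧
      ∀ z, z ≠ y → z ≠ y' → p' z = p z := by
  let f : 𝒴 → ℝ := Function.update (Function.update (fun z => (p z).toReal) y ((p y).toReal + ε)) y'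
    ((p y').toReal - ε)
  have f1 : f y = (p y).toReal + ε := by simp [f, hy]
  have f2 : f y' = (p y').toReal - ε := by simp [f]
  have f3 : ∀ z, z ≠ y → z ≠ y' → f z = (p z).toReal := by
    intro z h1 h2
    simp [f, h1, h2]
  have hf := hasSum_of_eq_off_pair hy (hasSum_pmf_toReal p) f3
  replace hf : HasSum f 1 := by
    convert hf using 1
    simp only [f1, f2]; ring
  obtain ⟨p', hp'⟩ := exists_pmf_of_hasSum (f := f) (fun z => by
    by_cases h1 : z = y
    · subst h1; rw [f1]; positivity
    · by_cases h2 : z = y'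
      · subst h2; rw [f2]; linarith
      · rw [f3 z h1 h2]; positivity) hf
  refine ⟨p', by rw [hp', f1], by rw [hp', f2], fun z h1 h2 => ?_⟩
  rw [← ENNReal.toReal_eq_toReal_iff' (p'.apply_ne_top z) (p.apply_ne_top z), hp', f3 z h1 h2]

end Shift

/-! ### Policies with bounded density ratio. -/

namespace Model

variable {𝒳 𝒴 : Type*} {N m d : ℕ} (M : Model 𝒳 𝒴 N m d)

/-- The density of the policy `π` with respect to `πref` varies at most by the factor
`exp (B / β)`. -/
def RatioBound (π : 𝒳 → PMF 𝒴) : Prop :=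
  ∀ x, M.ρ x ≠ 0 → ∀ y y', (π x y').toReal * (M.πref x y).toReal ≤
    Real.exp (M.B / M.β) * ((π x y).toReal * (M.πref x y').toReal)

variable {M}

/-- Summing the cross-multiplied bound over one response leaves a total mass of one on each side. -/
lemma RatioBound.le {π : 𝒳 → PMF 𝒴} (h : M.RatioBound π) {x : 𝒳} (hx : M.ρ x ≠ 0) (y : 𝒴) :
    (π x y).toReal ≤ Real.exp (M.B / M.β) * (M.πref x y).toReal := by
  have h1 := (hasSum_pmf_toReal (M.πref x)).mul_left (π x y).toReal
  have h2 := ((hasSum_pmf_toReal (π x)).mul_right (M.πref x y).toReal).mul_left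
    (Real.exp (M.B / M.β))
  simpa using hasSum_le (fun y' => h x hx y' y) h1 h2

lemma RatioBound.ge {π : 𝒳 → PMF 𝒴} (h : M.RatioBound π) {x : 𝒳} (hx : M.ρ x ≠ 0) (y : 𝒴) :
    (M.πref x y).toReal ≤ Real.exp (M.B / M.β) * (π x y).toReal := by
  have h1 := (hasSum_pmf_toReal (π x)).mul_right (M.πref x y).toReal
  have h2 := ((hasSum_pmf_toReal (M.πref x)).mul_left (π x y).toReal).mul_left
    (Real.exp (M.B / M.β))
  simpa using hasSum_le (fun y' => h x hx y y') h1 h2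

lemma summable_expect (π : 𝒳 → PMF 𝒴) {g : 𝒳 → 𝒴 → ℝ} {K : ℝ} (hg : ∀ x y, |g x y| ≤ K) :
    Summable fun x => (M.ρ x).toReal * ∑' y, (π x y).toReal * g x y :=
  summable_pmf_mul M.ρ fun x => abs_tsum_pmf_mul_le (π x) (hg x)

/-! ### Pareto optimality implies the ratio bound. -/

section Pareto

open InformationTheory

open Classical in
lemma expect_update (π : 𝒳 → PMF 𝒴) (x : 𝒳) (p : PMF 𝒴) {g : 𝒳 → 𝒴 → ℝ} {K : ℝ}
    (hg : ∀ x y, |g x y| ≤ K) :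
    M.expect (Function.update π x p) g = M.expect π g + (M.ρ x).toReal *
      (∑' y, (p y).toReal * g x y - ∑' y, (π x y).toReal * g x y) := by
  have h := (summable_expect (M := M) π hg).hasSum.update x
    ((M.ρ x).toReal * ∑' y, (p y).toReal * g x y)
  have e : Function.update (fun x => (M.ρ x).toReal * ∑' y, (π x y).toReal * g x y) x
      ((M.ρ x).toReal * ∑' y, (p y).toReal * g x y) =
      fun x' => (M.ρ x').toReal * ∑' y, (Function.update π x p x' y).toReal * g x' y := by
    ext x'
    by_cases hx' : x' = x
    · subst hx'; simp
    · simp [hx']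
  rw [e] at h
  unfold expect
  rw [h.tsum_eq]
  ring

lemma klDiv_ne_top_of_kl_ne_top [MeasurableSpace 𝒴] {π : 𝒳 → PMF 𝒴} (h : M.kl π ≠ ⊤) {x : 𝒳} (hx : M.ρ x ≠ 0) :
    klDiv (π x).toMeasure (M.πref x).toMeasure ≠ ⊤ := by
  intro h'
  have := ENNReal.ne_top_of_tsum_ne_top h x
  rw [h', ENNReal.mul_top hx] at this
  exact this rfl

open Classical in
lemma kl_update [MeasurableSpace 𝒴] {π : 𝒳 → PMF 𝒴} (h : M.kl π ≠ ⊤) {x : 𝒳} (hx : M.ρ x ≠ 0) {p : PMF 𝒴}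
    (hp : klDiv p.toMeasure (M.πref x).toMeasure ≠ ⊤) :
    M.kl (Function.update π x p) ≠ ⊤ ∧
    (M.kl (Function.update π x p)).toReal = (M.kl π).toReal + (M.ρ x).toReal *
      ((klDiv p.toMeasure (M.πref x).toMeasure).toReal -
        (klDiv (π x).toMeasure (M.πref x).toMeasure).toReal) := by
  -- Isolating the prompt `x` in `[0, ∞]` lets the two divergences be compared through a common
  -- finite rest.
  have hA : ∀ π' : 𝒳 → PMF 𝒴, M.kl π' = M.ρ x * klDiv (π' x).toMeasure (M.πref x).toMeasure +
      ∑' x', if x' = x then 0 else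
        M.ρ x' * klDiv (π' x').toMeasure (M.πref x').toMeasure := by
    intro π'
    exact ENNReal.tsum_eq_add_tsum_ite x
  have e : (∑' x', if x' = x then 0 else
      M.ρ x' * klDiv (Function.update π x p x').toMeasure (M.πref x').toMeasure) =
      ∑' x', if x' = x then 0 else M.ρ x' * klDiv (π x').toMeasure (M.πref x').toMeasure := by
    congr 1 with x'
    split_ifs with hx'
    · rfl
    · rw [Function.update_of_ne hx']
  have h1 := hA (Function.update π x p)
  rw [e, Function.update_self] at h1
  have h2 := hA π
  set S := ∑' x', if x' = x then 0 else M.ρ x' * klDiv (π x').toMeasure (M.πref x').toMeasure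
  have hS : S ≠ ⊤ := fun hS => h (by rw [h2, hS, add_top])
  have hρ := M.ρ.apply_ne_top x
  have hπ := klDiv_ne_top_of_kl_ne_top h hx
  have m1 := ENNReal.mul_ne_top hρ hp
  have m2 := ENNReal.mul_ne_top hρ hπ
  refine ⟨by rw [h1]; exact ENNReal.add_ne_top.2 ⟨m1, hS⟩, ?_⟩
  rw [h1, h2, ENNReal.toReal_add m1 hS, ENNReal.toReal_add m2 hS, ENNReal.toReal_mul,
    ENNReal.toReal_mul]
  ring

variable [Countable 𝒴] [MeasurableSpace 𝒴] [DiscreteMeasurableSpace 𝒴]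

open Classical in
/-- A weakly Pareto optimal policy has a density ratio bounded by `exp (B / β)`: otherwise moving
a little mass between two responses improves all coordinates. -/
lemma ratioBound_of_pareto (hβ : 0 < M.β) {θ : Fin m → EuclideanSpace ℝ (Fin d)}
    (hθ : ∀ i, θ i ∈ M.paramSet i) {π : 𝒳 → PMF 𝒴} (hkl : M.kl π ≠ ⊤)
    (hπ : ¬ ∃ π' : 𝒳 → PMF 𝒴, M.kl π' ≠ ⊤ ∧ ∀ i, M.rewardVector θ π i < M.rewardVector θ π' i) :
    M.RatioBound π := by
  intro x hx y y'
  by_contra! hlt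
  have hρ : 0 < (M.ρ x).toReal := ENNReal.toReal_pos hx (M.ρ.apply_ne_top x)
  have hK := klDiv_ne_top_of_kl_ne_top hkl hx
  have hac := absolutelyContinuous_toMeasure_iff.1 (klDiv_ne_top_iff.1 hK).1
  set a := (π x y).toReal with ha
  set a' := (π x y').toReal with ha'
  set b := (M.πref x y).toReal with hb
  set b' := (M.πref x y').toReal with hb'
  set F := Real.exp (M.B / M.β) with hF
  have ha0 : 0 ≤ a := ENNReal.toReal_nonneg
  have ha'0 : 0 ≤ a' := ENNReal.toReal_nonneg
  have hb0 : 0 ≤ b := ENNReal.toReal_nonneg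
  have hb'0 : 0 ≤ b' := ENNReal.toReal_nonneg
  have hF0 : 0 < F := Real.exp_pos _
  have hpos : 0 < a' * b := lt_of_le_of_lt (by positivity) hlt
  have ha'pos : 0 < a' := pos_of_mul_pos_left hpos hb0
  have hbpos : 0 < b := pos_of_mul_pos_right hpos ha'0
  have hb'pos : 0 < b' := by
    apply ENNReal.toReal_pos _ ((M.πref x).apply_ne_top y')
    intro h0
    have := hac y' h0
    simp [ha', this] at ha'pos
  -- For equal responses the bound fails only if `B < 0`. A nonempty `paramSet` excludes this;
  -- without objectives, `π` would dominate itself vacuously.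
  have hyy : y ≠ y' := by
    rintro rfl
    by_cases hB : 0 ≤ M.B / M.β
    · have : 1 ≤ F := Real.one_le_exp hB
      nlinarith
    · obtain hi | hi := isEmpty_or_nonempty (Fin m)
      · exact hπ ⟨π, hkl, fun i => hi.elim i⟩
      · obtain ⟨i⟩ := hi
        exact hB (div_nonneg ((norm_nonneg _).trans (hθ i).1) hβ.le)
  -- Half of the `ε` at which the violated bound would become an equality.
  obtain ⟨ε, hε, hεlt⟩ : ∃ ε, 0 < ε ∧ F * ((a + ε) * b') < (a' - ε) * b := by
    refine ⟨(a' * b - F * (a * b')) / (2 * (b + F * b')), div_pos (by linarith) (by positivity), ?_⟩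
    have : (a' * b - F * (a * b')) / (2 * (b + F * b')) * (b + F * b') =
      (a' * b - F * (a * b')) / 2 := by field_simp
    nlinarith
  have hεa : ε < a' := by
    have : 0 < (a' - ε) * b := lt_of_le_of_lt (by positivity) hεlt
    linarith [pos_of_mul_pos_left this hb0]
  obtain ⟨p, p1, p2, p3⟩ := exists_pmf_shift (π x) hyy hε.le hεa.le
  have hS := hasSum_of_eq_off_pair
    (g := fun y => (M.πref x y).toReal * klFun ((p y).toReal / (M.πref x y).toReal))
    hyy (hasSum_klDiv hK) (fun z h1 h2 => by rw [p3 z h1 h2])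
  have hlt' := klFun_shift_lt ha0 hbpos ha'0 hb'pos hε hεa hεlt
  have hpac : ∀ z, M.πref x z = 0 → p z = 0 := by
    intro z hz
    have h1 : z ≠ y := by rintro rfl; simp [hb, hz] at hbpos
    have h2 : z ≠ y' := by rintro rfl; simp [hb', hz] at hb'pos
    rw [p3 z h1 h2]; exact hac z hz
  have hpK := klDiv_eq_of_hasSum hpac hS
  have hpT : klDiv p.toMeasure (M.πref x).toMeasure ≠ ⊤ := by rw [hpK]; exact ENNReal.ofReal_ne_top
  have hpR := (hasSum_klDiv hpT).unique hS
  obtain ⟨hk1, hk2⟩ := kl_update hkl hx hpT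
  refine hπ ⟨Function.update π x p, hk1, fun i => ?_⟩
  have hr : ∀ x y, |M.reward i (θ i) x y| ≤ M.B := fun x y => by
    have := (hθ i).2.1 x y
    rw [abs_of_nonneg this.1]; exact this.2
  have hE : ∑' z, (p z).toReal * M.reward i (θ i) x z =
      ∑' z, (π x z).toReal * M.reward i (θ i) x z +
        ε * (M.reward i (θ i) x y - M.reward i (θ i) x y') := by
    rw [(hasSum_of_eq_off_pair hyy (summable_pmf_mul (π x) (hr x)).hasSum
      (g := fun z => (p z).toReal * M.reward i (θ i) x z)
      (fun z h1 h2 => by rw [p3 z h1 h2])).tsum_eq, p1, p2]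
    ring
  simp only [rewardVector]
  rw [expect_update π x p hr, hE, hk2, hpR, p1, p2]
  simp only [← ha, ← ha', ← hb, ← hb']
  have hB1 := ((hθ i).2.1 x y).1
  have hB2 := ((hθ i).2.1 x y').2
  -- Each reward loses at most `ε * B`, while `β` times the divergence at `x` drops by more than `ε
  -- * B`. The divergence term is common to all coordinates, so all of them improve.
  have h3 : M.β * (b * klFun ((a + ε) / b) - b * klFun (a / b) +
      (b' * klFun ((a' - ε) / b') - b' * klFun (a' / b'))) < -(ε * M.B) := by
    calc _ < M.β * (-(ε * (M.B / M.β))) := mul_lt_mul_of_pos_left hlt' hβ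
      _ = _ := by field_simp
  have h4 : ε * (-M.B) ≤ ε * (M.reward i (θ i) x y - M.reward i (θ i) x y') :=
    mul_le_mul_of_nonneg_left (by linarith) hε.le
  have h5 := mul_pos hρ (show 0 < ε * (M.reward i (θ i) x y - M.reward i (θ i) x y') -
    M.β * (b * klFun ((a + ε) / b) - b * klFun (a / b) +
      (b' * klFun ((a' - ε) / b') - b' * klFun (a' / b'))) by linarith)
  nlinarith

/-- A maximiser of a linear aggregation with weights in the simplex is weakly Pareto optimal, so its
Gibbs form need not be identified. -/
lemma IsGreedy.ratioBound (hβ : 0 < M.β) {θ : Fin m → EuclideanSpace ℝ (Fin d)}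
    (hθ : ∀ i, θ i ∈ M.paramSet i) {e : Fin m → ℝ} (he : e ∈ stdSimplex ℝ (Fin m))
    {π : 𝒳 → PMF 𝒴} (h : M.IsGreedy θ e π) : M.RatioBound π := by
  refine ratioBound_of_pareto hβ hθ h.1 ?_
  rintro ⟨π', h1, h2⟩
  refine absurd (h.2 π' h1) (not_le.2 ?_)
  obtain ⟨i, hi⟩ : ∃ i, 0 < e i := by
    by_contra! hc
    have := Finset.sum_nonpos fun i (_ : i ∈ Finset.univ) => hc i
    rw [he.2] at this
    linarith
  exact Finset.sum_lt_sum (fun j _ => mul_le_mul_of_nonneg_left (h2 j).le (he.1 j))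
    ⟨i, Finset.mem_univ i, mul_lt_mul_of_pos_left (h2 i) hi⟩

end Pareto

lemma sum_mul_reward_mem {θ : Fin m → EuclideanSpace ℝ (Fin d)}
    (hθ : ∀ i, θ i ∈ M.paramSet i) {e : Fin m → ℝ} (he : e ∈ stdSimplex ℝ (Fin m)) (x : 𝒳) (y : 𝒴) :
    ∑ i, e i * M.reward i (θ i) x y ∈ Set.Icc 0 M.B := by
  constructor
  · exact Finset.sum_nonneg fun i _ => mul_nonneg (he.1 i) ((hθ i).2.1 x y).1
  · calc _ ≤ ∑ i, e i * M.B :=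
        Finset.sum_le_sum fun i _ => mul_le_mul_of_nonneg_left ((hθ i).2.1 x y).2 (he.1 i)
      _ = M.B := by rw [← Finset.sum_mul, he.2, one_mul]

/-- The exponents differ by at most `B / β`, and the normaliser is common to both sides. Only its
sign matters, so its convergence is irrelevant here. -/
lemma ratioBound_of_gibbs (hβ : 0 < M.β) {f : 𝒳 → 𝒴 → ℝ} (hf : ∀ x y, f x y ∈ Set.Icc 0 M.B)
    {π : 𝒳 → PMF 𝒴} (h : ∀ x y, (π x y).toReal = M.gibbsProb f x y) : M.RatioBound π := by
  intro x _ y y'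
  rw [h, h]
  unfold gibbsProb
  set Z := ∑' y', (M.πref x y').toReal * Real.exp (f x y' / M.β)
  have hZ : 0 ≤ Z := tsum_nonneg fun y => by positivity
  have h1 : Real.exp (f x y' / M.β) ≤ Real.exp (M.B / M.β) * Real.exp (f x y / M.β) := by
    rw [← Real.exp_add]
    apply Real.exp_le_exp.2
    rw [← add_div]
    gcongr
    linarith [(hf x y').2, (hf x y).1]
  calc _ = (M.πref x y').toReal * (M.πref x y).toReal / Z * Real.exp (f x y' / M.β) := by ring
    _ ≤ (M.πref x y').toReal * (M.πref x y).toReal / Z *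
        (Real.exp (M.B / M.β) * Real.exp (f x y / M.β)) := by gcongr
    _ = _ := by ring

end Model

/-! ### Directions lie in the simplex. -/

section Direction

variable {m N : ℕ}

lemma ennreal_rpow_antitone {p : ℝ} (hp : p ≤ 0) {a b : ENNReal} (hab : a ≤ b) :
    b ^ p ≤ a ^ p := by
  rw [← neg_neg p, ENNReal.rpow_neg, ENNReal.rpow_neg a]
  exact ENNReal.inv_le_inv.2 (ENNReal.rpow_le_rpow hab (by linarith))

/-- For negative `p` the inner and the outer power both reverse the order, so the power mean is
monotone for either sign of `p`. -/
lemma targetSet_upward {p c : ℝ} {α : Fin m → ℝ} {z w : EuclideanSpace ℝ (Fin m)}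
    (hz : z ∈ targetSet p c α) (hzw : ∀ i, z i ≤ w i) : w ∈ targetSet p c α := by
  refine ⟨fun i => (hz.1 i).trans (hzw i), hz.2.trans ?_⟩
  rcases le_total 0 p with hp | hp
  · apply ENNReal.rpow_le_rpow _ (by positivity)
    exact Finset.sum_le_sum fun i _ => mul_le_mul_right
      (ENNReal.rpow_le_rpow (ENNReal.ofReal_le_ofReal (hzw i)) hp) _
  · apply ennreal_rpow_antitone (by simpa using hp)
    exact Finset.sum_le_sum fun i _ => mul_le_mul_right
      (ennreal_rpow_antitone hp (ENNReal.ofReal_le_ofReal (hzw i))) _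

/-- Otherwise the coordinatewise maximum of `P` and `V`, still in the upward closed set `W`, would
be strictly closer to `V`. Convexity plays no role. -/
lemma IsProj.le {W : Set (EuclideanSpace ℝ (Fin m))}
    (hW : ∀ z ∈ W, ∀ w : EuclideanSpace ℝ (Fin m), (∀ i, z i ≤ w i) → w ∈ W)
    {V P : EuclideanSpace ℝ (Fin m)} (h : IsProj W V P) (i : Fin m) : V i ≤ P i := by
  by_contra! hi
  have hQ := hW P h.1 (WithLp.toLp 2 fun j => max (P j) (V j)) fun j => le_max_left _ _
  have hd := h.2.trans_le (Metric.infDist_le_dist_of_mem (x := V) hQ)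
  rw [EuclideanSpace.dist_eq, EuclideanSpace.dist_eq] at hd
  refine absurd hd (not_le.2 (Real.sqrt_lt_sqrt (Finset.sum_nonneg fun _ _ => by positivity) ?_))
  refine Finset.sum_lt_sum (fun j _ => ?_) ⟨i, Finset.mem_univ i, ?_⟩
  · simp only [Real.dist_eq, sq_abs]
    rcases le_total (P j) (V j) with hj | hj
    · simp only [max_eq_right hj]; nlinarith [sq_nonneg (V j - P j)]
    · simp only [max_eq_left hj]; exact le_rfl
  · simp only [Real.dist_eq, sq_abs, max_eq_right hi.le]
    nlinarith

lemma normalizeOne_mem_stdSimplex {v : EuclideanSpace ℝ (Fin m)} (h : ∀ i, 0 ≤ v i) (hv : v ≠ 0) :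
    normalizeOne v ∈ stdSimplex ℝ (Fin m) := by
  refine ⟨fun i => div_nonneg (h i) (Finset.sum_nonneg fun _ _ => abs_nonneg _), ?_⟩
  unfold normalizeOne
  rw [← Finset.sum_div]
  have e : ∑ j, |v j| = ∑ j, v j := Finset.sum_congr rfl fun j _ => abs_of_nonneg (h j)
  rw [e]
  refine div_self fun h0 => hv ?_
  ext i
  exact (Finset.sum_eq_zero_iff_of_nonneg fun j _ => h j).1 h0 i (Finset.mem_univ i)

lemma Goal.IsDirection.mem_stdSimplex {G : Goal N} (hG : G.Valid)
    {W : Fin N → Set (EuclideanSpace ℝ (Fin m))}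
    (hW : ∀ n, ∀ z ∈ W n, ∀ w : EuclideanSpace ℝ (Fin m), (∀ i, z i ≤ w i) → w ∈ W n)
    {V : EuclideanSpace ℝ (Fin m)} {e : Fin m → ℝ} (h : G.IsDirection W V e) :
    e ∈ stdSimplex ℝ (Fin m) := by
  cases G with
  | consensus =>
    by_cases hV : V ∈ ⋂ n, W n
    · exact h.1 hV
    · obtain ⟨P, hP, rfl⟩ := h.2 hV
      have hle := hP.le fun z hz w hw =>
        Set.mem_iInter.2 fun n => hW n z (Set.mem_iInter.1 hz n) w hw
      have hne : P - V ≠ 0 := fun h0 => hV (by rw [← sub_eq_zero.1 h0]; exact hP.1)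
      refine normalizeOne_mem_stdSimplex (fun i => ?_) ?_
      · simp only [PiLp.smul_apply, PiLp.sub_apply, smul_eq_mul]
        exact mul_nonneg (by positivity) (sub_nonneg.2 (hle i))
      · exact smul_ne_zero (one_div_ne_zero (norm_ne_zero_iff.2 hne)) hne
  | malfare ζ q =>
    by_cases hV : ∀ n, V ∈ W n
    · exact h.1 hV
    · obtain ⟨P, hP, rfl⟩ := h.2 hV
      obtain ⟨hζ, -, hq⟩ := hG
      push Not at hV
      obtain ⟨n₀, hn₀⟩ := hV
      have hne : P n₀ - V ≠ 0 := fun h0 => hn₀ (by rw [← sub_eq_zero.1 h0]; exact (hP n₀).1)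
      have hd : 0 < Metric.infDist V (W n₀) := by
        rw [← (hP n₀).2, dist_comm, dist_eq_norm]
        exact norm_pos_iff.2 hne
      have hS : 0 < ∑ n', ζ n' * Metric.infDist V (W n') ^ (2 * q) :=
        Finset.sum_pos' (fun n _ => mul_nonneg (hζ n).le
          (Real.rpow_nonneg Metric.infDist_nonneg _))
          ⟨n₀, Finset.mem_univ _, mul_pos (hζ n₀) (Real.rpow_pos_of_pos hd _)⟩
      set S := ∑ n', ζ n' * Metric.infDist V (W n') ^ (2 * q)
      have hw : ∀ n, 0 ≤ ζ n * Metric.infDist V (W n) ^ (2 * q - 1) / S ^ ((2 * q - 1) / (2 * q)) :=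
        fun n => div_nonneg (mul_nonneg (hζ n).le (Real.rpow_nonneg Metric.infDist_nonneg _))
          (Real.rpow_nonneg hS.le _)
      have hw₀ : 0 < ζ n₀ * Metric.infDist V (W n₀) ^ (2 * q - 1) /
          S ^ ((2 * q - 1) / (2 * q)) :=
        div_pos (mul_pos (hζ n₀) (Real.rpow_pos_of_pos hd _)) (Real.rpow_pos_of_pos hS _)
      have hterm : ∀ n i, 0 ≤ ((ζ n * Metric.infDist V (W n) ^ (2 * q - 1) /
          S ^ ((2 * q - 1) / (2 * q))) • ((1 / ‖P n - V‖) • (P n - V))) i := by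
        intro n i
        simp only [PiLp.smul_apply, PiLp.sub_apply, smul_eq_mul]
        exact mul_nonneg (hw n) (mul_nonneg (by positivity) (sub_nonneg.2 ((hP n).le (hW n) i)))
      refine normalizeOne_mem_stdSimplex (fun i => ?_) fun h0 => ?_
      · rw [WithLp.ofLp_sum, Finset.sum_apply]
        exact Finset.sum_nonneg fun n _ => hterm n i
      -- Vectors with nonnegative coordinates cannot cancel, so a zero sum would force the
      -- displacement towards the missed set `W n₀` to vanish.
      · have : (ζ n₀ * Metric.infDist V (W n₀) ^ (2 * q - 1) /
          S ^ ((2 * q - 1) / (2 * q))) • ((1 / ‖P n₀ - V‖) • (P n₀ - V)) = 0 := by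
          ext i
          have h1 := congrArg (fun v : EuclideanSpace ℝ (Fin m) => v i) h0
          simp only [WithLp.ofLp_sum, Finset.sum_apply] at h1
          exact (Finset.sum_eq_zero_iff_of_nonneg fun n _ => hterm n i).1 h1 n₀ (Finset.mem_univ _)
        exact smul_ne_zero hw₀.ne' (smul_ne_zero (one_div_ne_zero (norm_ne_zero_iff.2 hne)) hne) this

end Direction

/-! ### Finite nets. -/

section Net

/-- A finite net inside a set `S` on which the coordinates `f` are bounded. -/
lemma exists_finite_net {X ι : Type*} [Fintype ι] (S : Set X) (f : X → ι → ℝ) {r ε : ℝ}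
    (hε : 0 < ε) (hf : ∀ x ∈ S, ∀ i, |f x i| ≤ r) :
    ∃ G : Finset X, (∀ x ∈ G, x ∈ S) ∧ G.card ≤ (⌊2 * r / ε⌋₊ + 1) ^ Fintype.card ι ∧
      ∀ x ∈ S, ∃ g ∈ G, ∀ i, |f x i - f g i| ≤ ε := by
  classical
  let K := ⌊2 * r / ε⌋₊ + 1
  have hlt : ∀ x ∈ S, ∀ i, ⌊(f x i + r) / ε⌋₊ < K := by
    intro x hx i
    refine Nat.lt_succ_of_le (Nat.floor_mono ?_)
    gcongr
    linarith [(abs_le.1 (hf x hx i)).2]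
  let c : S → ι → Fin K := fun x i => ⟨⌊(f x i + r) / ε⌋₊, hlt x x.2 i⟩
  -- One point of `S` is chosen in each occupied grid cell, so net points keep the constraints that
  -- define `S`.
  let pick : Set.range c → X := fun v => (v.2.choose : S)
  have hpick : ∀ x : S, c (Classical.choose (Set.mem_range_self (f := c) x)) = c x := fun x =>
    Classical.choose_spec (Set.mem_range_self (f := c) x)
  have : Fintype (Set.range c) := Fintype.ofFinite _
  refine ⟨Finset.univ.image pick, fun x hx => ?_, ?_, fun x hx => ?_⟩
  · obtain ⟨v, -, rfl⟩ := Finset.mem_image.1 hx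
    exact (v.2.choose).2
  · refine Finset.card_image_le.trans ?_
    rw [Finset.card_univ]
    calc Fintype.card (Set.range c) ≤ Fintype.card (ι → Fin K) :=
        Fintype.card_le_of_injective _ Subtype.val_injective
      _ = _ := by simp [K]
  · refine ⟨_, Finset.mem_image_of_mem pick (Finset.mem_univ ⟨c ⟨x, hx⟩, Set.mem_range_self _⟩),
      fun i => ?_⟩
    have h1 := congrArg Fin.val (congrFun (hpick ⟨x, hx⟩) i)
    set g : S := Classical.choose (Set.mem_range_self (f := c) ⟨x, hx⟩)
    change |f x i - f g i| ≤ ε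
    change ⌊(f g i + r) / ε⌋₊ = ⌊(f x i + r) / ε⌋₊ at h1
    have hx0 : 0 ≤ (f x i + r) / ε := div_nonneg (by linarith [(abs_le.1 (hf x hx i)).1]) hε.le
    have hg0 : 0 ≤ (f g i + r) / ε := div_nonneg (by linarith [(abs_le.1 (hf g g.2 i)).1]) hε.le
    have a1 := Nat.floor_le hx0
    have a2 := Nat.lt_floor_add_one ((f x i + r) / ε)
    have a3 := Nat.floor_le hg0
    have a4 := Nat.lt_floor_add_one ((f g i + r) / ε)
    rw [h1] at a3 a4
    have h2 : |(f x i + r) / ε - (f g i + r) / ε| ≤ 1 := abs_le.2 ⟨by linarith, by linarith⟩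
    rw [← sub_div, abs_div, abs_of_pos hε, div_le_one hε] at h2
    simpa using h2

end Net

/-! ### Affinity of Bernoulli distributions. -/

section Sigmoid

open Real

lemma sigmoid_le_exp_mul (a b : ℝ) : sigmoid a ≤ exp |a - b| * sigmoid b := by
  have h1 : 1 ≤ exp |a - b| := one_le_exp (abs_nonneg _)
  have h2 : exp (-b) ≤ exp |a - b| * exp (-a) := by
    rw [← exp_add]
    exact exp_le_exp.2 (by linarith [le_abs_self (a - b)])
  rw [sigmoid_def, sigmoid_def, ← div_eq_mul_inv, inv_eq_one_div,
    div_le_div_iff₀ (by positivity) (by positivity)]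
  linarith

lemma log_sigmoid_sub_le (a b : ℝ) : log (sigmoid a) - log (sigmoid b) ≤ |a - b| := by
  have h := log_le_log (sigmoid_pos a) (sigmoid_le_exp_mul a b)
  rw [log_mul (exp_pos _).ne' (sigmoid_pos b).ne', log_exp] at h
  linarith

/-- On `[-b, b]` the derivative `1 / (2 + exp z + exp (-z))` is at least `1 / (4 * exp b)`, and the
mean value inequality applies. -/
lemma sq_sub_le_sigmoid {b x y : ℝ} (hx : |x| ≤ b) (hy : |y| ≤ b) :
    (x - y) ^ 2 ≤ 16 * exp b ^ 2 * (sigmoid x - sigmoid y) ^ 2 := by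
  have hb : 0 ≤ b := (abs_nonneg x).trans hx
  have key : ∀ x ∈ Set.Icc (-b) b, ∀ y ∈ Set.Icc (-b) b, x ≤ y →
      (4 * exp b)⁻¹ * (y - x) ≤ sigmoid y - sigmoid x := by
    apply (convex_Icc (-b) b).mul_sub_le_image_sub_of_le_deriv
    · exact differentiable_sigmoid.continuous.continuousOn
    · exact differentiable_sigmoid.differentiableOn
    · intro z hz
      rw [interior_Icc] at hz
      simp only [deriv_sigmoid]
      rw [← sigmoid_neg, sigmoid_def, sigmoid_def, ← mul_inv, neg_neg]
      have e : (1 + exp (-z)) * (1 + exp z) = 2 + exp z + exp (-z) := by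
        have : exp (-z) * exp z = 1 := by rw [← exp_add]; simp
        linear_combination this
      rw [e]
      have h1 : exp z ≤ exp b := exp_le_exp.2 hz.2.le
      have h2 : exp (-z) ≤ exp b := exp_le_exp.2 (by linarith [hz.1])
      have h3 : 1 ≤ exp b := one_le_exp hb
      gcongr
      linarith
  have main : ∀ x y, |x| ≤ b → |y| ≤ b → x ≤ y →
      (x - y) ^ 2 ≤ 16 * exp b ^ 2 * (sigmoid x - sigmoid y) ^ 2 := by
    intro x y hx hy hxy
    have h := key x (abs_le.1 hx) y (abs_le.1 hy) hxy
    rw [inv_mul_le_iff₀ (by positivity)] at h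
    nlinarith [pow_le_pow_left₀ (by linarith) h 2]
  rcases le_total x y with h | h
  · exact main x y hx hy h
  · have := main y x hy hx h
    rw [← neg_sub y x, neg_sq, ← neg_sub (sigmoid y), neg_sq]
    exact this

lemma sqrt_mul_le_mean {p q : ℝ} (hp : 0 ≤ p) (hq : 0 ≤ q) : √p * √q ≤ (p + q) / 2 := by
  nlinarith [sq_nonneg (√p - √q), sq_sqrt hp, sq_sqrt hq]

/-- The defect of the mean inequality is `(√p - √q) ^ 2 / 2`, and `√p + √q ≤ 2` bounds it below by
`(p - q) ^ 2 / 8`. -/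
lemma sqrt_mul_le_mean_sub {p q : ℝ} (hp : 0 ≤ p) (hq : 0 ≤ q) (hp1 : p ≤ 1) (hq1 : q ≤ 1) :
    √p * √q ≤ (p + q) / 2 - (p - q) ^ 2 / 8 := by
  have e : (p - q) = (√p - √q) * (√p + √q) := by
    linear_combination -(sq_sqrt hp) + sq_sqrt hq
  have h1 : √p ≤ 1 := sqrt_le_one.2 hp1
  have h2 : √q ≤ 1 := sqrt_le_one.2 hq1
  have h3 : (√p + √q) ^ 2 ≤ 4 := by nlinarith [sqrt_nonneg p, sqrt_nonneg q]
  have h4 : (p - q) ^ 2 ≤ (√p - √q) ^ 2 * 4 := by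
    rw [e, mul_pow]
    exact mul_le_mul_of_nonneg_left h3 (sq_nonneg _)
  nlinarith [sq_sqrt hp, sq_sqrt hq]

lemma exp_half_log_sub {p q : ℝ} (hp : 0 < p) (hq : 0 < q) :
    exp ((log p - log q) / 2) = √p / √q := by
  rw [sub_div, exp_sub, ← log_sqrt hp.le, ← log_sqrt hq.le, exp_log (sqrt_pos.2 hp),
    exp_log (sqrt_pos.2 hq)]

/-- This is why the tests use half the log-likelihood ratio: the expectation of its exponential
under `q` is an affinity. -/
lemma mul_exp_half_log_sub {p q : ℝ} (hp : 0 < p) (hq : 0 < q) :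
    q * exp ((log p - log q) / 2) = √p * √q := by
  rw [exp_half_log_sub hp hq]
  have h2 := (sqrt_pos.2 hq).ne'
  nth_rewrite 1 [← mul_self_sqrt hq.le]
  field_simp

/-- The affinity of two Bernoulli distributions. -/
lemma bernoulli_affinity_le (a b : ℝ) :
    sigmoid b * exp ((log (sigmoid a) - log (sigmoid b)) / 2) +
      sigmoid (-b) * exp ((log (sigmoid (-a)) - log (sigmoid (-b))) / 2) ≤
      1 - (sigmoid a - sigmoid b) ^ 2 / 8 := by
  rw [mul_exp_half_log_sub (sigmoid_pos _) (sigmoid_pos _),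
    mul_exp_half_log_sub (sigmoid_pos _) (sigmoid_pos _)]
  have h1 := sqrt_mul_le_mean_sub (sigmoid_nonneg a) (sigmoid_nonneg b) (sigmoid_le_one a)
    (sigmoid_le_one b)
  have h2 := sqrt_mul_le_mean (sigmoid_nonneg (-a)) (sigmoid_nonneg (-b))
  rw [sigmoid_neg, sigmoid_neg] at h2 ⊢
  linarith

end Sigmoid

/-! ### Stability and identifiability of the softmax. -/

section Softmax

open Real

variable {m : ℕ}

/-- The softmax distribution of the logits `z`. -/
def softmax (z : Fin m → ℝ) (i : Fin m) : ℝ := exp (z i) / ∑ j, exp (z j)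

lemma sum_exp_pos (i : Fin m) (z : Fin m → ℝ) : 0 < ∑ j, exp (z j) :=
  Finset.sum_pos (fun _ _ => exp_pos _) ⟨i, Finset.mem_univ i⟩

lemma softmax_pos (z : Fin m → ℝ) (i : Fin m) : 0 < softmax z i :=
  div_pos (exp_pos _) (sum_exp_pos i z)

lemma sum_softmax [NeZero m] (z : Fin m → ℝ) : ∑ i, softmax z i = 1 := by
  unfold softmax
  rw [← Finset.sum_div]
  exact div_self (sum_exp_pos 0 z).ne'

lemma log_softmax (z : Fin m → ℝ) (i : Fin m) :
    log (softmax z i) = z i - log (∑ j, exp (z j)) := by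
  rw [softmax, log_div (exp_pos _).ne' (sum_exp_pos i z).ne', log_exp]

lemma softmax_ge {z : Fin m → ℝ} {b : ℝ} (hz : ∀ i, z i ∈ Set.Icc 0 b) (i : Fin m) :
    1 / (m * exp b) ≤ softmax z i := by
  unfold softmax
  have h1 : ∑ j, exp (z j) ≤ m * exp b := by
    calc _ ≤ ∑ _j : Fin m, exp b := Finset.sum_le_sum fun j _ => exp_le_exp.2 (hz j).2
      _ = _ := by simp
  have h2 := sum_exp_pos i z
  have h3 : 1 ≤ exp (z i) := one_le_exp (hz i).1
  gcongr

lemma softmax_le_exp_mul {z w : Fin m → ℝ} {e : ℝ} (h : ∀ i, |z i - w i| ≤ e) (i : Fin m) :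
    softmax z i ≤ exp (2 * e) * softmax w i := by
  unfold softmax
  have h1 := sum_exp_pos i z
  have h2 := sum_exp_pos i w
  have h3 : exp (z i) ≤ exp e * exp (w i) := by
    rw [← exp_add]; exact exp_le_exp.2 (by linarith [(abs_le.1 (h i)).2])
  have h4 : ∑ j, exp (w j) ≤ exp e * ∑ j, exp (z j) := by
    rw [Finset.mul_sum]
    refine Finset.sum_le_sum fun j _ => ?_
    rw [← exp_add]; exact exp_le_exp.2 (by linarith [(abs_le.1 (h j)).1])
  rw [← mul_div_assoc, div_le_div_iff₀ h1 h2, show 2 * e = e + e by ring, exp_add]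
  calc _ ≤ (exp e * exp (w i)) * (exp e * ∑ j, exp (z j)) := by gcongr
    _ = _ := by ring

lemma log_softmax_sub_le {z w : Fin m → ℝ} {e : ℝ} (h : ∀ i, |z i - w i| ≤ e) (i : Fin m) :
    log (softmax z i) - log (softmax w i) ≤ 2 * e := by
  have h := log_le_log (softmax_pos z i) (softmax_le_exp_mul h i)
  rw [log_mul (exp_pos _).ne' (softmax_pos w i).ne', log_exp] at h
  linarith

/-- The likelihood ratios lie between `exp (-2e)` and `exp (2e)`, so the relative error is at most
`2 * e * exp (2 * e)`. The assumption `e ≤ b` freezes the exponential factor and leaves a bound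
quadratic in `e`. -/
lemma softmax_chiSq_le [NeZero m] {z w : Fin m → ℝ} {e b : ℝ} (h : ∀ i, |z i - w i| ≤ e)
    (heb : e ≤ b) :
    ∑ i, (softmax z i - softmax w i) ^ 2 / softmax w i ≤ 4 * exp b ^ 4 * e ^ 2 := by
  have he : 0 ≤ e := (abs_nonneg _).trans (h 0)
  have h0 : exp (2 * e) - 1 ≤ 2 * e * exp (2 * e) := by
    have := add_one_le_exp (-(2 * e))
    have h2 : exp (-(2 * e)) * exp (2 * e) = 1 := by rw [← exp_add]; simp
    nlinarith [exp_pos (2 * e)]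
  have h1 : (2 * e * exp (2 * e)) ^ 2 ≤ 4 * exp b ^ 4 * e ^ 2 := by
    have : exp (2 * e) ≤ exp b ^ 2 := by
      rw [← exp_nat_mul]; exact exp_le_exp.2 (by push_cast; linarith)
    calc _ = 4 * (exp (2 * e)) ^ 2 * e ^ 2 := by ring
      _ ≤ 4 * (exp b ^ 2) ^ 2 * e ^ 2 := by gcongr
      _ = _ := by ring
  have key : ∀ i, (softmax z i - softmax w i) ^ 2 / softmax w i ≤
      softmax w i * (2 * e * exp (2 * e)) ^ 2 := by
    intro i
    have hw := softmax_pos w i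
    have a1 := softmax_le_exp_mul h i
    have a2 := softmax_le_exp_mul (z := w) (w := z) (e := e)
      (fun j => by rw [abs_sub_comm]; exact h j) i
    rw [div_le_iff₀ hw]
    have b1 : |softmax z i - softmax w i| ≤ softmax w i * (2 * e * exp (2 * e)) := by
      rw [abs_le]
      constructor
      · have hE := exp_pos (2 * e)
        have : softmax w i * (1 - 2 * e * exp (2 * e)) ≤ softmax z i := by
          by_cases hn : 1 - 2 * e * exp (2 * e) ≤ 0
          · exact (mul_nonpos_of_nonneg_of_nonpos hw.le hn).trans (softmax_pos z i).le
          · have c1 : exp (2 * e) * (1 - 2 * e * exp (2 * e)) ≤ 1 := by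
              nlinarith [one_le_exp (x := 2 * e) (by linarith)]
            push Not at hn
            calc _ ≤ (exp (2 * e) * softmax z i) * (1 - 2 * e * exp (2 * e)) := by gcongr
              _ = (exp (2 * e) * (1 - 2 * e * exp (2 * e))) * softmax z i := by ring
              _ ≤ 1 * softmax z i := by gcongr; exact (softmax_pos z i).le
              _ = _ := one_mul _
        linarith
      · nlinarith
    calc _ = |softmax z i - softmax w i| ^ 2 := (sq_abs _).symm
      _ ≤ (softmax w i * (2 * e * exp (2 * e))) ^ 2 := by gcongr
      _ = _ := by ring
  calc _ ≤ ∑ i, softmax w i * (2 * e * exp (2 * e)) ^ 2 := Finset.sum_le_sum fun i _ => key i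
    _ = (2 * e * exp (2 * e)) ^ 2 := by rw [← Finset.sum_mul, sum_softmax, one_mul]
    _ ≤ _ := h1

/-- The expected square root of the likelihood ratio of `q'` and `q` under a third distribution
`p`, controlled by the Hellinger distance of `q'` and `q` and the divergence of `p` from `q`. -/
lemma sum_mul_exp_half_log_le {p q q' : Fin m → ℝ} (hp : ∑ i, p i = 1) (hq : ∑ i, q i = 1)
    (hq' : ∑ i, q' i = 1) (hq0 : ∀ i, 0 < q i) (hq'0 : ∀ i, 0 < q' i) :
    ∑ i, p i * exp ((log (q' i) - log (q i)) / 2) ≤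
      1 + ∑ i, (p i - q i) ^ 2 / q i - (∑ i, (√(q' i) - √(q i)) ^ 2) / 4 := by
  have key : ∀ i, p i * exp ((log (q' i) - log (q i)) / 2) ≤
      p i + (q' i - q i) / 2 + (p i - q i) ^ 2 / q i - (√(q' i) - √(q i)) ^ 2 / 4 := by
    intro i
    rw [exp_half_log_sub (hq'0 i) (hq0 i)]
    set u := √(q i) with hu
    set v := √(q' i) with hv
    have hu0 : 0 < u := sqrt_pos.2 (hq0 i)
    have e1 : q i = u ^ 2 := (sq_sqrt (hq0 i).le).symm
    have e2 : q' i = v ^ 2 := (sq_sqrt (hq'0 i).le).symm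
    rw [e1, e2]
    -- Writing `p = u ^ 2 + (p - u ^ 2)`, the correctly specified part loses half of `(v - u) ^ 2`.
    -- The cross term `(p - u ^ 2) * (v - u) / u` takes back a quarter of it, at the price of the
    -- chi-square term.
    have h := sq_nonneg ((p i - u ^ 2) / u - (v - u) / 2)
    have e3 : ((p i - u ^ 2) / u - (v - u) / 2) ^ 2 = (p i - u ^ 2) ^ 2 / u ^ 2 -
        (p i - u ^ 2) * (v - u) / u + (v - u) ^ 2 / 4 := by field_simp; ring
    have e4 : (p i - u ^ 2) * (v - u) / u = p i * (v / u) - p i - u * (v - u) := by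
      field_simp
    rw [e3, e4] at h
    nlinarith
  calc _ ≤ ∑ i, (p i + (q' i - q i) / 2 + (p i - q i) ^ 2 / q i - (√(q' i) - √(q i)) ^ 2 / 4) :=
      Finset.sum_le_sum fun i _ => key i
    _ = _ := by
      rw [Finset.sum_sub_distrib, Finset.sum_add_distrib, Finset.sum_add_distrib, hp,
        ← Finset.sum_div, ← Finset.sum_div, Finset.sum_sub_distrib, hq, hq']
      ring

/-- For `q ≤ p`, the inequality `log x ≤ x - 1` at `x = √p / √q` bounds half the difference of the
logarithms, and `q ≥ 1 / κ` removes the denominator. -/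
lemma sq_log_sub_le {p q κ : ℝ} (hκ : 0 < κ) (hp : 1 / κ ≤ p) (hq : 1 / κ ≤ q) :
    (log p - log q) ^ 2 ≤ 4 * κ * (√p - √q) ^ 2 := by
  have main : ∀ p q : ℝ, 1 / κ ≤ p → 1 / κ ≤ q → q ≤ p →
      (log p - log q) ^ 2 ≤ 4 * κ * (√p - √q) ^ 2 := by
    intro p q hp hq hqp
    have hq0 : 0 < q := lt_of_lt_of_le (by positivity) hq
    have hp0 : 0 < p := hq0.trans_le hqp
    have hs : √q ≤ √p := sqrt_le_sqrt hqp
    have hsq := sqrt_pos.2 hq0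
    have h1 : (log p - log q) / 2 ≤ (√p - √q) / √q := by
      have h := log_le_sub_one_of_pos (div_pos (sqrt_pos.2 hp0) hsq)
      rw [log_div (sqrt_pos.2 hp0).ne' hsq.ne', log_sqrt hp0.le, log_sqrt hq0.le] at h
      rw [sub_div √p, div_self hsq.ne']
      linarith
    have h0 : 0 ≤ log p - log q := sub_nonneg.2 (log_le_log hq0 hqp)
    have h2 := pow_le_pow_left₀ (by linarith) h1 2
    rw [div_pow, div_pow, sq_sqrt hq0.le] at h2
    have h3 : (√p - √q) ^ 2 / q ≤ κ * (√p - √q) ^ 2 := by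
      rw [div_le_iff₀ hq0]
      have : 1 ≤ κ * q := by rwa [div_le_iff₀' hκ] at hq
      nlinarith [sq_nonneg (√p - √q)]
    linarith
  rcases le_total q p with h | h
  · exact main p q hp hq h
  · have := main q p hq hp h
    rw [← neg_sub, neg_sq, ← neg_sub √q, neg_sq]
    exact this

/-- The difference of two logits is determined by the softmax distribution. -/
lemma sq_logit_sub_le {z w : Fin m → ℝ} {b : ℝ} (hz : ∀ i, z i ∈ Set.Icc 0 b)
    (hw : ∀ i, w i ∈ Set.Icc 0 b) (i j : Fin m) :
    ((z i - w i) - (z j - w j)) ^ 2 ≤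
      8 * (m * exp b) * ∑ k, (√(softmax z k) - √(softmax w k)) ^ 2 := by
  have hm : (0 : ℝ) < m := Nat.cast_pos.2 i.pos
  have hκ : 0 < m * exp b := by positivity
  by_cases hij : i = j
  · subst hij
    rw [sub_self, zero_pow two_ne_zero]
    positivity
  -- The log-normalisers cancel only in a difference of two logits; a single logit is not determined
  -- by the softmax.
  have e : (z i - w i) - (z j - w j) = (log (softmax z i) - log (softmax w i)) -
      (log (softmax z j) - log (softmax w j)) := by
    simp only [log_softmax]; ring
  have h1 := sq_log_sub_le hκ (softmax_ge hz i) (softmax_ge hw i)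
  have h2 := sq_log_sub_le hκ (softmax_ge hz j) (softmax_ge hw j)
  have h3 : (√(softmax z i) - √(softmax w i)) ^ 2 + (√(softmax z j) - √(softmax w j)) ^ 2 ≤
      ∑ k, (√(softmax z k) - √(softmax w k)) ^ 2 := by
    rw [← Finset.sum_pair (f := fun k => (√(softmax z k) - √(softmax w k)) ^ 2) hij]
    exact Finset.sum_le_sum_of_subset_of_nonneg (Finset.subset_univ _) fun _ _ _ => sq_nonneg _
  have h4 := mul_le_mul_of_nonneg_left h3 hκ.le
  rw [e]
  generalize log (softmax z i) - log (softmax w i) = u at *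
  generalize log (softmax z j) - log (softmax w j) = v at *
  nlinarith [sq_nonneg (u + v)]

/-- For a vector `a` of sum zero, some weighted difference of two entries dominates `‖a‖`. -/
lemma exists_pair_of_sum_eq_zero [NeZero m] {a : Fin m → ℝ} (ha : ∑ i, a i = 0) :
    ∃ i j, ∀ w : Fin m → ℝ, (∀ k, 0 ≤ w k) → ‖a‖ ^ 2 * w i ^ 2 ≤ (a i * w i - a j * w j) ^ 2 := by
  obtain ⟨i, -, hi⟩ := Finset.exists_max_image Finset.univ (fun k => |a k|) ⟨0, Finset.mem_univ _⟩
  have hn : ‖a‖ ≤ |a i| :=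
    (pi_norm_le_iff_of_nonneg (abs_nonneg _)).2 fun k => hi k (Finset.mem_univ k)
  -- Entries of sum zero cannot all have the strict sign of the largest one. With nonnegative
  -- weights the two terms then reinforce each other. The pair is chosen before `w`, which varies
  -- with the round.
  obtain ⟨j, hj⟩ : ∃ j, a i * a j ≤ 0 := by
    by_contra! hc
    have := Finset.sum_pos (fun j (_ : j ∈ Finset.univ) => hc j) ⟨0, Finset.mem_univ _⟩
    rw [← Finset.mul_sum, ha, mul_zero] at this
    exact this.false
  refine ⟨i, j, fun w hw => ?_⟩
  have h1 : ‖a‖ ^ 2 ≤ a i ^ 2 := by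
    rw [← sq_abs (a i)]
    exact pow_le_pow_left₀ (norm_nonneg _) hn 2
  have h2 : ‖a‖ ^ 2 * w i ^ 2 ≤ a i ^ 2 * w i ^ 2 := by gcongr
  nlinarith [mul_nonneg (hw i) (hw j), sq_nonneg (a j * w j),
    mul_nonneg (neg_nonneg.2 hj) (mul_nonneg (hw i) (hw j))]

end Softmax

/-! ### Exponential supermartingales for adaptively collected data. -/

section Supermartingale

/-- The restriction of `μ` to `A` and the measure with density the conditional probability agree on
`m₀`, hence integrate `m₀`-measurable functions alike. Working in `[0, ∞]` avoids integrability
conditions on `F`. -/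
lemma setLIntegral_eq_of_condExp {Ω : Type*} {m₀ mΩ : MeasurableSpace Ω} {μ : Measure Ω}
    [IsProbabilityMeasure μ] (hm : m₀ ≤ mΩ) {A : Set Ω}
    (hA : MeasurableSet A) {q : Ω → ℝ} (hq : 0 ≤ q)
    (h : μ[A.indicator fun _ => (1 : ℝ) | m₀] =ᵐ[μ] q) {F : Ω → ENNReal}
    (hF : Measurable[m₀] F) :
    ∫⁻ ω in A, F ω ∂μ = ∫⁻ ω, ENNReal.ofReal (q ω) * F ω ∂μ := by
  set c := μ[A.indicator fun _ => (1 : ℝ) | m₀] with hc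
  have hint : Integrable (A.indicator fun _ => (1 : ℝ)) μ := (integrable_const 1).indicator hA
  have hcm : Measurable[m₀] fun ω => ENNReal.ofReal (c ω) :=
    ENNReal.measurable_ofReal.comp stronglyMeasurable_condExp.measurable
  have hc0 : 0 ≤ᵐ[μ] c := by filter_upwards [h] with ω hω; rw [hω]; exact hq ω
  have e : (μ.restrict A).trim hm = (μ.withDensity fun ω => ENNReal.ofReal (c ω)).trim hm := by
    refine @Measure.ext _ m₀ _ _ fun s hs => ?_
    rw [trim_measurableSet_eq hm hs, trim_measurableSet_eq hm hs, withDensity_apply _ (hm s hs),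
      Measure.restrict_apply (hm s hs),
      ← ofReal_integral_eq_lintegral_ofReal integrable_condExp.integrableOn
        (ae_restrict_of_ae hc0), setIntegral_condExp hm hint hs, integral_indicator hA,
      setIntegral_const, smul_eq_mul, mul_one, measureReal_def, Measure.restrict_apply hA,
      ENNReal.ofReal_toReal (measure_ne_top _ _), Set.inter_comm]
  calc ∫⁻ ω in A, F ω ∂μ = ∫⁻ ω, F ω ∂((μ.restrict A).trim hm) := (lintegral_trim hm hF).symm
    _ = ∫⁻ ω, F ω ∂(μ.withDensity fun ω => ENNReal.ofReal (c ω)) := by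
      rw [e, lintegral_trim hm hF]
    _ = ∫⁻ ω, ENNReal.ofReal (c ω) * F ω ∂μ :=
      lintegral_withDensity_eq_lintegral_mul _ (hcm.mono hm le_rfl) (hF.mono hm le_rfl)
    _ = _ := lintegral_congr_ae (by filter_upwards [h] with ω hω; rw [hω])

variable {Ω : Type*} {mΩ : MeasurableSpace Ω} {μ : Measure Ω} [IsProbabilityMeasure μ]

/-- If the conditional expectation of `g (obs t)` given the past is at most one in each round, then
so is the expectation of the product over the rounds. -/
lemma lintegral_prod_le_one {S : Type*} [Countable S] {ℱ : Filtration ℕ mΩ} {T : ℕ}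
    {obs : ℕ → Ω → S} {q : ℕ → Ω → S → ℝ} (hq : ∀ t ω o, 0 ≤ q t ω o)
    (hobs : ∀ t ∈ Finset.Icc 1 T, ∀ o, MeasurableSet[ℱ t] (obs t ⁻¹' {o}))
    (hlaw : ∀ t ∈ Finset.Icc 1 T, ∀ o,
      μ[(obs t ⁻¹' {o}).indicator fun _ => (1 : ℝ) | ℱ (t - 1)] =ᵐ[μ] fun ω => q t ω o)
    {g : S → ENNReal}
    (hg : ∀ t ∈ Finset.Icc 1 T, ∀ ω, ∑' o, ENNReal.ofReal (q t ω o) * g o ≤ 1)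
    {k : ℕ} (hk : k ≤ T) :
    Measurable[ℱ k] (fun ω => ∏ s ∈ Finset.Icc 1 k, g (obs s ω)) ∧
      ∫⁻ ω, ∏ s ∈ Finset.Icc 1 k, g (obs s ω) ∂μ ≤ 1 := by
  have hgm : ∀ t ∈ Finset.Icc 1 T, Measurable[ℱ t] fun ω => g (obs t ω) := by
    intro t ht
    let _ : MeasurableSpace S := ⊤
    have h1 : @Measurable _ _ (ℱ t) _ (obs t) :=
      @measurable_to_countable' _ _ _ _ (ℱ t) _ fun o => hobs t ht o
    exact (measurable_from_top (f := g)).comp h1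
  induction k with
  | zero => simp [measurable_const]
  | succ k ih =>
    obtain ⟨hM, hI⟩ := ih (by omega)
    have hk1 : k + 1 ∈ Finset.Icc 1 T := Finset.mem_Icc.2 ⟨by omega, hk⟩
    set F := fun ω => ∏ s ∈ Finset.Icc 1 k, g (obs s ω) with hF
    have e : ∀ ω, ∏ s ∈ Finset.Icc 1 (k + 1), g (obs s ω) = F ω * g (obs (k + 1) ω) := fun ω =>
      Finset.prod_Icc_succ_top (by omega) _
    simp only [e]
    refine ⟨(hM.mono (ℱ.mono (Nat.le_succ k)) le_rfl).mul (hgm _ hk1), ?_⟩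
    have hA : ∀ o, MeasurableSet (obs (k + 1) ⁻¹' {o}) := fun o => ℱ.le _ _ (hobs _ hk1 o)
    have hFm : Measurable F := hM.mono (ℱ.le k) le_rfl
    -- Countability of the data reduces the conditional expectation to the point probabilities `q`.
    have hsplit : ∫⁻ ω, F ω * g (obs (k + 1) ω) ∂μ =
        ∑' o, ∫⁻ ω in obs (k + 1) ⁻¹' {o}, F ω * g (obs (k + 1) ω) ∂μ := by
      rw [← lintegral_iUnion hA, ← Set.preimage_iUnion, Set.iUnion_of_singleton, Set.preimage_univ,
        Measure.restrict_univ]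
      intro o o' hoo
      exact Disjoint.preimage _ (by simpa using hoo)
    have hterm : ∀ o, ∫⁻ ω in obs (k + 1) ⁻¹' {o}, F ω * g (obs (k + 1) ω) ∂μ =
        ∫⁻ ω, ENNReal.ofReal (q (k + 1) ω o) * F ω * g o ∂μ := by
      intro o
      have h1 := setLIntegral_eq_of_condExp (ℱ.le k) (hA o) (fun ω => hq (k + 1) ω o)
        (hlaw _ hk1 o) (hM.mul_const (g o))
      rw [setLIntegral_congr_fun (g := fun ω => F ω * g o) (hA o) (fun ω hω => by
        rw [Set.mem_preimage, Set.mem_singleton_iff] at hω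
        simp only [hω]), h1]
      simp only [mul_assoc]
    have hae : ∀ o, AEMeasurable (fun ω => ENNReal.ofReal (q (k + 1) ω o) * F ω * g o) μ := by
      intro o
      have h1 : AEMeasurable (fun ω => q (k + 1) ω o) μ :=
        integrable_condExp.aestronglyMeasurable.aemeasurable.congr (hlaw _ hk1 o)
      exact (h1.ennreal_ofReal.mul hFm.aemeasurable).mul_const _
    rw [hsplit]
    simp only [hterm]
    rw [← lintegral_tsum hae]
    refine (lintegral_mono fun ω => ?_).trans hI
    calc ∑' o, ENNReal.ofReal (q (k + 1) ω o) * F ω * g o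
        = (∑' o, ENNReal.ofReal (q (k + 1) ω o) * g o) * F ω := by
          rw [← ENNReal.tsum_mul_right]; congr 1 with o; ring
      _ ≤ 1 * F ω := by gcongr; exact hg _ hk1 ω
      _ = F ω := one_mul _

/-- Simultaneous exponential bounds for finitely many tests `f j`. -/
lemma exists_bad_event {S J : Type*} [Countable S] [Fintype J] {ℱ : Filtration ℕ mΩ} {T : ℕ}
    {obs : ℕ → Ω → S} {q : ℕ → Ω → S → ℝ} (hq : ∀ t ω o, 0 ≤ q t ω o)
    (hobs : ∀ t ∈ Finset.Icc 1 T, ∀ o, MeasurableSet[ℱ t] (obs t ⁻¹' {o}))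
    (hlaw : ∀ t ∈ Finset.Icc 1 T, ∀ o,
      μ[(obs t ⁻¹' {o}).indicator fun _ => (1 : ℝ) | ℱ (t - 1)] =ᵐ[μ] fun ω => q t ω o)
    {f : J → S → ℝ}
    (hf : ∀ j, ∀ t ∈ Finset.Icc 1 T, ∀ ω,
      ∑' o, ENNReal.ofReal (q t ω o) * ENNReal.ofReal (Real.exp (f j o)) ≤ 1)
    (Λ : ℝ) :
    ∃ A : Set Ω, MeasurableSet A ∧
      μ A ≤ ENNReal.ofReal ((T + 1) * Fintype.card J * Real.exp (-Λ)) ∧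
      ∀ ω ∉ A, ∀ j, ∀ k ≤ T, ∑ s ∈ Finset.Icc 1 k, f j (obs s ω) ≤ Λ := by
  let X : ℕ → J → Ω → ENNReal := fun k j ω =>
    ∏ s ∈ Finset.Icc 1 k, ENNReal.ofReal (Real.exp (f j (obs s ω)))
  have hX : ∀ k ≤ T, ∀ j, Measurable (X k j) ∧ ∫⁻ ω, X k j ω ∂μ ≤ 1 := fun k hk j => by
    obtain ⟨h1, h2⟩ := lintegral_prod_le_one (μ := μ) hq hobs hlaw
      (g := fun o => ENNReal.ofReal (Real.exp (f j o))) (hf j) hk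
    exact ⟨h1.mono (ℱ.le k) le_rfl, h2⟩
  let E : ℕ → J → Set Ω := fun k j => {ω | ENNReal.ofReal (Real.exp Λ) ≤ X k j ω}
  have hE : ∀ k ≤ T, ∀ j, μ (E k j) ≤ ENNReal.ofReal (Real.exp (-Λ)) := by
    intro k hk j
    refine (meas_ge_le_lintegral_div (hX k hk j).1.aemeasurable
      (by simp [Real.exp_pos]) ENNReal.ofReal_ne_top).trans ?_
    rw [Real.exp_neg, ENNReal.ofReal_inv_of_pos (Real.exp_pos _), ← one_div]
    exact ENNReal.div_le_div_right (hX k hk j).2 _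
  -- The union bound runs over the lengths `0, …, T` and all tests, hence the factor `T + 1`.
  refine ⟨⋃ k ∈ Finset.range (T + 1), ⋃ j ∈ (Finset.univ : Finset J), E k j, ?_, ?_, ?_⟩
  · refine Finset.measurableSet_biUnion _ fun k hk => Finset.measurableSet_biUnion _ fun j _ => ?_
    exact measurableSet_le measurable_const (hX k (by simpa [Nat.lt_succ_iff] using hk) j).1
  · calc _ ≤ ∑ k ∈ Finset.range (T + 1), ∑ j : J, ENNReal.ofReal (Real.exp (-Λ)) := by
          refine (measure_biUnion_finset_le _ _).trans (Finset.sum_le_sum fun k hk => ?_)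
          refine (measure_biUnion_finset_le _ _).trans (Finset.sum_le_sum fun j _ => ?_)
          exact hE k (by simpa [Nat.lt_succ_iff] using hk) j
      _ = _ := by
          rw [Finset.sum_const, Finset.sum_const, Finset.card_range, Finset.card_univ,
            nsmul_eq_mul, nsmul_eq_mul, mul_assoc, ENNReal.ofReal_mul (by positivity),
            ENNReal.ofReal_mul (by positivity), ENNReal.ofReal_natCast]
          congr 1
          exact_mod_cast (ENNReal.ofReal_natCast (T + 1)).symm
  · intro ω hω j k hk
    simp only [Set.mem_iUnion, not_exists] at hω
    have h1 := hω k (by simpa [Nat.lt_succ_iff] using hk) j (Finset.mem_univ j)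
    have e : X k j ω = ENNReal.ofReal (Real.exp (∑ s ∈ Finset.Icc 1 k, f j (obs s ω))) := by
      rw [Real.exp_sum, ENNReal.ofReal_prod_of_nonneg fun _ _ => (Real.exp_pos _).le]
    by_contra! hlt
    refine h1 ?_
    change ENNReal.ofReal (Real.exp Λ) ≤ X k j ω
    rw [e]
    exact ENNReal.ofReal_le_ofReal (Real.exp_le_exp.2 hlt.le)

end Supermartingale

/-! ### The three tests and their exponential moments. -/

namespace Model

open Real (exp log sigmoid exp_pos exp_add exp_sum exp_zero exp_nat_mul exp_eq_one_iff sigmoid_nonneg sigmoid_neg add_one_le_exp)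

variable {𝒳 𝒴 : Type*} {N m d : ℕ} (M : Model 𝒳 𝒴 N m d)

/-- The difference of the rewards of two responses. -/
def margin (i : Fin m) (θ : EuclideanSpace ℝ (Fin d)) (x : 𝒳) (y₁ y₂ : 𝒴) : ℝ :=
  M.reward i θ x y₁ - M.reward i θ x y₂

/-- The logits of the distribution of the reported objective. -/
def logits (α : Fin m → ℝ) (θ : Fin m → EuclideanSpace ℝ (Fin d)) (x : 𝒳) (y₁ y₂ : 𝒴)
    (i : Fin m) : ℝ :=
  α i * |M.margin i (θ i) x y₁ y₂|

/-- The probability that group `n` reports the objective `a.1` and the preference `a.2`. -/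
def reportProb (n : Fin N) (x : 𝒳) (y₁ y₂ : 𝒴) (a : Fin m × Bool) : ℝ :=
  softmax (M.logits (M.αstar n) M.θstar x y₁ y₂) a.1 *
    sigmoid (if a.2 then M.margin a.1 (M.θstar a.1) x y₁ y₂
      else -M.margin a.1 (M.θstar a.1) x y₁ y₂)

variable {M}

lemma abs_margin_le {i : Fin m} {θ : EuclideanSpace ℝ (Fin d)} (h : θ ∈ M.paramSet i)
    (x : 𝒳) (y₁ y₂ : 𝒴) : |M.margin i θ x y₁ y₂| ≤ M.B := by
  have h1 := h.2.1 x y₁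
  have h2 := h.2.1 x y₂
  exact abs_le.2 ⟨by unfold margin; linarith [h1.1, h2.2], by unfold margin; linarith [h1.2, h2.1]⟩

lemma logits_mem {α : Fin m → ℝ} (hα : α ∈ stdSimplex ℝ (Fin m))
    {θ : Fin m → EuclideanSpace ℝ (Fin d)} (h : ∀ i, θ i ∈ M.paramSet i)
    (x : 𝒳) (y₁ y₂ : 𝒴) (i : Fin m) : M.logits α θ x y₁ y₂ i ∈ Set.Icc 0 M.B := by
  have h1 : α i ≤ 1 := (mem_Icc_of_mem_stdSimplex hα i).2
  have h0 : 0 ≤ α i := hα.1 i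
  have h2 := abs_margin_le (h i) x y₁ y₂
  refine ⟨mul_nonneg h0 (abs_nonneg _), ?_⟩
  unfold logits
  nlinarith [abs_nonneg (M.margin i (θ i) x y₁ y₂)]

lemma reward_win_sub_lose (o : Round 𝒳 𝒴 N m) (n : Fin N) (i : Fin m)
    (θ : EuclideanSpace ℝ (Fin d)) :
    M.reward i θ o.x (o.win n) - M.reward i θ o.x (o.lose n) =
      if o.pref n then M.margin i θ o.x o.y₁ o.y₂ else -M.margin i θ o.x o.y₁ o.y₂ := by
  unfold Round.win Round.lose margin
  split_ifs <;> ring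

lemma roundProb_eq (π : 𝒳 → PMF 𝒴) (o : Round 𝒳 𝒴 N m) :
    M.roundProb π o = (M.ρ o.x).toReal * (π o.x o.y₁).toReal * (π o.x o.y₂).toReal *
      ∏ n, M.reportProb n o.x o.y₁ o.y₂ (o.obj n, o.pref n) := by
  unfold roundProb
  congr 1
  refine Finset.prod_congr rfl fun n _ => ?_
  rw [reward_win_sub_lose]
  rfl

lemma reportProb_nonneg (n : Fin N) (x : 𝒳) (y₁ y₂ : 𝒴) (a : Fin m × Bool) :
    0 ≤ M.reportProb n x y₁ y₂ a :=
  mul_nonneg (softmax_pos _ _).le (sigmoid_nonneg _)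

lemma roundProb_nonneg (π : 𝒳 → PMF 𝒴) (o : Round 𝒳 𝒴 N m) : 0 ≤ M.roundProb π o := by
  rw [roundProb_eq]
  exact mul_nonneg (by positivity) (Finset.prod_nonneg fun n _ => reportProb_nonneg n _ _ _ _)

/-- The probability of the prompt and the two responses of a round. -/
def queryProb (M : Model 𝒳 𝒴 N m d) (π : 𝒳 → PMF 𝒴) (p : 𝒳 × 𝒴 × 𝒴) : ℝ :=
  (M.ρ p.1).toReal * (π p.1 p.2.1).toReal * (π p.1 p.2.2).toReal

lemma queryProb_nonneg (π : 𝒳 → PMF 𝒴) (p : 𝒳 × 𝒴 × 𝒴) : 0 ≤ M.queryProb π p := by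
  unfold queryProb; positivity

lemma tsum_queryProb (π : 𝒳 → PMF 𝒴) : ∑' p, ENNReal.ofReal (M.queryProb π p) = 1 := by
  have e : ∀ p : 𝒳 × 𝒴 × 𝒴,
      ENNReal.ofReal (M.queryProb π p) = M.ρ p.1 * (π p.1 p.2.1 * π p.1 p.2.2) := by
    intro p
    unfold queryProb
    rw [mul_assoc, ENNReal.ofReal_mul ENNReal.toReal_nonneg,
      ENNReal.ofReal_mul ENNReal.toReal_nonneg, ENNReal.ofReal_toReal (PMF.apply_ne_top _ _),
      ENNReal.ofReal_toReal (PMF.apply_ne_top _ _), ENNReal.ofReal_toReal (PMF.apply_ne_top _ _)]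
  simp only [e]
  rw [ENNReal.tsum_prod']
  simp only [ENNReal.tsum_mul_left, ENNReal.tsum_prod', PMF.tsum_coe, mul_one]

/-- The data of a round as a query together with the reports of the groups. -/
def roundEquiv : Round 𝒳 𝒴 N m ≃ (𝒳 × 𝒴 × 𝒴) × (Fin N → Fin m × Bool) where
  toFun o := ((o.x, o.y₁, o.y₂), fun n => (o.obj n, o.pref n))
  invFun p := ⟨p.1.1, p.1.2.1, p.1.2.2, fun n => (p.2 n).1, fun n => (p.2 n).2⟩
  left_inv _ := rfl
  right_inv _ := rfl

/-- The expectation of a test that factorises over the groups. -/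
lemma tsum_roundProb_mul_exp_le {π : 𝒳 → PMF 𝒴} {f : Round 𝒳 𝒴 N m → ℝ} {c : 𝒳 → 𝒴 → 𝒴 → ℝ}
    {u : Fin N → 𝒳 → 𝒴 → 𝒴 → Fin m × Bool → ℝ}
    (hf : ∀ o, f o = c o.x o.y₁ o.y₂ + ∑ n, u n o.x o.y₁ o.y₂ (o.obj n, o.pref n))
    {H : 𝒳 → 𝒴 → 𝒴 → ℝ}
    (hH : ∀ x y₁ y₂, exp (c x y₁ y₂) *
      ∏ n, ∑ a, M.reportProb n x y₁ y₂ a * exp (u n x y₁ y₂ a) ≤ H x y₁ y₂) :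
    ∑' o, ENNReal.ofReal (M.roundProb π o) * ENNReal.ofReal (exp (f o)) ≤
      ∑' p : 𝒳 × 𝒴 × 𝒴, ENNReal.ofReal (M.queryProb π p * H p.1 p.2.1 p.2.2) := by
  rw [← roundEquiv.symm.tsum_eq, ENNReal.tsum_prod']
  refine ENNReal.tsum_le_tsum fun p => ?_
  rw [tsum_fintype]
  have e : ∀ a : Fin N → Fin m × Bool,
      ENNReal.ofReal (M.roundProb π (roundEquiv.symm (p, a))) *
        ENNReal.ofReal (exp (f (roundEquiv.symm (p, a)))) =
      ENNReal.ofReal (M.queryProb π p * (exp (c p.1 p.2.1 p.2.2) *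
        ∏ n, (M.reportProb n p.1 p.2.1 p.2.2 (a n) * exp (u n p.1 p.2.1 p.2.2 (a n))))) := by
    intro a
    rw [← ENNReal.ofReal_mul (roundProb_nonneg _ _), hf, exp_add, exp_sum, roundProb_eq,
      Finset.prod_mul_distrib]
    congr 1
    simp only [roundEquiv, queryProb, Equiv.coe_fn_symm_mk, Prod.mk.eta]
    ring
  -- Independence of the groups: the sum over joint reports is a product of sums.
  have e' := Fintype.prod_sum fun n (a : Fin m × Bool) =>
    M.reportProb n p.1 p.2.1 p.2.2 a * exp (u n p.1 p.2.1 p.2.2 a)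
  simp only [e]
  rw [← ENNReal.ofReal_sum_of_nonneg, ← Finset.mul_sum, ← Finset.mul_sum, ← e']
  · exact ENNReal.ofReal_le_ofReal
      (mul_le_mul_of_nonneg_left (hH _ _ _) (queryProb_nonneg _ _))
  · intro a _
    refine mul_nonneg (queryProb_nonneg _ _) (mul_nonneg (exp_pos _).le ?_)
    exact Finset.prod_nonneg fun n _ => mul_nonneg (reportProb_nonneg _ _ _ _ _) (exp_pos _).le

lemma tsum_roundProb_mul_exp_le_one {π : 𝒳 → PMF 𝒴} {f : Round 𝒳 𝒴 N m → ℝ}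
    {c : 𝒳 → 𝒴 → 𝒴 → ℝ} {u : Fin N → 𝒳 → 𝒴 → 𝒴 → Fin m × Bool → ℝ}
    (hf : ∀ o, f o = c o.x o.y₁ o.y₂ + ∑ n, u n o.x o.y₁ o.y₂ (o.obj n, o.pref n))
    (hH : ∀ x y₁ y₂, exp (c x y₁ y₂) *
      ∏ n, ∑ a, M.reportProb n x y₁ y₂ a * exp (u n x y₁ y₂ a) ≤ 1) :
    ∑' o, ENNReal.ofReal (M.roundProb π o) * ENNReal.ofReal (exp (f o)) ≤ 1 := by
  refine (tsum_roundProb_mul_exp_le (H := fun _ _ _ => 1) hf hH).trans_eq ?_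
  simp only [mul_one]
  exact tsum_queryProb π

lemma sum_reportProb_mul (n : Fin N) (x : 𝒳) (y₁ y₂ : 𝒴) (g : Fin m × Bool → ℝ) :
    ∑ a, M.reportProb n x y₁ y₂ a * g a =
      ∑ i, softmax (M.logits (M.αstar n) M.θstar x y₁ y₂) i *
        (sigmoid (M.margin i (M.θstar i) x y₁ y₂) * g (i, true) +
          sigmoid (-M.margin i (M.θstar i) x y₁ y₂) * g (i, false)) := by
  rw [Fintype.sum_prod_type]
  refine Finset.sum_congr rfl fun i _ => ?_
  simp only [reportProb, Fintype.sum_bool]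
  simp
  ring

lemma sum_reportProb [NeZero m] (n : Fin N) (x : 𝒳) (y₁ y₂ : 𝒴) :
    ∑ a, M.reportProb n x y₁ y₂ a = 1 := by
  have h := sum_reportProb_mul (M := M) n x y₁ y₂ fun _ => 1
  simpa only [mul_one, sigmoid_neg, add_sub_cancel, sum_softmax] using h

/-- The test for the preferences on the objective `i`. -/
def prefTest (M : Model 𝒳 𝒴 N m d) (i : Fin m) (θ : EuclideanSpace ℝ (Fin d))
    (o : Round 𝒳 𝒴 N m) : ℝ :=
  N * (1 / (m * exp M.B)) * ((sigmoid (M.margin i θ o.x o.y₁ o.y₂) -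
      sigmoid (M.margin i (M.θstar i) o.x o.y₁ o.y₂)) ^ 2 / 8) +
    ∑ n, if o.obj n = i then
      (log (sigmoid (M.reward i θ o.x (o.win n) - M.reward i θ o.x (o.lose n))) -
      log (sigmoid (M.reward i (M.θstar i) o.x (o.win n) -
        M.reward i (M.θstar i) o.x (o.lose n)))) / 2 else 0

/-- Each group reports `i` with probability at least `q₀ = 1 / (m * exp B)`, and then the affinity
is at most `1 - h`. So each group contributes at most `1 - q₀ * h ≤ exp (-(q₀ * h))`, and the
deterministic term of the test compensates all `N` factors. -/
lemma tsum_exp_prefTest_le [NeZero m] (hM : M.Valid) (π : 𝒳 → PMF 𝒴) (i : Fin m)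
    (θ : EuclideanSpace ℝ (Fin d)) :
    ∑' o, ENNReal.ofReal (M.roundProb π o) * ENNReal.ofReal (exp (M.prefTest i θ o)) ≤ 1 := by
  refine tsum_roundProb_mul_exp_le_one
    (c := fun x y₁ y₂ => N * (1 / (m * exp M.B)) * ((sigmoid (M.margin i θ x y₁ y₂) -
      sigmoid (M.margin i (M.θstar i) x y₁ y₂)) ^ 2 / 8))
    (u := fun n x y₁ y₂ a => if a.1 = i then
      (log (sigmoid (if a.2 then M.margin i θ x y₁ y₂ else -M.margin i θ x y₁ y₂)) -
      log (sigmoid (if a.2 then M.margin i (M.θstar i) x y₁ y₂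
        else -M.margin i (M.θstar i) x y₁ y₂))) / 2 else 0)
    (fun o => by simp only [prefTest, reward_win_sub_lose]) fun x y₁ y₂ => ?_
  set a := M.margin i θ x y₁ y₂
  set b := M.margin i (M.θstar i) x y₁ y₂ with hb
  set h := (sigmoid a - sigmoid b) ^ 2 / 8 with hh
  set q₀ := 1 / (m * exp M.B) with hq₀
  have hq₀0 : 0 ≤ q₀ := by positivity
  have hh0 : 0 ≤ h := by positivity
  have key : ∀ n : Fin N, ∑ c : Fin m × Bool, M.reportProb n x y₁ y₂ c * exp (if c.1 = i then
      (log (sigmoid (if c.2 then a else -a)) - log (sigmoid (if c.2 then b else -b))) / 2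
      else 0) ≤ exp (-(q₀ * h)) := by
    intro n
    rw [sum_reportProb_mul]
    set s := softmax (M.logits (M.αstar n) M.θstar x y₁ y₂) with hs
    have hsum : ∑ j, s j = 1 := sum_softmax _
    have hsi : q₀ ≤ s i := softmax_ge (logits_mem (hM.αstar_mem n) hM.θstar_mem x y₁ y₂) i
    have hs0 : ∀ j, 0 ≤ s j := fun j => (softmax_pos _ j).le
    calc _ ≤ ∑ j, (s j - if j = i then s j * h else 0) := by
          refine Finset.sum_le_sum fun j _ => ?_
          by_cases hj : j = i
          · subst hj
            have := bernoulli_affinity_le a b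
            have h2 := mul_le_mul_of_nonneg_left this (hs0 j)
            simp only [if_true, ← hb, Bool.false_eq_true, if_false]
            rw [← hh] at h2
            linarith
          · simp only [hj, if_false, exp_zero, mul_one, sigmoid_neg, sub_zero]
            linarith
      _ = 1 - s i * h := by simp [Finset.sum_sub_distrib, hsum]
      _ ≤ 1 - q₀ * h := by nlinarith
      _ ≤ _ := by linarith [add_one_le_exp (-(q₀ * h))]
  calc _ ≤ exp (N * q₀ * h) * ∏ _n : Fin N, exp (-(q₀ * h)) := by
        refine mul_le_mul_of_nonneg_left (Finset.prod_le_prod (fun n _ => ?_) fun n _ => key n)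
          (exp_pos _).le
        exact Finset.sum_nonneg fun c _ => mul_nonneg (reportProb_nonneg _ _ _ _ _) (exp_pos _).le
    _ = 1 := by
        rw [Finset.prod_const, Finset.card_univ, Fintype.card_fin, ← exp_nat_mul, ← exp_add]
        simp only [exp_eq_one_iff]; ring

/-- The test for the weights of group `n`. -/
def weightTest (M : Model 𝒳 𝒴 N m d) (n : Fin N) (α : Fin m → ℝ)
    (θ : Fin m → EuclideanSpace ℝ (Fin d)) (o : Round 𝒳 𝒴 N m) : ℝ :=
  (∑ i, (√(softmax (M.logits α θ o.x o.y₁ o.y₂) i) -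
      √(softmax (M.logits (M.αstar n) θ o.x o.y₁ o.y₂) i)) ^ 2) / 4 -
    4 * exp M.B ^ 4 * ∑ i, (M.margin i (θ i) o.x o.y₁ o.y₂ -
      M.margin i (M.θstar i) o.x o.y₁ o.y₂) ^ 2 +
    (log (softmax (M.logits α θ o.x o.y₁ o.y₂) (o.obj n)) -
      log (softmax (M.logits (M.αstar n) θ o.x o.y₁ o.y₂) (o.obj n))) / 2

lemma abs_logits_sub_le {α : Fin m → ℝ} (hα : α ∈ stdSimplex ℝ (Fin m))
    (θ θ' : Fin m → EuclideanSpace ℝ (Fin d)) (x : 𝒳) (y₁ y₂ : 𝒴) (i : Fin m) :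
    |M.logits α θ x y₁ y₂ i - M.logits α θ' x y₁ y₂ i| ≤
      |M.margin i (θ i) x y₁ y₂ - M.margin i (θ' i) x y₁ y₂| := by
  have h1 := mem_Icc_of_mem_stdSimplex hα i
  unfold logits
  rw [← mul_sub, abs_mul, abs_of_nonneg h1.1]
  calc _ ≤ 1 * |(|M.margin i (θ i) x y₁ y₂| - |M.margin i (θ' i) x y₁ y₂|)| :=
        mul_le_mul_of_nonneg_right h1.2 (abs_nonneg _)
    _ ≤ _ := by rw [one_mul]; exact abs_abs_sub_abs_le_abs_sub _ _

/-- Objectives are reported under the true rewards, but both likelihoods use `θ`. The chi-square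
cost of this misspecification is quadratic in the margin errors, which the preference tests control;
a linear cost would spoil the rate. -/
lemma tsum_exp_weightTest_le [NeZero m] (hM : M.Valid) (π : 𝒳 → PMF 𝒴) (n : Fin N)
    (α : Fin m → ℝ) {θ : Fin m → EuclideanSpace ℝ (Fin d)} (hθ : ∀ i, θ i ∈ M.paramSet i) :
    ∑' o, ENNReal.ofReal (M.roundProb π o) * ENNReal.ofReal (exp (M.weightTest n α θ o)) ≤ 1 := by
  refine tsum_roundProb_mul_exp_le_one
    (c := fun x y₁ y₂ => (∑ i, (√(softmax (M.logits α θ x y₁ y₂) i) -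
      √(softmax (M.logits (M.αstar n) θ x y₁ y₂) i)) ^ 2) / 4 -
    4 * exp M.B ^ 4 * ∑ i, (M.margin i (θ i) x y₁ y₂ - M.margin i (M.θstar i) x y₁ y₂) ^ 2)
    (u := fun n' x y₁ y₂ a => if n' = n then (log (softmax (M.logits α θ x y₁ y₂) a.1) -
      log (softmax (M.logits (M.αstar n) θ x y₁ y₂) a.1)) / 2 else 0)
    (fun o => by simp [weightTest]) fun x y₁ y₂ => ?_
  set p := softmax (M.logits (M.αstar n) M.θstar x y₁ y₂) with hp
  set q := softmax (M.logits (M.αstar n) θ x y₁ y₂) with hq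
  set q' := softmax (M.logits α θ x y₁ y₂) with hq'
  have hother : ∀ n' : Fin N, n' ≠ n → ∑ a : Fin m × Bool, M.reportProb n' x y₁ y₂ a *
      exp (if n' = n then (log (q' a.1) - log (q a.1)) / 2 else 0) = 1 := by
    intro n' hn'
    rw [sum_reportProb_mul]
    simp only [hn', if_false, exp_zero, mul_one, sigmoid_neg, add_sub_cancel]
    exact sum_softmax _
  rw [Finset.prod_eq_single n (fun n' _ hn' => hother n' hn') (by simp), sum_reportProb_mul]
  simp only [if_true, ← add_mul, sigmoid_neg, add_sub_cancel, one_mul]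
  have h1 := sum_mul_exp_half_log_le (p := p) (q := q) (q' := q') (sum_softmax _) (sum_softmax _)
    (sum_softmax _) (fun i => softmax_pos _ i) (fun i => softmax_pos _ i)
  obtain ⟨j, -, hj⟩ := Finset.exists_max_image Finset.univ (fun k =>
    |M.logits (M.αstar n) M.θstar x y₁ y₂ k - M.logits (M.αstar n) θ x y₁ y₂ k|)
    ⟨0, Finset.mem_univ _⟩
  have hjB : |M.logits (M.αstar n) M.θstar x y₁ y₂ j - M.logits (M.αstar n) θ x y₁ y₂ j| ≤ M.B := by
    have h1 := logits_mem (hM.αstar_mem n) hM.θstar_mem x y₁ y₂ j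
    have h2 := logits_mem (hM.αstar_mem n) hθ x y₁ y₂ j
    exact abs_le.2 ⟨by linarith [h1.1, h2.2], by linarith [h1.2, h2.1]⟩
  have h2 := softmax_chiSq_le (fun i => hj i (Finset.mem_univ i)) hjB
  have h3 : |M.logits (M.αstar n) M.θstar x y₁ y₂ j - M.logits (M.αstar n) θ x y₁ y₂ j| ^ 2 ≤
      ∑ i, (M.margin i (θ i) x y₁ y₂ - M.margin i (M.θstar i) x y₁ y₂) ^ 2 := by
    refine (pow_le_pow_left₀ (abs_nonneg _)
      (abs_logits_sub_le (hM.αstar_mem n) M.θstar θ x y₁ y₂ j) 2).trans ?_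
    rw [sq_abs, ← neg_sub, neg_sq]
    exact Finset.single_le_sum
      (f := fun i => (M.margin i (θ i) x y₁ y₂ - M.margin i (M.θstar i) x y₁ y₂) ^ 2)
      (fun i _ => sq_nonneg _) (Finset.mem_univ j)
  have h4 : 4 * exp M.B ^ 4 *
      |M.logits (M.αstar n) M.θstar x y₁ y₂ j - M.logits (M.αstar n) θ x y₁ y₂ j| ^ 2 ≤
      4 * exp M.B ^ 4 *
        ∑ i, (M.margin i (θ i) x y₁ y₂ - M.margin i (M.θstar i) x y₁ y₂) ^ 2 := by gcongr
  set c := (∑ i, (√(q' i) - √(q i)) ^ 2) / 4 - 4 * exp M.B ^ 4 *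
    ∑ i, (M.margin i (θ i) x y₁ y₂ - M.margin i (M.θstar i) x y₁ y₂) ^ 2 with hc
  calc _ ≤ exp c * exp (-c) := by
        refine mul_le_mul_of_nonneg_left ?_ (exp_pos _).le
        have := add_one_le_exp (-c)
        linarith
    _ = 1 := by rw [← exp_add]; simp

lemma ofReal_expect (π : 𝒳 → PMF 𝒴) {g : 𝒳 → 𝒴 → ℝ} {K : ℝ} (hg0 : ∀ x y, 0 ≤ g x y)
    (hgK : ∀ x y, g x y ≤ K) :
    ENNReal.ofReal (M.expect π g) =
      ∑' x, ∑' y, ENNReal.ofReal ((M.ρ x).toReal * ((π x y).toReal * g x y)) := by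
  have hK : ∀ x y, |g x y| ≤ K := fun x y => by rw [abs_of_nonneg (hg0 x y)]; exact hgK x y
  unfold expect
  rw [ENNReal.ofReal_tsum_of_nonneg (fun x => mul_nonneg ENNReal.toReal_nonneg
    (tsum_nonneg fun y => mul_nonneg ENNReal.toReal_nonneg (hg0 x y))) (summable_expect π hK)]
  congr 1 with x
  rw [← tsum_mul_left, ENNReal.ofReal_tsum_of_nonneg (fun y => mul_nonneg ENNReal.toReal_nonneg
    (mul_nonneg ENNReal.toReal_nonneg (hg0 x y)))
    ((summable_pmf_mul (π x) (hK x)).mul_left _)]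

/-- The gap of a comparable policy bounds the mean absolute margin of a query from below. -/
lemma ofReal_gap_le (hM : M.Valid) {π πstar : 𝒳 → PMF 𝒴} (hπ : M.RatioBound π)
    (hπstar : M.RatioBound πstar) (i : Fin m) :
    ENNReal.ofReal (M.gap πstar i / exp (M.B / M.β) ^ 3) ≤
      ∑' p : 𝒳 × 𝒴 × 𝒴, ENNReal.ofReal (M.queryProb π p *
        |M.margin i (M.θstar i) p.1 p.2.1 p.2.2|) := by
  have hB : ∀ x y₁ y₂, |(|M.margin i (M.θstar i) x y₁ y₂|)| ≤ M.B := fun x y₁ y₂ => by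
    rw [abs_abs]; exact abs_margin_le (hM.θstar_mem i) x y₁ y₂
  have hin : ∀ x y₁, Summable fun y₂ => (M.πref x y₂).toReal * |M.margin i (M.θstar i) x y₁ y₂| :=
    fun x y₁ => summable_pmf_mul (M.πref x) (hB x y₁)
  have e : ENNReal.ofReal (M.gap πstar i) = ∑' x, ∑' y₁, ∑' y₂, ENNReal.ofReal
      ((M.ρ x).toReal * ((πstar x y₁).toReal * ((M.πref x y₂).toReal *
        |M.margin i (M.θstar i) x y₁ y₂|))) := by
    change ENNReal.ofReal (M.expect πstar fun x y₁ => ∑' y₂, (M.πref x y₂).toReal *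
      |M.margin i (M.θstar i) x y₁ y₂|) = _
    rw [ofReal_expect πstar (K := M.B)
      (fun x y₁ => tsum_nonneg fun y₂ => mul_nonneg ENNReal.toReal_nonneg (abs_nonneg _))
      (fun x y₁ => (le_abs_self _).trans (abs_tsum_pmf_mul_le (M.πref x) (hB x y₁)))]
    congr 1 with x
    congr 1 with y₁
    rw [← tsum_mul_left, ← tsum_mul_left, ENNReal.ofReal_tsum_of_nonneg
      (fun y₂ => by positivity) (((hin x y₁).mul_left _).mul_left _)]
  have hF : 0 < exp (M.B / M.β) := exp_pos _
  rw [div_eq_mul_inv, mul_comm, ENNReal.ofReal_mul (by positivity), e,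
    ENNReal.tsum_prod', ← ENNReal.tsum_mul_left]
  refine ENNReal.tsum_le_tsum fun x => ?_
  rw [ENNReal.tsum_prod', ← ENNReal.tsum_mul_left]
  refine ENNReal.tsum_le_tsum fun y₁ => ?_
  rw [← ENNReal.tsum_mul_left]
  refine ENNReal.tsum_le_tsum fun y₂ => ?_
  rw [← ENNReal.ofReal_mul (by positivity)]
  refine ENNReal.ofReal_le_ofReal ?_
  by_cases hx : M.ρ x = 0
  · simp [hx, queryProb]
  -- Three changes of measure, each costing `exp (B / β)`: `πstar` to `πref` to `π` for the first
  -- response, and `πref` to `π` for the second.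
  have h1 := hπstar.le hx y₁
  have h2 := hπ.ge hx y₁
  have h3 := hπ.ge hx y₂
  unfold queryProb
  simp only
  rw [inv_mul_le_iff₀ (by positivity)]
  calc _ ≤ (M.ρ x).toReal * ((exp (M.B / M.β) * (exp (M.B / M.β) * (π x y₁).toReal)) *
        ((exp (M.B / M.β) * (π x y₂).toReal) * |M.margin i (M.θstar i) x y₁ y₂|)) := by
        gcongr
        exact h1.trans (by gcongr)
    _ = _ := by ring

/-- The test for the size of the margins. -/
def marginTest (M : Model 𝒳 𝒴 N m d) (g : ℝ) (i : Fin m) (o : Round 𝒳 𝒴 N m) : ℝ :=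
  -(M.margin i (M.θstar i) o.x o.y₁ o.y₂ ^ 2 / M.B ^ 2) + g ^ 2 / (2 * M.B ^ 2)

lemma exp_neg_le_one_sub_half {x : ℝ} (h0 : 0 ≤ x) (h1 : x ≤ 1) : exp (-x) ≤ 1 - x / 2 := by
  have h := add_one_le_exp x
  have h2 : exp (-x) * exp x = 1 := by rw [← exp_add]; simp
  have h3 : exp (-x) * (1 + x) ≤ 1 := by nlinarith [exp_pos (-x)]
  nlinarith [exp_pos (-x)]

/-- With `Y ≤ B` the absolute margin, `exp (-Y² / B²) ≤ 1 - Y² / (2B²)`, and `Y² ≥ 2gY - g²` makes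
this linear in `Y`. As the mean of `Y` is at least `g`, the expectation is at most `exp κ * (1 - κ)
≤ 1` for `κ = g² / (2B²)`. -/
lemma tsum_exp_marginTest_le [NeZero m] (hM : M.Valid) {π πstar : 𝒳 → PMF 𝒴}
    (hπ : M.RatioBound π) (hπstar : M.RatioBound πstar) {γ : ℝ} (hγ : 0 < γ) {i : Fin m}
    (hgap : γ ≤ M.gap πstar i) :
    ∑' o, ENNReal.ofReal (M.roundProb π o) *
      ENNReal.ofReal (exp (M.marginTest (γ / exp (M.B / M.β) ^ 3) i o)) ≤ 1 := by
  set g := γ / exp (M.B / M.β) ^ 3 with hg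
  have hg0 : 0 < g := by positivity
  have hB : 0 < M.B := by linarith [hM.one_le_B]
  set κ := g ^ 2 / (2 * M.B ^ 2) with hκ
  set Y : 𝒳 × 𝒴 × 𝒴 → ℝ := fun p => |M.margin i (M.θstar i) p.1 p.2.1 p.2.2| with hY
  have hYB : ∀ p, Y p ≤ M.B := fun p => abs_margin_le (hM.θstar_mem i) _ _ _
  refine (tsum_roundProb_mul_exp_le
    (c := fun x y₁ y₂ => -(M.margin i (M.θstar i) x y₁ y₂ ^ 2 / M.B ^ 2) + κ) (u := fun _ _ _ _ _ => 0)
    (H := fun x y₁ y₂ => exp (-(M.margin i (M.θstar i) x y₁ y₂ ^ 2 / M.B ^ 2) + κ))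
    (fun o => by simp [marginTest, hκ]) (fun x y₁ y₂ => ?_)).trans ?_
  · simp only [exp_zero, mul_one, sum_reportProb, Finset.prod_const_one, le_refl]
  have hb : 0 ≤ g / M.B ^ 2 := by positivity
  have hpt : ∀ p : 𝒳 × 𝒴 × 𝒴,
      exp (-(M.margin i (M.θstar i) p.1 p.2.1 p.2.2 ^ 2 / M.B ^ 2) + κ) ≤
      exp κ * (1 + κ - g / M.B ^ 2 * Y p) := by
    intro p
    rw [exp_add, mul_comm]
    refine mul_le_mul_of_nonneg_left ?_ (exp_pos _).le
    rw [← sq_abs]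
    change exp (-(Y p ^ 2 / M.B ^ 2)) ≤ _
    have hY0 : 0 ≤ Y p := abs_nonneg _
    refine (exp_neg_le_one_sub_half (by positivity) ?_).trans ?_
    · rw [div_le_one (by positivity)]
      exact pow_le_pow_left₀ hY0 (hYB p) 2
    · have : 0 ≤ (Y p - g) ^ 2 / (2 * M.B ^ 2) := by positivity
      have e : (Y p - g) ^ 2 / (2 * M.B ^ 2) =
          Y p ^ 2 / M.B ^ 2 / 2 - g / M.B ^ 2 * Y p + κ := by
        rw [hκ]; field_simp; ring
      linarith
  have hnn : ∀ p, 0 ≤ 1 + κ - g / M.B ^ 2 * Y p := fun p => by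
    by_contra! h
    have := (exp_pos _).trans_le (hpt p)
    nlinarith [exp_pos κ]
  set S := ∑' p, ENNReal.ofReal (M.queryProb π p * (1 + κ - g / M.B ^ 2 * Y p)) with hS
  -- The linear term is added back, so that subtraction in `[0, ∞]` occurs only once, for finite
  -- totals.
  have h1 : S + ENNReal.ofReal (g / M.B ^ 2) *
      (∑' p, ENNReal.ofReal (M.queryProb π p * Y p)) = ENNReal.ofReal (1 + κ) := by
    rw [hS, ← ENNReal.tsum_mul_left, ← ENNReal.tsum_add]
    have : ∀ p, ENNReal.ofReal (M.queryProb π p * (1 + κ - g / M.B ^ 2 * Y p)) +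
        ENNReal.ofReal (g / M.B ^ 2) * ENNReal.ofReal (M.queryProb π p * Y p) =
        ENNReal.ofReal (M.queryProb π p) * ENNReal.ofReal (1 + κ) := by
      intro p
      have hq := queryProb_nonneg (M := M) π p
      rw [← ENNReal.ofReal_mul hb, ← ENNReal.ofReal_mul hq,
        ← ENNReal.ofReal_add (mul_nonneg hq (hnn p))
          (mul_nonneg hb (mul_nonneg hq (abs_nonneg _)))]
      congr 1; ring
    simp only [this]
    rw [ENNReal.tsum_mul_right, tsum_queryProb, one_mul]
  have h2 : ENNReal.ofReal g ≤ ∑' p, ENNReal.ofReal (M.queryProb π p * Y p) :=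
    (ENNReal.ofReal_le_ofReal (by rw [hg]; gcongr)).trans (ofReal_gap_le hM hπ hπstar i)
  have h3 : S ≤ ENNReal.ofReal (1 - κ) := by
    have h4 : S + ENNReal.ofReal (g / M.B ^ 2 * g) ≤ ENNReal.ofReal (1 + κ) := by
      rw [← h1, ENNReal.ofReal_mul hb]
      gcongr
    have h5 := ENNReal.le_sub_of_add_le_right ENNReal.ofReal_ne_top h4
    rw [← ENNReal.ofReal_sub _ (by positivity)] at h5
    convert h5 using 2
    rw [hκ]; field_simp; ring
  calc _ ≤ ∑' p, ENNReal.ofReal (exp κ) *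
        ENNReal.ofReal (M.queryProb π p * (1 + κ - g / M.B ^ 2 * Y p)) := by
        refine ENNReal.tsum_le_tsum fun p => ?_
        rw [← ENNReal.ofReal_mul (exp_pos _).le]
        refine ENNReal.ofReal_le_ofReal ?_
        calc _ ≤ M.queryProb π p * (exp κ * (1 + κ - g / M.B ^ 2 * Y p)) :=
              mul_le_mul_of_nonneg_left (hpt p) (queryProb_nonneg π p)
          _ = _ := by ring
    _ = ENNReal.ofReal (exp κ) * S := ENNReal.tsum_mul_left
    _ ≤ ENNReal.ofReal (exp κ) * ENNReal.ofReal (1 - κ) := by gcongr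
    _ = ENNReal.ofReal (exp κ * (1 - κ)) := (ENNReal.ofReal_mul (exp_pos _).le).symm
    _ ≤ ENNReal.ofReal 1 := by
        refine ENNReal.ofReal_le_ofReal ?_
        have h6 := add_one_le_exp (-κ)
        calc _ ≤ exp κ * exp (-κ) := by gcongr; linarith
          _ = 1 := by rw [← exp_add]; simp
    _ = 1 := ENNReal.ofReal_one

end Model

/-! ### Deterministic consequences of maximum likelihood, and the parameter net. -/

namespace Model

open Real (exp log sigmoid exp_pos)

variable {𝒳 𝒴 : Type*} {N m d : ℕ} {M : Model 𝒳 𝒴 N m d}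

section Deterministic

variable {o : ℕ → Round 𝒳 𝒴 N m} {k t : ℕ} {Λ : ℝ}

lemma sum_Ico_const_le (hkt : k ≤ t) (ht : 1 ≤ t) {c : ℝ} (hc : 0 ≤ c) :
    ∑ _s ∈ Finset.Ico 1 k, c * (1 / (t : ℝ)) ≤ c := by
  have h1 : ((k - 1 : ℕ) : ℝ) ≤ t := by exact_mod_cast (Nat.sub_le k 1).trans hkt
  have h2 : (0 : ℝ) < t := by exact_mod_cast ht
  rw [Finset.sum_const, Nat.card_Ico, nsmul_eq_mul]
  calc _ ≤ (t : ℝ) * (c * (1 / t)) := by gcongr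
    _ = c := by field_simp

/-- The squared estimation error of the margins on the past data, for a point `θ'` close to a
maximum likelihood estimate `θ`. -/
lemma sum_sq_margin_sub_le [NeZero m] (hM : M.Valid) (hN : 1 ≤ N) (hkt : k ≤ t) (ht : 1 ≤ t)
    (hΛ : 0 ≤ Λ) {i : Fin m} {θ θ' : EuclideanSpace ℝ (Fin d)} (hθ' : θ' ∈ M.paramSet i)
    (hmin : ∀ ϑ ∈ M.paramSet i, M.prefLoss o k i θ ≤ M.prefLoss o k i ϑ)
    (hclose : ∀ x y₁ y₂, |M.margin i θ x y₁ y₂ - M.margin i θ' x y₁ y₂| ≤ 1 / t)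
    (htest : ∑ s ∈ Finset.Ico 1 k, M.prefTest i θ' (o s) ≤ Λ) :
    ∑ s ∈ Finset.Ico 1 k, (M.margin i θ' (o s).x (o s).y₁ (o s).y₂ -
      M.margin i (M.θstar i) (o s).x (o s).y₁ (o s).y₂) ^ 2 ≤
        128 * m * exp M.B ^ 3 * (Λ + 1) := by
  set h : ℕ → ℝ := fun s => (sigmoid (M.margin i θ' (o s).x (o s).y₁ (o s).y₂) -
      sigmoid (M.margin i (M.θstar i) (o s).x (o s).y₁ (o s).y₂)) ^ 2 / 8 with hh
  have hm : (0 : ℝ) < m := Nat.cast_pos.2 (NeZero.pos m)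
  have hE : 0 < exp M.B := exp_pos _
  have hN' : (1 : ℝ) ≤ N := by exact_mod_cast hN
  have e1 : ∑ s ∈ Finset.Ico 1 k, M.prefTest i θ' (o s) =
      N * (1 / (m * exp M.B)) * ∑ s ∈ Finset.Ico 1 k, h s +
        (M.prefLoss o k i (M.θstar i) - M.prefLoss o k i θ') / 2 := by
    simp only [prefTest, Finset.sum_add_distrib, ← Finset.mul_sum, prefLoss]
    congr 1
    rw [neg_sub_neg, ← Finset.sum_sub_distrib, Finset.sum_div]
    refine Finset.sum_congr rfl fun s _ => ?_
    rw [← Finset.sum_sub_distrib, Finset.sum_div]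
    refine Finset.sum_congr rfl fun n _ => ?_
    split_ifs <;> simp
  have e2 : M.prefLoss o k i θ' - M.prefLoss o k i θ ≤ N := by
    simp only [prefLoss]
    rw [neg_sub_neg, ← Finset.sum_sub_distrib]
    refine (Finset.sum_le_sum fun s _ => ?_).trans
      (sum_Ico_const_le hkt ht (Nat.cast_nonneg N))
    rw [← Finset.sum_sub_distrib]
    calc _ ≤ ∑ _n : Fin N, 1 / (t : ℝ) := by
          refine Finset.sum_le_sum fun n _ => ?_
          split_ifs
          · refine (log_sigmoid_sub_le _ _).trans ?_
            rw [reward_win_sub_lose, reward_win_sub_lose]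
            split_ifs
            · exact hclose _ _ _
            · rw [neg_sub_neg, abs_sub_comm]; exact hclose _ _ _
          · rw [sub_zero]; positivity
      _ = _ := by simp
  have e3 := hmin _ (hM.θstar_mem i)
  have hS : ∑ s ∈ Finset.Ico 1 k, h s ≤ m * exp M.B * (Λ + 1) := by
    rw [e1] at htest
    -- The rounding error is at most `N / 2`, and `Λ ≤ N * Λ`, so `N` cancels and the rate does not
    -- depend on the number of groups.
    have h1 : N * ((1 / (m * exp M.B)) * ∑ s ∈ Finset.Ico 1 k, h s) ≤ N * (Λ + 1) := by nlinarith
    have h2 := le_of_mul_le_mul_left h1 (by linarith)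
    rw [one_div, inv_mul_le_iff₀ (by positivity)] at h2
    exact h2
  calc _ ≤ ∑ s ∈ Finset.Ico 1 k, 128 * exp M.B ^ 2 * h s := by
        refine Finset.sum_le_sum fun s _ => ?_
        refine (sq_sub_le_sigmoid (abs_margin_le hθ' _ _ _)
          (abs_margin_le (hM.θstar_mem i) _ _ _)).trans_eq ?_
        simp only [hh]; ring
    _ = 128 * exp M.B ^ 2 * ∑ s ∈ Finset.Ico 1 k, h s := by rw [Finset.mul_sum]
    _ ≤ 128 * exp M.B ^ 2 * (m * exp M.B * (Λ + 1)) := by gcongr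
    _ = _ := by ring

lemma weightLogLik_sub_le {n : Fin N} {α α' : Fin m → ℝ}
    {θ θ' : Fin m → EuclideanSpace ℝ (Fin d)} {c : ℝ} (hc : 0 ≤ c) (hkt : k ≤ t) (ht : 1 ≤ t)
    (h : ∀ x y₁ y₂ i, |M.logits α θ x y₁ y₂ i - M.logits α' θ' x y₁ y₂ i| ≤ c * (1 / t)) :
    M.weightLogLik o k n θ α - M.weightLogLik o k n θ' α' ≤ 2 * c := by
  unfold weightLogLik
  rw [← Finset.sum_sub_distrib]
  refine (Finset.sum_le_sum fun s _ => ?_).trans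
    (sum_Ico_const_le hkt ht (by positivity : 0 ≤ 2 * c))
  refine (log_softmax_sub_le (h (o s).x (o s).y₁ (o s).y₂) ((o s).obj n)).trans_eq ?_
  ring

/-- The estimation error of the weights against the information in the margins. -/
lemma sum_hellinger_le [NeZero m] (hM : M.Valid) (hkt : k ≤ t) (ht : 1 ≤ t) {n : Fin N}
    {α α' : Fin m → ℝ} (hα : α ∈ stdSimplex ℝ (Fin m)) {θ θ' : Fin m → EuclideanSpace ℝ (Fin d)}
    (hθ' : ∀ i, θ' i ∈ M.paramSet i)
    (hmax : ∀ a ∈ stdSimplex ℝ (Fin m), M.weightLogLik o k n θ a ≤ M.weightLogLik o k n θ α)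
    (hclose : ∀ i x y₁ y₂, |M.margin i (θ i) x y₁ y₂ - M.margin i (θ' i) x y₁ y₂| ≤ 1 / t)
    (hαclose : ∀ i, |α i - α' i| ≤ 1 / t) {C : ℝ}
    (hC : ∀ i, ∑ s ∈ Finset.Ico 1 k, (M.margin i (θ' i) (o s).x (o s).y₁ (o s).y₂ -
      M.margin i (M.θstar i) (o s).x (o s).y₁ (o s).y₂) ^ 2 ≤ C)
    (htest : ∑ s ∈ Finset.Ico 1 k, M.weightTest n α' θ' (o s) ≤ Λ) :
    (∑ s ∈ Finset.Ico 1 k, ∑ i,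
      (√(softmax (M.logits α' θ' (o s).x (o s).y₁ (o s).y₂) i) -
        √(softmax (M.logits (M.αstar n) θ' (o s).x (o s).y₁ (o s).y₂) i)) ^ 2) / 4 ≤
      Λ + 3 * exp M.B + 4 * exp M.B ^ 4 * (m * C) := by
  have hB := hM.one_le_B
  have ht0 : (0 : ℝ) < t := by exact_mod_cast ht
  have hEB : M.B ≤ exp M.B := by linarith [Real.add_one_le_exp M.B]
  have e1 : ∑ s ∈ Finset.Ico 1 k, M.weightTest n α' θ' (o s) =
      (∑ s ∈ Finset.Ico 1 k, ∑ i,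
      (√(softmax (M.logits α' θ' (o s).x (o s).y₁ (o s).y₂) i) -
        √(softmax (M.logits (M.αstar n) θ' (o s).x (o s).y₁ (o s).y₂) i)) ^ 2) / 4 -
      4 * exp M.B ^ 4 * (∑ i, ∑ s ∈ Finset.Ico 1 k,
        (M.margin i (θ' i) (o s).x (o s).y₁ (o s).y₂ -
          M.margin i (M.θstar i) (o s).x (o s).y₁ (o s).y₂) ^ 2) +
      (M.weightLogLik o k n θ' α' - M.weightLogLik o k n θ' (M.αstar n)) / 2 := by
    rw [Finset.sum_comm (s := Finset.univ)]
    simp only [weightTest, Finset.sum_add_distrib, Finset.sum_sub_distrib, ← Finset.mul_sum,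
      ← Finset.sum_div]
    rfl
  have e2 : ∑ i, ∑ s ∈ Finset.Ico 1 k, (M.margin i (θ' i) (o s).x (o s).y₁ (o s).y₂ -
      M.margin i (M.θstar i) (o s).x (o s).y₁ (o s).y₂) ^ 2 ≤ m * C := by
    refine (Finset.sum_le_sum fun i _ => hC i).trans_eq ?_
    simp
  -- The pairs `(θ', αstar)` and `(θ', α')` are compared through `(θ, αstar)` and `(θ, α)`, where
  -- maximality applies. The two replacements cost `2` and `4 * B`, and half their sum is at most `3
  -- * exp B`.
  have e3 : M.weightLogLik o k n θ' (M.αstar n) - M.weightLogLik o k n θ (M.αstar n) ≤ 2 * 1 := by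
    refine weightLogLik_sub_le zero_le_one hkt ht fun x y₁ y₂ i => ?_
    rw [one_mul]
    refine (abs_logits_sub_le (hM.αstar_mem n) θ' θ x y₁ y₂ i).trans ?_
    rw [abs_sub_comm]
    exact hclose i x y₁ y₂
  have e4 : M.weightLogLik o k n θ α - M.weightLogLik o k n θ' α' ≤ 2 * (2 * M.B) := by
    refine weightLogLik_sub_le (by linarith) hkt ht fun x y₁ y₂ i => ?_
    have h1 := (abs_logits_sub_le hα θ θ' x y₁ y₂ i).trans (hclose i x y₁ y₂)
    have h2 : |M.logits α θ' x y₁ y₂ i - M.logits α' θ' x y₁ y₂ i| ≤ 1 / t * M.B := by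
      unfold logits
      rw [← sub_mul, abs_mul, abs_abs]
      exact mul_le_mul (hαclose i) (abs_margin_le (hθ' i) _ _ _) (abs_nonneg _) (by positivity)
    have h3 := abs_sub_le (M.logits α θ x y₁ y₂ i) (M.logits α θ' x y₁ y₂ i)
      (M.logits α' θ' x y₁ y₂ i)
    have h4 : 1 / (t : ℝ) * 1 ≤ 1 / t * M.B := by gcongr
    linarith
  have e5 := hmax _ (hM.αstar_mem n)
  have e6 : 4 * exp M.B ^ 4 * (∑ i, ∑ s ∈ Finset.Ico 1 k,
        (M.margin i (θ' i) (o s).x (o s).y₁ (o s).y₂ -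
          M.margin i (M.θstar i) (o s).x (o s).y₁ (o s).y₂) ^ 2) ≤
      4 * exp M.B ^ 4 * (m * C) := by gcongr
  rw [e1] at htest
  linarith

/-- The estimation error of the weights from `k - 1` rounds. -/
lemma mul_sq_norm_sub_le [NeZero m] (hM : M.Valid) (hkt : k ≤ t) (ht : 1 ≤ t)
    (hΛ : 0 ≤ Λ) {n : Fin N} {α α' : Fin m → ℝ} (hα : α ∈ stdSimplex ℝ (Fin m))
    (hα' : α' ∈ stdSimplex ℝ (Fin m)) {θ θ' : Fin m → EuclideanSpace ℝ (Fin d)}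
    (hθ' : ∀ i, θ' i ∈ M.paramSet i)
    (hmin : ∀ i, ∀ ϑ ∈ M.paramSet i, M.prefLoss o k i (θ i) ≤ M.prefLoss o k i ϑ)
    (hmax : ∀ a ∈ stdSimplex ℝ (Fin m), M.weightLogLik o k n θ a ≤ M.weightLogLik o k n θ α)
    (hclose : ∀ i x y₁ y₂, |M.margin i (θ i) x y₁ y₂ - M.margin i (θ' i) x y₁ y₂| ≤ 1 / t)
    (hαclose : ∀ i, |α i - α' i| ≤ 1 / t) {g : ℝ}
    (htest₁ : ∀ i, ∑ s ∈ Finset.Ico 1 k, M.prefTest i (θ' i) (o s) ≤ Λ)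
    (htest₂ : ∑ s ∈ Finset.Ico 1 k, M.weightTest n α' θ' (o s) ≤ Λ)
    (htest₃ : ∀ i, ∑ s ∈ Finset.Ico 1 k, M.marginTest g i (o s) ≤ Λ) :
    ((k - 1 : ℕ) : ℝ) * (g * ‖α' - M.αstar n‖) ^ 2 ≤
      67000 * m ^ 3 * exp M.B ^ 8 * (Λ + 1) := by
  have hm : (1 : ℝ) ≤ m := by exact_mod_cast NeZero.one_le
  have hN : 1 ≤ N := n.pos
  have hB := hM.one_le_B
  have hEB : M.B ≤ exp M.B := by linarith [Real.add_one_le_exp M.B]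
  have hE : 1 ≤ exp M.B := hB.trans hEB
  set E := exp M.B with hEdef
  set C := 128 * m * E ^ 3 * (Λ + 1) with hC
  have hC1 : ∀ i, ∑ s ∈ Finset.Ico 1 k, (M.margin i (θ' i) (o s).x (o s).y₁ (o s).y₂ -
      M.margin i (M.θstar i) (o s).x (o s).y₁ (o s).y₂) ^ 2 ≤ C := fun i =>
    sum_sq_margin_sub_le hM hN hkt ht hΛ (hθ' i) (hmin i) (hclose i) (htest₁ i)
  have hH := sum_hellinger_le hM hkt ht hα hθ' hmax hclose hαclose hC1 htest₂
  set a := α' - M.αstar n with ha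
  have hasum : ∑ i, a i = 0 := by
    simp only [ha, Pi.sub_apply, Finset.sum_sub_distrib, hα'.2, (hM.αstar_mem n).2, sub_self]
  have han : ‖a‖ ≤ 1 := by
    refine (pi_norm_le_iff_of_nonneg zero_le_one).2 fun i => ?_
    have h1 := mem_Icc_of_mem_stdSimplex hα' i
    have h2 := mem_Icc_of_mem_stdSimplex (hM.αstar_mem n) i
    simp only [ha, Pi.sub_apply, Real.norm_eq_abs]
    exact abs_le.2 ⟨by linarith [h1.1, h2.2], by linarith [h1.2, h2.1]⟩
  -- The pair depends only on `a`, so one objective `i` serves all rounds and its squared margins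
  -- can be summed.
  obtain ⟨i, j, hij⟩ := exists_pair_of_sum_eq_zero hasum
  have hpt : ∀ s, ‖a‖ ^ 2 * M.margin i (θ' i) (o s).x (o s).y₁ (o s).y₂ ^ 2 ≤
      8 * (m * E) * ∑ i, (√(softmax (M.logits α' θ' (o s).x (o s).y₁ (o s).y₂) i) -
        √(softmax (M.logits (M.αstar n) θ' (o s).x (o s).y₁ (o s).y₂) i)) ^ 2 := by
    intro s
    have h1 := hij (fun i => |M.margin i (θ' i) (o s).x (o s).y₁ (o s).y₂|) fun _ => abs_nonneg _
    have h2 := sq_logit_sub_le (logits_mem hα' hθ' (o s).x (o s).y₁ (o s).y₂)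
      (logits_mem (hM.αstar_mem n) hθ' (o s).x (o s).y₁ (o s).y₂) i j
    simp only [sq_abs] at h1
    refine h1.trans (le_trans (le_of_eq ?_) h2)
    simp only [logits, ha, Pi.sub_apply]
    ring
  have hC2 : ‖a‖ ^ 2 * ∑ s ∈ Finset.Ico 1 k, M.margin i (θ' i) (o s).x (o s).y₁ (o s).y₂ ^ 2 ≤
      32 * (m * E) * (Λ + 3 * E + 4 * E ^ 4 * (m * C)) := by
    rw [Finset.mul_sum]
    refine (Finset.sum_le_sum fun s _ => hpt s).trans ?_
    rw [← Finset.mul_sum]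
    have := mul_le_mul_of_nonneg_left hH (show 0 ≤ 32 * (m * E) by positivity)
    linarith
  have hst : ∑ s ∈ Finset.Ico 1 k, M.margin i (M.θstar i) (o s).x (o s).y₁ (o s).y₂ ^ 2 ≤
      2 * ∑ s ∈ Finset.Ico 1 k, M.margin i (θ' i) (o s).x (o s).y₁ (o s).y₂ ^ 2 + 2 * C := by
    have h1 := hC1 i
    calc _ ≤ ∑ s ∈ Finset.Ico 1 k, (2 * M.margin i (θ' i) (o s).x (o s).y₁ (o s).y₂ ^ 2 +
          2 * (M.margin i (θ' i) (o s).x (o s).y₁ (o s).y₂ -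
            M.margin i (M.θstar i) (o s).x (o s).y₁ (o s).y₂) ^ 2) := by
          refine Finset.sum_le_sum fun s _ => ?_
          nlinarith [sq_nonneg (2 * M.margin i (θ' i) (o s).x (o s).y₁ (o s).y₂ -
            M.margin i (M.θstar i) (o s).x (o s).y₁ (o s).y₂)]
      _ ≤ _ := by
          rw [Finset.sum_add_distrib, ← Finset.mul_sum, ← Finset.mul_sum]
          linarith
  have hmg : ((k - 1 : ℕ) : ℝ) * g ^ 2 ≤
      2 * ∑ s ∈ Finset.Ico 1 k, M.margin i (M.θstar i) (o s).x (o s).y₁ (o s).y₂ ^ 2 +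
        2 * M.B ^ 2 * Λ := by
    have h1 := htest₃ i
    simp only [marginTest, Finset.sum_add_distrib, Finset.sum_neg_distrib, ← Finset.sum_div,
      Finset.sum_const, Nat.card_Ico, nsmul_eq_mul] at h1
    have h2 := mul_le_mul_of_nonneg_left h1 (show 0 ≤ 2 * M.B ^ 2 by positivity)
    have h3 : 2 * M.B ^ 2 * (-((∑ s ∈ Finset.Ico 1 k,
        M.margin i (M.θstar i) (o s).x (o s).y₁ (o s).y₂ ^ 2) / M.B ^ 2) +
        ((k - 1 : ℕ) : ℝ) * g ^ 2 / (2 * M.B ^ 2)) =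
        -(2 * ∑ s ∈ Finset.Ico 1 k, M.margin i (M.θstar i) (o s).x (o s).y₁ (o s).y₂ ^ 2) +
          ((k - 1 : ℕ) : ℝ) * g ^ 2 := by
      have : M.B ≠ 0 := by linarith
      field_simp
    rw [h3] at h2
    linarith
  have ha2 : ‖a‖ ^ 2 ≤ 1 := pow_le_one₀ (norm_nonneg _) han
  have ha0 : 0 ≤ ‖a‖ ^ 2 := sq_nonneg _
  have hmain : ((k - 1 : ℕ) : ℝ) * (g * ‖a‖) ^ 2 ≤
      4 * (32 * (m * E) * (Λ + 3 * E + 4 * E ^ 4 * (m * C))) + 4 * C + 2 * M.B ^ 2 * Λ := by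
    have hC0 : 0 ≤ 4 * C + 2 * M.B ^ 2 * Λ := by positivity
    calc _ = ‖a‖ ^ 2 * (((k - 1 : ℕ) : ℝ) * g ^ 2) := by ring
      _ ≤ ‖a‖ ^ 2 * (4 * (∑ s ∈ Finset.Ico 1 k,
            M.margin i (θ' i) (o s).x (o s).y₁ (o s).y₂ ^ 2) + (4 * C + 2 * M.B ^ 2 * Λ)) := by
          refine mul_le_mul_of_nonneg_left ?_ ha0
          linarith
      _ ≤ _ := by nlinarith
  refine hmain.trans ?_
  have hL : 0 ≤ Λ + 1 := by linarith
  have hE0 : 0 ≤ E := by linarith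
  have hm0 : (0 : ℝ) ≤ m := by linarith
  -- All terms are absorbed into one monomial using `m, E ≥ 1`: here `516 = 1 + 3 + 512`, and below
  -- `66048 + 512 + 2 ≤ 67000`.
  have p1 : Λ + 3 * E + 4 * E ^ 4 * (m * C) ≤ 516 * (m ^ 2 * E ^ 7 * (Λ + 1)) := by
    have q1 : 1 ≤ (m : ℝ) ^ 2 := one_le_pow₀ hm
    have q2 : E ≤ E ^ 7 := le_self_pow₀ hE (by norm_num)
    have q3 : E ^ 7 * (Λ + 1) ≤ m ^ 2 * E ^ 7 * (Λ + 1) := by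
      rw [mul_assoc]
      exact le_mul_of_one_le_left (by positivity) q1
    have q4 : E * (Λ + 1) ≤ E ^ 7 * (Λ + 1) := mul_le_mul_of_nonneg_right q2 hL
    have q5 : E * 1 ≤ E * (Λ + 1) := mul_le_mul_of_nonneg_left (by linarith) hE0
    have q6 : 1 * (Λ + 1) ≤ E * (Λ + 1) := mul_le_mul_of_nonneg_right hE hL
    have q7 : 4 * E ^ 4 * (m * C) = 512 * (m ^ 2 * E ^ 7 * (Λ + 1)) := by rw [hC]; ring
    linarith
  have p2 : 4 * (32 * (m * E) * (Λ + 3 * E + 4 * E ^ 4 * (m * C))) ≤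
      66048 * (m ^ 3 * E ^ 8 * (Λ + 1)) := by
    calc _ ≤ 4 * (32 * (m * E) * (516 * (m ^ 2 * E ^ 7 * (Λ + 1)))) := by gcongr
      _ = _ := by ring
  have p3 : 4 * C ≤ 512 * (m ^ 3 * E ^ 8 * (Λ + 1)) := by
    calc 4 * C = 512 * (m * E ^ 3 * (Λ + 1)) := by rw [hC]; ring
      _ ≤ _ := by
        gcongr
        · exact le_self_pow₀ hm (by norm_num)
        · norm_num
  have p4 : 2 * M.B ^ 2 * Λ ≤ 2 * (m ^ 3 * E ^ 8 * (Λ + 1)) := by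
    have q1 : M.B ^ 2 ≤ E ^ 8 := (pow_le_pow_left₀ (by linarith) hEB 2).trans
      (pow_le_pow_right₀ hE (by norm_num))
    have q2 : 1 ≤ (m : ℝ) ^ 3 := one_le_pow₀ hm
    calc _ = 2 * (1 * M.B ^ 2 * Λ) := by ring
      _ ≤ 2 * (m ^ 3 * E ^ 8 * (Λ + 1)) := by
        gcongr
        linarith
  have p5 : 0 ≤ m ^ 3 * E ^ 8 * (Λ + 1) := by positivity
  linarith

end Deterministic

/-- A finite net of the joint parameter space of the weights and the rewards. -/
lemma exists_param_net (hM : M.Valid) {t : ℕ} (ht : 1 ≤ t) :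
    ∃ G : Finset ((Fin m → ℝ) × (Fin m → EuclideanSpace ℝ (Fin d))),
      (∀ x ∈ G, x.1 ∈ stdSimplex ℝ (Fin m) ∧ ∀ i, x.2 i ∈ M.paramSet i) ∧
      (G.card : ℝ) ≤ (2 * M.B * (t * (2 * d + 1)) + 1) ^ (m + m * d) ∧
      ∀ α ∈ stdSimplex ℝ (Fin m), ∀ θ : Fin m → EuclideanSpace ℝ (Fin d),
        (∀ i, θ i ∈ M.paramSet i) → ∃ x ∈ G, (∀ i, |α i - x.1 i| ≤ 1 / t) ∧
          ∀ i ξ y₁ y₂, |M.margin i (θ i) ξ y₁ y₂ - M.margin i (x.2 i) ξ y₁ y₂| ≤ 1 / t := by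
  have hB := hM.one_le_B
  have ht0 : (0 : ℝ) < t := by exact_mod_cast ht
  -- A margin pairs `θ` with a vector of coordinates at most `2`, so mesh `ε` changes it by at most
  -- `2 * d * ε ≤ 1 / t`. The summand `1` keeps the mesh at most `1 / t` for the weights and covers
  -- `d = 0`.
  have hε : (0 : ℝ) < 1 / (t * (2 * d + 1)) := by positivity
  obtain ⟨G, h1, h2, h3⟩ := exists_finite_net
    {x : (Fin m → ℝ) × (Fin m → EuclideanSpace ℝ (Fin d)) |
      x.1 ∈ stdSimplex ℝ (Fin m) ∧ ∀ i, x.2 i ∈ M.paramSet i}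
    (fun x => Sum.elim x.1 fun ij : Fin m × Fin d => x.2 ij.1 ij.2) (r := M.B) hε
    (by
      rintro x ⟨hx1, hx2⟩ (i | ⟨i, j⟩)
      · have := mem_Icc_of_mem_stdSimplex hx1 i
        simp only [Sum.elim_inl]
        rw [abs_of_nonneg this.1]
        linarith [this.2]
      · exact (PiLp.norm_apply_le (x.2 i) j).trans (hx2 i).1)
  refine ⟨G, h1, ?_, fun α hα θ hθ => ?_⟩
  · have e : Fintype.card (Fin m ⊕ Fin m × Fin d) = m + m * d := by simp
    rw [e] at h2
    calc (G.card : ℝ) ≤ ((⌊2 * M.B / (1 / (t * (2 * d + 1)))⌋₊ : ℝ) + 1) ^ (m + m * d) := by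
          exact_mod_cast h2
      _ ≤ _ := by
          gcongr
          refine (Nat.floor_le (by positivity)).trans_eq ?_
          rw [div_div_eq_mul_div, div_one]
  · obtain ⟨x, hx, hc⟩ := h3 (α, θ) ⟨hα, hθ⟩
    have hd : (0 : ℝ) ≤ d := Nat.cast_nonneg d
    refine ⟨x, hx, fun i => (hc (Sum.inl i)).trans ?_, fun i ξ y₁ y₂ => ?_⟩
    · refine one_div_le_one_div_of_le ht0 ?_
      nlinarith
    · have e : M.margin i (θ i) ξ y₁ y₂ - M.margin i (x.2 i) ξ y₁ y₂ =
          inner ℝ (θ i - x.2 i) (M.φ i ξ y₁ - M.φ i ξ y₂) := by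
        simp only [margin, reward, inner_sub_left, inner_sub_right]
        ring
      rw [e, PiLp.inner_apply]
      calc _ ≤ ∑ j : Fin d, 2 * (1 / (t * (2 * d + 1) : ℝ)) := by
            refine (Finset.abs_sum_le_sum_abs _ _).trans (Finset.sum_le_sum fun j _ => ?_)
            have q1 := hc (Sum.inr (i, j))
            simp only [Sum.elim_inr] at q1
            have q2 : |(M.φ i ξ y₁ - M.φ i ξ y₂) j| ≤ 2 := by
              refine (PiLp.norm_apply_le (M.φ i ξ y₁ - M.φ i ξ y₂) j).trans ?_
              linarith [norm_sub_le (M.φ i ξ y₁) (M.φ i ξ y₂), hM.norm_φ_le i ξ y₁,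
                hM.norm_φ_le i ξ y₂]
            have q3 : inner ℝ ((θ i - x.2 i) j) ((M.φ i ξ y₁ - M.φ i ξ y₂) j) =
                (M.φ i ξ y₁ - M.φ i ξ y₂) j * (θ i j - x.2 i j) := by
              simp [mul_comm]
            rw [q3, abs_mul]
            exact mul_le_mul q2 q1 (abs_nonneg _) (by norm_num)
        _ = 2 * d * (1 / (t * (2 * d + 1))) := by simp; ring
        _ ≤ 1 / t := by
            rw [mul_one_div, div_le_div_iff₀ (by positivity) ht0]
            nlinarith

/-- It yields `γ ≤ B`, so the error of the first round, made without data, is at most `exp B / γ`.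
-/
lemma gap_le (hM : M.Valid) (π : 𝒳 → PMF 𝒴) (i : Fin m) : M.gap π i ≤ M.B := by
  have hB : ∀ x y₁ y₂, |(|M.margin i (M.θstar i) x y₁ y₂|)| ≤ M.B := fun x y₁ y₂ => by
    rw [abs_abs]; exact abs_margin_le (hM.θstar_mem i) x y₁ y₂
  exact (le_abs_self _).trans (abs_tsum_pmf_mul_le M.ρ fun x =>
    abs_tsum_pmf_mul_le (π x) fun y₁ => abs_tsum_pmf_mul_le (M.πref x) (hB x y₁))

end Model

/-! ### From executions of the algorithm to a uniform event. -/

section Execution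

variable {Ω 𝒳 𝒴 : Type*} {N m d T : ℕ} [MeasurableSpace 𝒴] [mΩ : MeasurableSpace Ω]
  {M : Model 𝒳 𝒴 N m d} {μ : Measure Ω} {ℱ : Filtration ℕ mΩ} {R : Trajectory Ω 𝒳 𝒴 N m d}

lemma IsExecution.dir_mem (hR : IsExecution M T μ ℱ R) (hM : M.Valid) {t : ℕ}
    (ht : t ∈ Finset.Icc 1 T) (ω : Ω) : R.dir t ω ∈ stdSimplex ℝ (Fin m) := by
  rw [Finset.mem_Icc] at ht
  obtain rfl | h := ht.1.eq_or_lt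
  · exact hR.dir_one ω
  · obtain ⟨s, rfl⟩ : ∃ s, t = s + 1 := ⟨t - 1, by omega⟩
    exact (hR.dir_succ s (Finset.mem_Icc.2 ⟨by omega, by omega⟩) ω).mem_stdSimplex hM.goal_valid
      fun n z hz w hw => targetSet_upward hz hw

lemma IsExecution.ratioBound [Countable 𝒴] [DiscreteMeasurableSpace 𝒴]
    (hR : IsExecution M T μ ℱ R) (hM : M.Valid) {t : ℕ} (ht : t ∈ Finset.Icc 1 T) (ω : Ω) :
    M.RatioBound (R.π t ω) := by
  have hdir := hR.dir_mem hM ht ω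
  rcases hR.step t ht ω with h | h
  · exact h.2.2.ratioBound hM.β_pos h.1 hdir
  · exact Model.ratioBound_of_gibbs hM.β_pos (Model.sum_mul_reward_mem h.1 hdir) h.2.2

/-- The unspecified initial value `R.α 0` has weight zero in the recursion. -/
lemma IsExecution.smul_α (hR : IsExecution M T μ ℱ R) {t : ℕ} (ht : t ≤ T) (ω : Ω) (n : Fin N) :
    (t : ℝ) • R.α t ω n = ∑ k ∈ Finset.Icc 1 t, R.αhat k ω n := by
  induction t with
  | zero => simp
  | succ t ih =>
    rw [Finset.sum_Icc_succ_top (by omega), ← ih (by omega),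
      hR.α_eq (t + 1) (Finset.mem_Icc.2 ⟨by omega, ht⟩), smul_add, smul_smul, smul_smul]
    have : ((t + 1 : ℕ) : ℝ) ≠ 0 := by positivity
    rw [mul_div_cancel₀ _ this, mul_one_div_cancel this, one_smul]
    simp

lemma IsExecution.norm_sub_α_le (hR : IsExecution M T μ ℱ R) {t : ℕ} (ht : t ∈ Finset.Icc 1 T)
    (ω : Ω) (n : Fin N) :
    ‖M.αstar n - R.α t ω n‖ ≤
      1 / (t : ℝ) * ∑ k ∈ Finset.Icc 1 t, ‖M.αstar n - R.αhat k ω n‖ := by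
  rw [Finset.mem_Icc] at ht
  have ht0 : (0 : ℝ) < t := by exact_mod_cast ht.1
  have h := hR.smul_α ht.2 ω n
  have e : (t : ℝ) • (M.αstar n - R.α t ω n) = ∑ k ∈ Finset.Icc 1 t, (M.αstar n - R.αhat k ω n) := by
    rw [smul_sub, h, Finset.sum_sub_distrib, Finset.sum_const, Nat.card_Icc, Nat.add_sub_cancel,
      Nat.cast_smul_eq_nsmul]
  have h2 := norm_sum_le (Finset.Icc 1 t) fun k => M.αstar n - R.αhat k ω n
  rw [← e, norm_smul, Real.norm_of_nonneg ht0.le] at h2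
  rw [one_div, le_inv_mul_iff₀ ht0]
  exact h2

/-- The uniform bound on the errors of the weights, outside of an event of probability `δ`. -/
lemma IsExecution.exists_event [Countable 𝒳] [Countable 𝒴] [DiscreteMeasurableSpace 𝒴]
    [IsProbabilityMeasure μ] [NeZero m] (hR : IsExecution M T μ ℱ R) (hM : M.Valid)
    {πstar : 𝒳 → PMF 𝒴} (hπ : M.IsOptimal πstar) {γ : ℝ} (hγ : 0 < γ)
    (hgap : ∀ i, γ ≤ M.gap πstar i) (n : Fin N) {t : ℕ} (ht : t ∈ Finset.Icc 1 T)
    {δ : ℝ} (hδ : δ ∈ Set.Ioo (0 : ℝ) 1) {Λ : ℝ}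
    (hΛ : Λ = Real.log (1 / δ) + Real.log (t + 1) + Real.log (2 * m + 1) +
      (m + m * d) * Real.log (2 * M.B * (t * (2 * d + 1)) + 1)) :
    ∃ A : Set Ω, MeasurableSet A ∧ μ A ≤ ENNReal.ofReal δ ∧ ∀ ω ∉ A, ∀ k ∈ Finset.Icc 1 t,
      ∃ v : ℝ, 0 ≤ v ∧ ‖M.αstar n - R.αhat k ω n‖ ≤ v + 1 / t ∧
        ((k - 1 : ℕ) : ℝ) * (γ / Real.exp (M.B / M.β) ^ 3 * v) ^ 2 ≤
          67000 * m ^ 3 * Real.exp M.B ^ 8 * (Λ + 1) := by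
  have hB := hM.one_le_B
  obtain ⟨ht1, htT⟩ := Finset.mem_Icc.1 ht
  have ht0 : (0 : ℝ) < t := by exact_mod_cast ht1
  obtain ⟨G, hG, hGcard, hGnet⟩ := Model.exists_param_net hM ht1
  set g := γ / Real.exp (M.B / M.β) ^ 3 with hg
  have hstar : M.RatioBound πstar :=
    Model.ratioBound_of_pareto hM.β_pos hM.θstar_mem hπ.kl_ne_top hπ.pareto
  -- Each net point carries one weight test (`none`) and one preference test per objective; the
  -- margin tests do not depend on the net.
  let J := (G × Option (Fin m)) ⊕ Fin m
  let f : J → Round 𝒳 𝒴 N m → ℝ := Sum.elim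
    (fun j => j.2.elim (M.weightTest n j.1.1.1 j.1.1.2) fun i => M.prefTest i (j.1.1.2 i))
    (fun i => M.marginTest g i)
  have hsub : ∀ s ∈ Finset.Icc 1 t, s ∈ Finset.Icc 1 T := fun s hs =>
    Finset.Icc_subset_Icc_right htT hs
  have : Countable (Round 𝒳 𝒴 N m) := Model.roundEquiv.injective.countable
  -- The horizon is `t`, not the total number of rounds, so only `log t` enters `Λ`.
  obtain ⟨A, hA, hμ, hgood⟩ := exists_bad_event (μ := μ) (ℱ := ℱ) (T := t) (obs := R.obs)
    (q := fun s ω o => M.roundProb (R.π s ω) o) (fun s ω o => Model.roundProb_nonneg _ _)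
    (fun s hs => hR.obs_measurable s (hsub s hs)) (fun s hs => hR.obs_law s (hsub s hs)) (f := f)
    (by
      rintro (⟨x, _ | i⟩ | i) s hs ω
      · exact Model.tsum_exp_weightTest_le hM _ n _ (hG x x.2).2
      · exact Model.tsum_exp_prefTest_le hM _ i _
      · exact Model.tsum_exp_marginTest_le hM (hR.ratioBound hM (hsub s hs) ω) hstar hγ (hgap i))
    Λ
  have hlogs : 0 ≤ Real.log (1 / δ) ∧ 0 ≤ Real.log ((t : ℝ) + 1) ∧
      0 ≤ Real.log (2 * (m : ℝ) + 1) ∧ 0 ≤ Real.log (2 * M.B * (t * (2 * d + 1)) + 1) :=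
    ⟨Real.log_nonneg (by rw [le_div_iff₀ hδ.1]; linarith [hδ.2]),
      Real.log_nonneg (by linarith), Real.log_nonneg (by linarith [Nat.cast_nonneg (α := ℝ) m]),
      Real.log_nonneg (by
        have : 0 ≤ 2 * M.B * ((t : ℝ) * (2 * d + 1)) := by positivity
        linarith)⟩
  have hΛ0 : 0 ≤ Λ := by
    rw [hΛ]
    have := mul_nonneg (show (0 : ℝ) ≤ m + m * d by positivity) hlogs.2.2.2
    linarith [hlogs.1, hlogs.2.1, hlogs.2.2.1]
  refine ⟨A, hA, hμ.trans (ENNReal.ofReal_le_ofReal ?_), fun ω hω k hk => ?_⟩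
  · set K := 2 * M.B * ((t : ℝ) * (2 * d + 1)) + 1 with hK
    have hK1 : 1 ≤ K := by
      have : 0 ≤ 2 * M.B * ((t : ℝ) * (2 * d + 1)) := by positivity
      linarith
    have hKp : 1 ≤ K ^ (m + m * d) := one_le_pow₀ hK1
    have hJ : (Fintype.card J : ℝ) ≤ (2 * m + 1) * K ^ (m + m * d) := by
      simp only [J, Fintype.card_sum, Fintype.card_prod, Fintype.card_coe, Fintype.card_option,
        Fintype.card_fin]
      push_cast
      nlinarith [Nat.cast_nonneg (α := ℝ) m]
    have hexp : Real.exp Λ = 1 / δ * (t + 1) * (2 * m + 1) * K ^ (m + m * d) := by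
      rw [hΛ, Real.exp_add, Real.exp_add, Real.exp_add, Real.exp_log (by positivity [hδ.1]),
        Real.exp_log (by positivity), Real.exp_log (by positivity)]
      congr 1
      have : ((m : ℝ) + m * d) = ((m + m * d : ℕ) : ℝ) := by push_cast; ring
      rw [this, Real.exp_nat_mul, Real.exp_log (by linarith)]
    rw [Real.exp_neg, ← div_eq_mul_inv, div_le_iff₀ (Real.exp_pos _), hexp]
    calc _ ≤ ((t : ℝ) + 1) * ((2 * m + 1) * K ^ (m + m * d)) := by gcongr
      _ = _ := by
        have := hδ.1.ne'
        field_simp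
  · obtain ⟨hk1, hkt⟩ := Finset.mem_Icc.1 hk
    have hkT := hsub k hk
    -- The tests are valid for fixed parameters only, so the estimates of round `k` are replaced by
    -- a net point within `1 / t`.
    obtain ⟨x, hx, hx1, hx2⟩ := hGnet _ (hR.αhat_mem k hkT ω n) _ (hR.θMLE_mem k hkT ω)
    have hIco : Finset.Ico 1 k = Finset.Icc 1 (k - 1) := by ext s; simp; omega
    have htests : ∀ j : J, ∑ s ∈ Finset.Ico 1 k, f j (R.obs s ω) ≤ Λ := fun j => by
      rw [hIco]; exact hgood ω hω j (k - 1) (by omega)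
    have hmain := Model.mul_sq_norm_sub_le (o := fun s => R.obs s ω) (n := n) hM hkt ht1 hΛ0
      (hR.αhat_mem k hkT ω n) (hG x hx).1 (hG x hx).2 (hR.θMLE_min k hkT ω) (hR.αhat_max k hkT ω n)
      hx2 hx1 (fun i => htests (Sum.inl (⟨x, hx⟩, some i))) (htests (Sum.inl (⟨x, hx⟩, none)))
      (fun i => htests (Sum.inr i))
    refine ⟨‖x.1 - M.αstar n‖, norm_nonneg _, ?_, hmain⟩
    have h1 : ‖x.1 - R.αhat k ω n‖ ≤ 1 / t :=
      (pi_norm_le_iff_of_nonneg (by positivity)).2 fun i => by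
        rw [Pi.sub_apply, Real.norm_eq_abs, abs_sub_comm]; exact hx1 i
    have h2 := norm_sub_le_norm_sub_add_norm_sub (M.αstar n) x.1 (R.αhat k ω n)
    rw [norm_sub_rev (M.αstar n) x.1] at h2
    linarith

end Execution

/-! ### Telescoping the errors of the rounds. -/

section Rate

lemma sum_sqrt_sub_sqrt (t : ℕ) :
    ∑ k ∈ Finset.Icc 1 t, (√(k : ℝ) - √((k - 1 : ℕ) : ℝ)) = √(t : ℝ) := by
  induction t with
  | zero => simp
  | succ t ih => rw [Finset.sum_Icc_succ_top (by omega), ih]; simp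

/-- A bound of order `1 / √k` on the `k`-th error, in a form that telescopes. -/
lemma le_mul_sqrt_sub_sqrt {k : ℕ} (hk : 2 ≤ k) {g v c : ℝ} (hg : 0 < g) (hv : 0 ≤ v)
    (hc : 1 ≤ c) (h : ((k - 1 : ℕ) : ℝ) * (g * v) ^ 2 ≤ c) :
    v ≤ 4 * (c / g) * (√(k : ℝ) - √((k - 1 : ℕ) : ℝ)) := by
  set a := √((k - 1 : ℕ) : ℝ) with ha
  set b := √(k : ℝ) with hb
  have ha2 : a ^ 2 = ((k - 1 : ℕ) : ℝ) := Real.sq_sqrt (Nat.cast_nonneg _)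
  have hb2 : b ^ 2 = k := Real.sq_sqrt (Nat.cast_nonneg _)
  have hk1 : ((k - 1 : ℕ) : ℝ) = k - 1 := by rw [Nat.cast_sub (by omega)]; simp
  have hk2 : (2 : ℝ) ≤ k := by exact_mod_cast hk
  have ha1 : 1 ≤ a := by rw [ha, Real.one_le_sqrt, hk1]; linarith
  have hb0 : 0 ≤ b := Real.sqrt_nonneg _
  have hba : b ≤ 3 * a := by nlinarith
  have hprod : (b - a) * (b + a) = 1 := by nlinarith
  have hab : 0 ≤ b - a := by nlinarith
  -- Here `b + a ≤ 4 * a`, so the increment `b - a = 1 / (b + a)` dominates `1 / (4 * a)`.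
  have h1 : 1 ≤ 4 * a * (b - a) := by nlinarith
  -- Replacing `c` by `c ^ 2` avoids `√c`, so the final bound stays polynomial.
  have h2 : (a * (g * v)) ^ 2 ≤ c ^ 2 := by
    rw [mul_pow, ha2]; nlinarith
  have h3 : a * (g * v) ≤ c := le_of_sq_le_sq h2 (by linarith)
  have h4 : a * v ≤ c / g := by rw [le_div_iff₀ hg]; linarith
  calc v = v * 1 := (mul_one v).symm
    _ ≤ v * (4 * a * (b - a)) := by gcongr
    _ = 4 * (a * v) * (b - a) := by ring
    _ ≤ _ := by gcongr

end Rate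

/-! ### The explicit rate. -/

section Conclusion

/-- The polynomial of the estimation rate, in the variables `m`, `exp B`, `exp (B / β)`, `d`,
`log (1 / δ)`. -/
def ratePolynomial : MvPolynomial (Fin 5) ℝ :=
  2 * .X 1 + 268000 * .X 0 ^ 3 * .X 1 ^ 8 *
    (2 + .X 4 + 2 * .X 0 + .X 0 * (1 + .X 3) * (2 + .X 1 + 2 * .X 3)) * .X 2 ^ 3

lemma eval_ratePolynomial (a b c e l : ℝ) :
    MvPolynomial.eval ![a, b, c, e, l] ratePolynomial =
      2 * b + 268000 * a ^ 3 * b ^ 8 * (2 + l + 2 * a + a * (1 + e) * (2 + b + 2 * e)) * c ^ 3 := by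
  simp [ratePolynomial]

/-- The confidence level grows logarithmically with the number of rounds. -/
lemma confidence_le {m d t : ℕ} {B L : ℝ} (hB : 1 ≤ B) (hL : 0 ≤ L) (ht : 1 ≤ t) :
    L + Real.log (t + 1) + Real.log (2 * m + 1) +
        (m + m * d) * Real.log (2 * B * (t * (2 * d + 1)) + 1) + 1 ≤
      (2 + L + 2 * m + m * (1 + d) * (2 + Real.exp B + 2 * d)) * (1 + Real.log t) := by
  have ht1 : (1 : ℝ) ≤ t := by exact_mod_cast ht
  have hd : (0 : ℝ) ≤ d := Nat.cast_nonneg d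
  have hm : (0 : ℝ) ≤ m := Nat.cast_nonneg m
  have hlt : 0 ≤ Real.log t := Real.log_nonneg ht1
  have hlog2 : Real.log 2 ≤ 1 := by linarith [Real.log_le_sub_one_of_pos (zero_lt_two (α := ℝ))]
  have h1 : Real.log ((t : ℝ) + 1) ≤ 1 + Real.log t := by
    calc _ ≤ Real.log (2 * t) := Real.log_le_log (by linarith) (by linarith)
      _ ≤ _ := by rw [Real.log_mul two_ne_zero (by linarith)]; linarith
  have h2 : Real.log (2 * (m : ℝ) + 1) ≤ 2 * m := by
    linarith [Real.log_le_sub_one_of_pos (x := 2 * (m : ℝ) + 1) (by positivity)]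
  have h3 : Real.log (2 * B * ((t : ℝ) * (2 * d + 1)) + 1) ≤
      2 + Real.exp B + 2 * d + Real.log t := by
    have hE : B + 1 ≤ Real.exp B := Real.add_one_le_exp B
    have q : (1 : ℝ) ≤ B * (t * (2 * d + 1)) := by
      have : (1 : ℝ) ≤ 2 * d + 1 := by linarith
      have : (1 : ℝ) ≤ t * (2 * d + 1) := one_le_mul_of_one_le_of_one_le ht1 this
      exact one_le_mul_of_one_le_of_one_le hB this
    calc _ ≤ Real.log (3 * (B * (t * (2 * d + 1)))) :=
          Real.log_le_log (by positivity) (by linarith)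
      _ = Real.log 3 + (Real.log B + (Real.log t + Real.log (2 * d + 1))) := by
          rw [Real.log_mul (by norm_num) (by linarith), Real.log_mul (by linarith)
            (by positivity), Real.log_mul (by linarith) (by positivity)]
      _ ≤ _ := by
          have q1 := Real.log_le_sub_one_of_pos (x := (3 : ℝ)) (by norm_num)
          have q2 := Real.log_le_sub_one_of_pos (x := B) (by linarith)
          have q3 := Real.log_le_sub_one_of_pos (x := 2 * (d : ℝ) + 1) (by positivity)
          linarith
  have h4 : ((m : ℝ) + m * d) * Real.log (2 * B * (t * (2 * d + 1)) + 1) ≤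
      m * (1 + d) * (2 + Real.exp B + 2 * d) * (1 + Real.log t) := by
    have hE := Real.exp_pos B
    calc _ ≤ ((m : ℝ) + m * d) * ((2 + Real.exp B + 2 * d) * (1 + Real.log t)) := by
          refine mul_le_mul_of_nonneg_left (h3.trans ?_) (by positivity)
          nlinarith
      _ = _ := by ring
  nlinarith [mul_nonneg hL hlt, mul_nonneg hm hlt]

variable {Ω 𝒳 𝒴 : Type*} {N m d T : ℕ} [MeasurableSpace 𝒴] [mΩ : MeasurableSpace Ω]
  {M : Model 𝒳 𝒴 N m d} {μ : Measure Ω} {ℱ : Filtration ℕ mΩ} {R : Trajectory Ω 𝒳 𝒴 N m d}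

lemma IsExecution.prob_rate_ge [Countable 𝒳] [Countable 𝒴] [DiscreteMeasurableSpace 𝒴]
    [IsProbabilityMeasure μ] (hR : IsExecution M T μ ℱ R) (hM : M.Valid)
    {πstar : 𝒳 → PMF 𝒴} (hπ : M.IsOptimal πstar) {γ : ℝ} (hγ : 0 < γ)
    (hgap : ∀ i, γ ≤ M.gap πstar i) (n : Fin N) {t : ℕ} (ht : t ∈ Finset.Icc 1 T)
    {δ : ℝ} (hδ : δ ∈ Set.Ioo (0 : ℝ) 1) :
    ENNReal.ofReal (1 - δ) ≤ μ {ω | 1 / (t : ℝ) * ∑ k ∈ Finset.Icc 1 t,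
      ‖M.αstar n - R.αhat k ω n‖ ≤ γ⁻¹ * (MvPolynomial.eval
        ![(m : ℝ), Real.exp M.B, Real.exp (M.B / M.β), (d : ℝ), Real.log (1 / δ)] ratePolynomial *
          (1 + Real.log t)) * (1 / √t)} := by
  have hm0 : m ≠ 0 := by
    rintro rfl
    simpa using (hM.αstar_mem n).2
  have : NeZero m := ⟨hm0⟩
  have hB := hM.one_le_B
  obtain ⟨ht1, htT⟩ := Finset.mem_Icc.1 ht
  have ht1' : (1 : ℝ) ≤ t := by exact_mod_cast ht1
  obtain ⟨A, hA, hμ, hgood⟩ := hR.exists_event hM hπ hγ hgap n ht hδ rfl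
  have hL : 0 ≤ Real.log (1 / δ) :=
    Real.log_nonneg (by rw [le_div_iff₀ hδ.1]; linarith [hδ.2])
  have hconf := confidence_le (m := m) (d := d) hB hL ht1
  set Λ₁ := Real.log (1 / δ) + Real.log (t + 1) + Real.log (2 * m + 1) +
      (m + m * d) * Real.log (2 * M.B * (t * (2 * d + 1)) + 1) + 1
  set Λ₀ := 2 + Real.log (1 / δ) + 2 * m + m * (1 + d) * (2 + Real.exp M.B + 2 * d) with hΛ₀
  set r := 1 + Real.log (t : ℝ) with hr
  set E := Real.exp M.B with hE
  set F := Real.exp (M.B / M.β) with hF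
  have hr1 : 1 ≤ r := by linarith [Real.log_nonneg ht1']
  have hEB : M.B ≤ E := by linarith [Real.add_one_le_exp M.B]
  have hE1 : 1 ≤ E := hB.trans hEB
  have hF0 : 0 < F := Real.exp_pos _
  have hm1 : (1 : ℝ) ≤ m := by exact_mod_cast NeZero.one_le
  have hd0 : (0 : ℝ) ≤ d := Nat.cast_nonneg d
  have hΛ₀1 : 1 ≤ Λ₀ := by
    have : 0 ≤ (m : ℝ) * (1 + d) * (2 + E + 2 * d) := by positivity
    linarith
  set c := 67000 * (m : ℝ) ^ 3 * E ^ 8 * (Λ₀ * r) with hc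
  have hc1 : 1 ≤ c := by
    have q1 : 1 ≤ (m : ℝ) ^ 3 := one_le_pow₀ hm1
    have q2 : 1 ≤ E ^ 8 := one_le_pow₀ hE1
    have q3 : 1 ≤ Λ₀ * r := one_le_mul_of_one_le_of_one_le hΛ₀1 hr1
    refine one_le_mul_of_one_le_of_one_le (one_le_mul_of_one_le_of_one_le ?_ q2) q3
    linarith
  have hγE : 1 ≤ E / γ := by
    rw [le_div_iff₀ hγ, one_mul]
    exact (hgap 0).trans ((Model.gap_le hM πstar 0).trans hEB)
  -- The first summand pays for round `1`, where `√1 - √0 = 1`; the second is the telescoping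
  -- constant of the later rounds.
  set D := E / γ + 4 * (c / (γ / F ^ 3)) with hD
  have hD2 : 0 ≤ 4 * (c / (γ / F ^ 3)) := by positivity
  have hbound : ∀ ω ∉ A, ∀ k ∈ Finset.Icc 1 t, ‖M.αstar n - R.αhat k ω n‖ ≤
      1 / t + D * (√(k : ℝ) - √((k - 1 : ℕ) : ℝ)) := by
    intro ω hω k hk
    obtain ⟨hk1, hkt⟩ := Finset.mem_Icc.1 hk
    obtain rfl | hk2 := hk1.eq_or_lt
    · have h1 : ‖M.αstar n - R.αhat 1 ω n‖ ≤ 1 := by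
        refine (pi_norm_le_iff_of_nonneg zero_le_one).2 fun i => ?_
        have h1 := mem_Icc_of_mem_stdSimplex (hM.αstar_mem n) i
        have h2 := mem_Icc_of_mem_stdSimplex
          (hR.αhat_mem 1 (Finset.mem_Icc.2 ⟨le_rfl, ht1.trans htT⟩) ω n) i
        simp only [Pi.sub_apply, Real.norm_eq_abs]
        exact abs_le.2 ⟨by linarith [h1.1, h2.2], by linarith [h1.2, h2.1]⟩
      have h2 : 0 ≤ 1 / (t : ℝ) := by positivity
      simp only [Nat.cast_one, Real.sqrt_one, Nat.sub_self, Nat.cast_zero, Real.sqrt_zero,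
        sub_zero, mul_one]
      linarith
    · obtain ⟨v, hv, hle, hsq⟩ := hgood ω hω k hk
      have h1 := le_mul_sqrt_sub_sqrt hk2 (g := γ / F ^ 3) (by positivity) hv hc1
        (hsq.trans (mul_le_mul_of_nonneg_left hconf (by positivity)))
      have h2 : 0 ≤ √(k : ℝ) - √((k - 1 : ℕ) : ℝ) :=
        sub_nonneg.2 (Real.sqrt_le_sqrt (by exact_mod_cast Nat.sub_le k 1))
      have h3 : 4 * (c / (γ / F ^ 3)) * (√(k : ℝ) - √((k - 1 : ℕ) : ℝ)) ≤
          D * (√(k : ℝ) - √((k - 1 : ℕ) : ℝ)) :=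
        mul_le_mul_of_nonneg_right (by linarith) h2
      linarith
  have hs0 : 0 < √(t : ℝ) := Real.sqrt_pos.2 (by linarith)
  have hs1 : 1 ≤ √(t : ℝ) := Real.one_le_sqrt.2 ht1'
  have hsub : Aᶜ ⊆ {ω | 1 / (t : ℝ) * ∑ k ∈ Finset.Icc 1 t,
      ‖M.αstar n - R.αhat k ω n‖ ≤ γ⁻¹ * (MvPolynomial.eval
        ![(m : ℝ), E, F, (d : ℝ), Real.log (1 / δ)] ratePolynomial * r) * (1 / √t)} := by
    intro ω hω
    have hsum : ∑ k ∈ Finset.Icc 1 t, ‖M.αstar n - R.αhat k ω n‖ ≤ 1 + D * √t := by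
      refine (Finset.sum_le_sum (hbound ω hω)).trans_eq ?_
      rw [Finset.sum_add_distrib, ← Finset.mul_sum, sum_sqrt_sub_sqrt, Finset.sum_const,
        Nat.card_Icc, Nat.add_sub_cancel, nsmul_eq_mul, mul_one_div_cancel (by linarith)]
    have hfinal : 1 + D ≤ γ⁻¹ * (MvPolynomial.eval
        ![(m : ℝ), E, F, (d : ℝ), Real.log (1 / δ)] ratePolynomial * r) := by
      rw [eval_ratePolynomial, ← hΛ₀]
      -- The coefficient is `268000 = 4 * 67000`, and `2 * (E / γ)` leaves room for the total
      -- rounding error `1 ≤ E / γ`.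
      have e : γ⁻¹ * ((2 * E + 268000 * (m : ℝ) ^ 3 * E ^ 8 * Λ₀ * F ^ 3) * r) =
          2 * (E / γ) * r + 4 * (c / (γ / F ^ 3)) := by
        rw [hc]; field_simp; ring
      rw [e]
      nlinarith
    calc _ ≤ 1 / (t : ℝ) * (1 + D * √t) := by gcongr
      _ ≤ 1 / (t : ℝ) * ((1 + D) * √t) := by gcongr; linarith
      _ = (1 + D) * (1 / √t) := by
          rw [← Real.sqrt_div_self']; ring
      _ ≤ _ := by gcongr
  calc ENNReal.ofReal (1 - δ) = 1 - ENNReal.ofReal δ := by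
        rw [ENNReal.ofReal_sub _ hδ.1.le, ENNReal.ofReal_one]
    _ ≤ 1 - μ A := tsub_le_tsub_left hμ 1
    _ = μ Aᶜ := (prob_compl_eq_one_sub hA).symm
    _ ≤ _ := measure_mono hsub

end Conclusion

end MORLHF

end

theorem mainTheorem5 :
    ∃ (P : MvPolynomial (Fin 5) ℝ) (k : ℕ),
      ∀ (𝒳 𝒴 Ω : Type*) [Countable 𝒳] [Countable 𝒴]
        [MeasurableSpace 𝒴] [DiscreteMeasurableSpace 𝒴]
        [mΩ : MeasurableSpace Ω] (μ : MeasureTheory.Measure Ω)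
        [MeasureTheory.IsProbabilityMeasure μ]
        (N m d T : ℕ) (M : MORLHF.Model 𝒳 𝒴 N m d) (_hM : M.Valid)
        (πstar : 𝒳 → PMF 𝒴) (_hπ : M.IsOptimal πstar)
        (γ : ℝ) (_hγ : 0 < γ) (_hgap : ∀ i, γ ≤ M.gap πstar i)
        (ℱ : MeasureTheory.Filtration ℕ mΩ) (R : MORLHF.Trajectory Ω 𝒳 𝒴 N m d)
        (_hR : MORLHF.IsExecution M T μ ℱ R)
        (n : Fin N) (t : ℕ) (_ht : t ∈ Finset.Icc 1 T) (δ : ℝ) (_hδ : δ ∈ Set.Ioo (0 : ℝ) 1),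
        ENNReal.ofReal (1 - δ) ≤
          μ {ω |
            ‖M.αstar n - R.α t ω n‖ ≤
                1 / (t : ℝ) * ∑ k ∈ Finset.Icc 1 t, ‖M.αstar n - R.αhat k ω n‖ ∧
            1 / (t : ℝ) * ∑ k ∈ Finset.Icc 1 t, ‖M.αstar n - R.αhat k ω n‖ ≤
              γ⁻¹ * (MvPolynomial.eval
                  ![(m : ℝ), Real.exp M.B, Real.exp (M.B / M.β), (d : ℝ), Real.log (1 / δ)] P *
                (1 + Real.log t) ^ k) * (1 / Real.sqrt t)} := by
  refine ⟨MORLHF.ratePolynomial, 1, ?_⟩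
  intro 𝒳 𝒴 Ω _ _ _ _ mΩ μ _ N m d T M hM πstar hπ γ hγ hgap ℱ R hR n t ht δ hδ
  -- The first inequality is the triangle inequality for the running average and holds for every
  -- outcome, so only the second costs probability.
  refine (hR.prob_rate_ge hM hπ hγ hgap n ht hδ).trans (MeasureTheory.measure_mono fun ω hω => ?_)
  refine ⟨hR.norm_sub_α_le ht ω n, ?_⟩
  rw [pow_one]
  exact hω
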